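/- Let $\Bbbk$ be an algebraically closed field and let $A$ be a finite dimensional $\Bbbk$-algebra which is basic, connected, not simple and self-injective, with a decomposition $1=e_1+\dots+e_n$ into pairwise orthogonal primitive idempotents. Let $\mathcal C$ be a $\Bbbk$-linear category equivalent to the category of finite dimensional left $A$-modules, and let $\mathscr C_A$ be the 2-category with one object (identified with $\mathcal C$), whose 1-morphisms are the endofunctors of $\mathcal C$ isomorphic to direct summands of finite direct sums of copies of the identity functor and of the functors $(Ae\otimes_{\Bbbk} fA)\otimes_A-$, with $e,f$ idempotents of $A$, and whose 2-morphisms are all natural transformations. On indecomposable 1-morphisms write $F\le_L G$ if $G$ is isomorphic to a direct summand of $H\circ F$ for some 1-morphism $H$; the equivalence classes (up to isomorphism of 1-morphisms) are the left cells. Let $\mathcal L_0$ be the left cell of the identity functor, let $\mathcal L_i$ be the left cell of $(Ae_i\otimes_{\Bbbk} e_iA)\otimes_A-$ for $1\le i\le n$, and put $\mathcal J=\mathcal L_1\cup\dots\cup\mathcal L_n$. For a left cell $\mathcal L$, the cell 2-representation $\mathbf C_{\mathcal L}$ is the sub-2-representation of the principal 2-representation (the left action of $\mathscr C_A$ on itself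 by composition) generated by $\mathcal L$, modulo its largest ideal that is stable under the action and contains no identity morphism of an element of $\mathcal L$. Let $\mathbf M$ be a finitary 2-representation of $\mathscr C_A$: a $\Bbbk$-linear action of $\mathscr C_A$ on an additive, idempotent split $\Bbbk$-linear category $M$ with finite dimensional morphism spaces and finitely many indecomposable objects up to isomorphism. For indecomposable objects write $X\to Y$ if $Y$ is isomorphic to a direct summand of $FX$ for some 1-morphism $F$. This is a preorder; the vertices of the diagram of $\mathbf M$ are the classes of the associated equivalence relation, partially ordered by $\to$, and the diagram of $\mathbf M$ is the Hasse diagram of this poset. If $\rho\to\tau$ is a covering relation, the edge between $\rho$ and $\tau$ is decorated by the set $\Theta_{\tau,\rho}$ of all isomorphism classes of indecomposable 1-morphisms $F$ such that, for some $X\in\rho$, the object $FX$ has a direct summand in $\tau$. Let $Q$ be a set of vertices closed under $\to$ (that is, $\sigma\in Q$ and $\sigma\to\sigma'$ imply $\sigma'\in Q$), and let $\rho$ be a vertex in $Q$ such that no other vertex $\sigma\in Q$ satisfies $\sigma\to\rho$. The simple transitive subquotient of $\mathbf M$ at $(Q,\rho)$ is the sub-2-representation generated by the indecomposable objects belonging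 to $Q$, modulo its largest ideal that is stable under the action and contains no identity morphism of an object in $\rho$. (These are the subquotients occurring in weak Jordan-Hölder series of $\mathbf M$.) Two 2-representations are equivalent if there is a $\Bbbk$-linear equivalence between the underlying categories that commutes with the action up to coherent natural isomorphisms. Then the diagram of $\mathbf M$ is a bipartite graph: its set of vertices is a disjoint union $\Gamma_0^{(0)}\sqcup\Gamma_0^{(1)}$ such that each edge connects a vertex in $\Gamma_0^{(0)}$ with a vertex in $\Gamma_0^{(1)}$, where, for all $(Q,\rho)$ as above, $\rho\in\Gamma_0^{(0)}$ if and only if the simple transitive subquotient at $(Q,\rho)$ is equivalent to $\mathbf C_{\mathcal L_0}$, and $\rho\in\Gamma_0^{(1)}$ if and only if it is equivalent to $\mathbf C_{\mathcal L_1}$ (equivalently, to $\mathbf C_{\mathcal L_i}$ for any given $i\in\{1,\dots,n\}$). Moreover, in the decorated diagram of $\mathbf M$ each edge is decorated by a union of left cells from $\mathcal J$. -/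

import Mathlib

open CategoryTheory CategoryTheory.Limits MonoidalCategory MonoidalRightAction
open scoped TensorProduct

universe u

namespace TwoRep

/-! ### Additive categories -/

section Additive

variable {D : Type*} [Category* D] [Preadditive D]

/-- The additive closure of a class `S` of objects: all direct summands of finite direct sums of
objects in `S`. (That `X` is such a summand is expressed by writing the identity of `X` as a
finite sum of endomorphisms that factor through objects in `S`.) -/
def addClosure (S : ObjectProperty D) : ObjectProperty D := fun X =>
  ∃ (n : ℕ) (Y : Fin n → D) (p : ∀ i, X ⟶ Y i) (q : ∀ i, Y i ⟶ X),
    (∀ i, S (Y i)) ∧ ∑ i, p i ≫ q i = 𝟙 X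

lemma addClosure_of_fintype {S : ObjectProperty D} {X : D} {ι : Type*} [Fintype ι]
    (Y : ι → D) (p : ∀ i, X ⟶ Y i) (q : ∀ i, Y i ⟶ X) (hS : ∀ i, S (Y i))
    (h : ∑ i, p i ≫ q i = 𝟙 X) : addClosure S X := by
  classical
  refine ⟨Fintype.card ι, fun i => Y ((Fintype.equivFin ι).symm i), fun i => p _, fun i => q _,
    fun i => hS _, ?_⟩
  rw [← h]
  exact Equiv.sum_comp (Fintype.equivFin ι).symm (fun i => p i ≫ q i)

lemma addClosure_trans {S : ObjectProperty D} {X : D} {ι : Type*} [Fintype ι]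
    (Y : ι → D) (p : ∀ i, X ⟶ Y i) (q : ∀ i, Y i ⟶ X) (hS : ∀ i, addClosure S (Y i))
    (h : ∑ i, p i ≫ q i = 𝟙 X) : addClosure S X := by
  choose n Z a b hZ hab using hS
  refine addClosure_of_fintype (ι := Σ i, Fin (n i)) (fun j => Z j.1 j.2)
    (fun j => p j.1 ≫ a j.1 j.2) (fun j => b j.1 j.2 ≫ q j.1) (fun j => hZ _ _) ?_
  rw [Fintype.sum_sigma, ← h]
  refine Finset.sum_congr rfl fun i _ => ?_
  calc ∑ j, (p i ≫ a i j) ≫ b i j ≫ q i = p i ≫ (∑ j, a i j ≫ b i j) ≫ q i := by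
        simp [Preadditive.sum_comp, Preadditive.comp_sum]
    _ = p i ≫ q i := by rw [hab]; simp

lemma addClosure_of_mem {S : ObjectProperty D} {X : D} (h : S X) : addClosure S X :=
  addClosure_of_fintype (ι := Unit) (fun _ => X) (fun _ => 𝟙 X) (fun _ => 𝟙 X) (fun _ => h)
    (by simp)

/-- Indecomposable objects: nonzero, and in any decomposition as a direct sum of two objects
one of the two is zero. -/
def IsIndec (X : D) : Prop :=
  ¬ IsZero X ∧ ∀ ⦃Y Z : D⦄ (b : BinaryBicone Y Z), Nonempty b.IsBilimit →
    Nonempty (b.pt ≅ X) → IsZero Y ∨ IsZero Z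

/-- Finitary `k`-linear categories: additive, idempotent split, with finite-dimensional morphism
spaces and finitely many indecomposable objects up to isomorphism. (The Krull-Schmidt property is
a consequence.) -/
structure IsFinitary (k : Type*) [Field k] (D : Type*) [Category* D] [Preadditive D]
    [Linear k D] : Prop where
  hasFiniteBiproducts : HasFiniteBiproducts D
  isIdempotentComplete : IsIdempotentComplete D
  finiteDimensional_hom : ∀ X Y : D, FiniteDimensional k (X ⟶ Y)
  finite_indec : ∃ (n : ℕ) (X : Fin n → D), ∀ Y : D, IsIndec Y → ∃ i, Nonempty (Y ≅ X i)

end Additive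

/-! ### Actions of a monoidal category, alias `2`-representations

A `2`-category with one object is a monoidal category `𝒞`. In the examples below the monoidal
product `F ⊗ G` of two `1`-morphisms is "first `F`, then `G`" (Mathlib's `F ⋙ G`, usually
written `G ∘ F`), so that a `2`-representation on a category `M` is a right action of `𝒞`, and
`X ⊙ᵣ F` is the object that is usually written `F X`. The structure isomorphisms of the action are
not required to be identities; strict `2`-functors are the case where they are. -/

section Actions

variable (k : Type*) [Field k] (𝒞 : Type*) [Category* 𝒞] [MonoidalCategory 𝒞]
  [Preadditive 𝒞] [Linear k 𝒞]

/-- The action is additive: every `1`-morphism acts by an additive functor, and the assignment of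
natural transformations to `2`-morphisms is additive. -/
class AdditiveAction (𝒞 : Type*) [Category* 𝒞] [MonoidalCategory 𝒞] [Preadditive 𝒞]
    (M : Type*) [Category* M] [Preadditive M] [MonoidalRightAction 𝒞 M] : Prop where
  add_left : ∀ {X Y : M} (f g : X ⟶ Y) (F : 𝒞), (f + g) ⊵ᵣ F = f ⊵ᵣ F + g ⊵ᵣ F
  add_right : ∀ (X : M) {F G : 𝒞} (α β : F ⟶ G), X ⊴ᵣ (α + β) = X ⊴ᵣ α + X ⊴ᵣ β

/-- The (additive) action is `k`-linear: every `1`-morphism acts by a `k`-linear functor, and the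
assignment of natural transformations to `2`-morphisms is `k`-linear. -/
class LinearAction (M : Type*) [Category* M] [Preadditive M] [Linear k M]
    [MonoidalRightAction 𝒞 M] [AdditiveAction 𝒞 M] : Prop where
  smul_left : ∀ {X Y : M} (r : k) (f : X ⟶ Y) (F : 𝒞), (r • f) ⊵ᵣ F = r • (f ⊵ᵣ F)
  smul_right : ∀ (X : M) {F G : 𝒞} (r : k) (α : F ⟶ G), X ⊴ᵣ (r • α) = r • (X ⊴ᵣ α)

/-- Equivalence of `2`-representations: a `2`-natural transformation (a `k`-linear functor that
commutes with the action up to coherent natural isomorphisms) which is an equivalence of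
categories. -/
def Equivalent (M N : Type*) [Category* M] [Preadditive M] [Linear k M] [MonoidalRightAction 𝒞 M]
    [Category* N] [Preadditive N] [Linear k N] [MonoidalRightAction 𝒞 N] : Prop :=
  ∃ Φ : M ⥤ N, Φ.IsEquivalence ∧ Φ.Additive ∧ Φ.Linear k ∧ Nonempty (Φ.RightLinear 𝒞)

end Actions

/-! ### The action preorder and diagrams -/

section Diagram

variable (𝒞 : Type*) [Category* 𝒞] [MonoidalCategory 𝒞]

/-- `Y` is isomorphic to a direct summand of `F X` for some `1`-morphism `F`. -/
def ActsOnto {M : Type*} [Category* M] [MonoidalRightAction 𝒞 M] (X Y : M) : Prop :=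
  ∃ F : 𝒞, Nonempty (Retract Y (X ⊙ᵣ F))

lemma ActsOnto.refl {M : Type*} [Category* M] [MonoidalRightAction 𝒞 M] (X : M) :
    ActsOnto 𝒞 X X :=
  ⟨𝟙_ 𝒞, ⟨{ i := (ρᵣ[𝒞] X).inv, r := (ρᵣ[𝒞] X).hom }⟩⟩

lemma ActsOnto.trans {M : Type*} [Category* M] [MonoidalRightAction 𝒞 M] {X Y Z : M}
    (h₁ : ActsOnto 𝒞 X Y) (h₂ : ActsOnto 𝒞 Y Z) : ActsOnto 𝒞 X Z := by
  obtain ⟨F, ⟨a⟩⟩ := h₁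
  obtain ⟨G, ⟨b⟩⟩ := h₂
  refine ⟨F ⊗ G, ⟨{ i := b.i ≫ a.i ⊵ᵣ G ≫ (αᵣ X F G).inv
                    r := (αᵣ X F G).hom ≫ a.r ⊵ᵣ G ≫ b.r
                    retract := ?_ }⟩⟩
  have h : a.i ⊵ᵣ G ≫ a.r ⊵ᵣ G = 𝟙 _ := by
    rw [← MonoidalRightAction.comp_actionHomLeft, a.retract,
      MonoidalRightAction.id_actionHomLeft]
  simp [reassoc_of% h]

variable (M : Type*) [Category* M] [Preadditive M] [MonoidalRightAction 𝒞 M]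

/-- The indecomposable objects of `M`. Isomorphic objects are not identified here; all notions
below that refer to indecomposable objects are invariant under isomorphism. -/
def Ind (_𝒞 : Type*) (M : Type*) [Category* M] [Preadditive M] : Type _ := {X : M // IsIndec X}

/-- The action preorder on indecomposable objects. -/
instance : Preorder (Ind 𝒞 M) where
  le X Y := ActsOnto 𝒞 X.1 Y.1
  le_refl X := ActsOnto.refl 𝒞 X.1
  le_trans _ _ _ := ActsOnto.trans 𝒞

/-- The vertices of the diagram of `M`: equivalence classes of indecomposable objects for the
equivalence relation associated with the action preorder, with the induced partial order. -/
abbrev Vertex : Type _ := Antisymmetrization (Ind 𝒞 M) (· ≤ ·)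

/-- The diagram of `M` is the Hasse diagram of the poset of vertices. -/
def diagram : SimpleGraph (Vertex 𝒞 M) := SimpleGraph.hasse (Vertex 𝒞 M)

variable {M}

/-- The indecomposable object `X` belongs to the vertex `ρ`. -/
def Ind.MemVertex (X : Ind 𝒞 M) (ρ : Vertex 𝒞 M) : Prop := toAntisymmetrization (· ≤ ·) X = ρ

/-- The decoration of the edge between `ρ` and `τ`, where `ρ ⋖ τ`: all indecomposable
`1`-morphisms `F` such that `F X` has a direct summand in `τ` for some `X` in `ρ`. -/
def decoration [Preadditive 𝒞] (ρ τ : Vertex 𝒞 M) : Set (Ind 𝒞 𝒞) :=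
  {F | ∃ X Y : Ind 𝒞 M, X.MemVertex 𝒞 ρ ∧ Y.MemVertex 𝒞 τ ∧ Nonempty (Retract Y.1 (X.1 ⊙ᵣ F.1))}

/-- The left cell of a `1`-morphism `G`. The left preorder on `1`-morphisms is the action preorder
of the action of `𝒞` on itself: `F ≤ G` if `G` is a direct summand of "`F` followed by `H`" for
some `H`. -/
def leftCell {𝒞 : Type*} [Category* 𝒞] [MonoidalCategory 𝒞] [Preadditive 𝒞] (G : 𝒞) :
    Set (Ind 𝒞 𝒞) :=
  {F | ActsOnto 𝒞 F.1 G ∧ ActsOnto 𝒞 G F.1}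

end Diagram

/-! ### Sub-`2`-representations -/

section Sub

variable (k : Type*) [Field k] (𝒞 : Type*) [Category* 𝒞] [MonoidalCategory 𝒞]
  [Preadditive 𝒞] [Linear k 𝒞]
  {M : Type*} [Category* M] [Preadditive M] [Linear k M] [MonoidalRightAction 𝒞 M]

/-- A class of objects that is stable under the action. -/
class ActionStable (P : ObjectProperty M) : Prop where
  prop_action : ∀ (X : M) (F : 𝒞), P X → P (X ⊙ᵣ F)

/-- The action on a full subcategory that is stable under the action. -/
instance subAction (P : ObjectProperty M) [ActionStable 𝒞 P] :
    MonoidalRightAction 𝒞 P.FullSubcategory where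
  actionObj X F := ⟨X.obj ⊙ᵣ F, ActionStable.prop_action _ _ X.property⟩
  actionHomLeft f F := ObjectProperty.homMk (f.hom ⊵ᵣ F)
  actionHomRight X _ _ α := ObjectProperty.homMk (X.obj ⊴ᵣ α)
  actionHom f α := ObjectProperty.homMk (f.hom ⊙ᵣₘ α)
  actionAssocIso X F G := P.isoMk (αᵣ X.obj F G)
  actionUnitIso X := P.isoMk (ρᵣ X.obj)
  actionHom_def f g := by ext; exact MonoidalRightAction.actionHom_def _ _
  actionHomRight_id c d := by ext; exact MonoidalRightAction.actionHomRight_id _ _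
  id_actionHomLeft c d := by ext; exact MonoidalRightAction.id_actionHomLeft _ _
  actionHom_comp _ _ _ _ := by ext; exact MonoidalRightAction.actionHom_comp _ _ _ _
  actionAssocIso_hom_naturality _ _ _ := by
    ext; exact MonoidalRightAction.actionAssocIso_hom_naturality _ _ _
  actionUnitIso_hom_naturality _ := by
    ext; exact MonoidalRightAction.actionUnitIso_hom_naturality _
  actionHomRight_whiskerRight _ _ _ := by
    ext; exact MonoidalRightAction.actionHomRight_whiskerRight _ _ _
  whiskerRight_actionHomLeft _ _ _ _ _ := by
    ext; exact MonoidalRightAction.whiskerRight_actionHomLeft _ _ _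
  actionHom_associator _ _ _ _ := by
    ext; exact MonoidalRightAction.actionHom_associator _ _ _ _
  actionHom_leftUnitor _ _ := by ext; exact MonoidalRightAction.actionHom_leftUnitor _ _
  actionHom_rightUnitor _ _ := by ext; exact MonoidalRightAction.actionHom_rightUnitor _ _

instance subAction_additive [AdditiveAction 𝒞 M] (P : ObjectProperty M) [ActionStable 𝒞 P] :
    AdditiveAction 𝒞 P.FullSubcategory where
  add_left f g F := by ext; exact AdditiveAction.add_left f.hom g.hom F
  add_right X _ _ α β := by ext; exact AdditiveAction.add_right X.obj α β

instance subAction_linear [AdditiveAction 𝒞 M] [LinearAction k 𝒞 M] (P : ObjectProperty M)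
    [ActionStable 𝒞 P] : LinearAction k 𝒞 P.FullSubcategory where
  smul_left r f F := by ext; exact LinearAction.smul_left r f.hom F
  smul_right X _ _ r α := by ext; exact LinearAction.smul_right X.obj r α

end Sub

section Generated

variable (𝒞 : Type*) [Category* 𝒞] [MonoidalCategory 𝒞] [Preadditive 𝒞]
  {M : Type*} [Category* M] [Preadditive M] [MonoidalRightAction 𝒞 M]

/-- The objects of the sub-`2`-representation generated by a class `S` of objects: the additive
closure of all `F Y`, where `Y` is in `S` and `F` is a `1`-morphism. -/
def generated (S : ObjectProperty M) : ObjectProperty M :=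
  addClosure (fun X => ∃ (Y : M) (F : 𝒞), S Y ∧ Nonempty (X ≅ Y ⊙ᵣ F))

instance generated_action [AdditiveAction 𝒞 M] (S : ObjectProperty M) :
    ActionStable 𝒞 (generated 𝒞 S) where
  prop_action X F hX := by
    obtain ⟨n, Y, p, q, hY, h⟩ := hX
    refine ⟨n, fun i => Y i ⊙ᵣ F, fun i => p i ⊵ᵣ F, fun i => q i ⊵ᵣ F, fun i => ?_, ?_⟩
    · obtain ⟨Z, G, hZ, ⟨e⟩⟩ := hY i
      refine ⟨Z, G ⊗ F, hZ, ⟨?_ ≪≫ (αᵣ Z G F).symm⟩⟩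
      exact { hom := e.hom ⊵ᵣ F
              inv := e.inv ⊵ᵣ F
              hom_inv_id := by
                rw [← MonoidalRightAction.comp_actionHomLeft, e.hom_inv_id,
                  MonoidalRightAction.id_actionHomLeft]
              inv_hom_id := by
                rw [← MonoidalRightAction.comp_actionHomLeft, e.inv_hom_id,
                  MonoidalRightAction.id_actionHomLeft] }
    · let φ : (X ⟶ X) →+ (X ⊙ᵣ F ⟶ X ⊙ᵣ F) :=
        AddMonoidHom.mk' (fun f => f ⊵ᵣ F) (fun f g => AdditiveAction.add_left f g F)
      have := congrArg φ h
      rw [map_sum] at this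
      simpa [φ, MonoidalRightAction.comp_actionHomLeft] using this

end Generated

/-! ### Stable ideals and quotients -/

section Ideals

variable (k : Type*) [Field k] (𝒞 : Type*) [Category* 𝒞] [MonoidalCategory 𝒞]
  (D : Type*) [Category* D] [Preadditive D] [Linear k D] [MonoidalRightAction 𝒞 D]

/-- Two-sided ideals of the category `D` which are stable under the action. -/
structure StableIdeal where
  /-- the morphisms from `X` to `Y` in the ideal -/
  hom : ∀ X Y : D, AddSubgroup (X ⟶ Y)
  comp_left : ∀ {X Y Z : D} (f : X ⟶ Y) {g : Y ⟶ Z}, g ∈ hom Y Z → f ≫ g ∈ hom X Z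
  comp_right : ∀ {X Y Z : D} {f : X ⟶ Y} (g : Y ⟶ Z), f ∈ hom X Y → f ≫ g ∈ hom X Z
  action : ∀ {X Y : D} {f : X ⟶ Y} (F : 𝒞), f ∈ hom X Y → f ⊵ᵣ F ∈ hom (X ⊙ᵣ F) (Y ⊙ᵣ F)

variable {D}

/-- The sum of all stable ideals that contain none of the identity morphisms of the objects
in `R`, that is, the smallest stable ideal that contains all of them. -/
def avoidingIdeal (R : ObjectProperty D) : StableIdeal 𝒞 D where
  hom X Y :=
    { carrier := {f | ∀ J : StableIdeal 𝒞 D,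
        (∀ I : StableIdeal 𝒞 D, (∀ Z, R Z → 𝟙 Z ∉ I.hom Z Z) →
          ∀ U V : D, I.hom U V ≤ J.hom U V) → f ∈ J.hom X Y}
      add_mem' := fun hf hg J hJ => add_mem (hf J hJ) (hg J hJ)
      zero_mem' := fun _ _ => zero_mem _
      neg_mem' := fun hf J hJ => neg_mem (hf J hJ) }
  comp_left f _ hg J hJ := J.comp_left f (hg J hJ)
  comp_right g hf J hJ := J.comp_right g (hf J hJ)
  action F hf J hJ := J.action F (hf J hJ)

variable {𝒞}

/-- Two morphisms are congruent modulo an ideal if their difference lies in the ideal. -/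
def StableIdeal.rel (I : StableIdeal 𝒞 D) : HomRel D := fun X Y f g => f - g ∈ I.hom X Y

instance (I : StableIdeal 𝒞 D) : Congruence I.rel where
  equivalence :=
    { refl := fun f => by simp [StableIdeal.rel]
      symm := fun {f g} h => by
        have := neg_mem h
        rwa [neg_sub] at this
      trans := fun {f g h} h₁ h₂ => by
        have := add_mem h₁ h₂
        rwa [sub_add_sub_cancel] at this }
  comp_left f g g' h := by
    have := I.comp_left f h
    rwa [Preadditive.comp_sub] at this
  comp_right g h := by
    have := I.comp_right g h
    rwa [Preadditive.sub_comp] at this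

lemma StableIdeal.rel_add (I : StableIdeal 𝒞 D) ⦃X Y : D⦄ (f₁ f₂ g₁ g₂ : X ⟶ Y)
    (hf : I.rel f₁ f₂) (hg : I.rel g₁ g₂) : I.rel (f₁ + g₁) (f₂ + g₂) := by
  have := add_mem hf hg
  rwa [sub_add_sub_comm] at this

lemma StableIdeal.rel_smul (I : StableIdeal 𝒞 D) (r : k) ⦃X Y : D⦄ (f₁ f₂ : X ⟶ Y)
    (hf : I.rel f₁ f₂) : I.rel (r • f₁) (r • f₂) := by
  have := I.comp_left (r • 𝟙 X) hf
  rwa [Linear.smul_comp, Category.id_comp, smul_sub] at this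

/-- The quotient of `D` by a stable ideal: the same objects, and morphisms modulo the ideal. -/
abbrev StableIdeal.QuotCat (I : StableIdeal 𝒞 D) := CategoryTheory.Quotient I.rel

instance (I : StableIdeal 𝒞 D) : Preadditive I.QuotCat := Quotient.preadditive I.rel I.rel_add

instance (I : StableIdeal 𝒞 D) : (CategoryTheory.Quotient.functor I.rel).Additive :=
  CategoryTheory.Quotient.functor_additive I.rel I.rel_add

instance (I : StableIdeal 𝒞 D) : Linear k I.QuotCat := Quotient.linear k I.rel (I.rel_smul k)

variable [Preadditive 𝒞] [AdditiveAction 𝒞 D]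

/-- The functor on the quotient by which a `1`-morphism acts. -/
def StableIdeal.actionFunctor (I : StableIdeal 𝒞 D) (F : 𝒞) : I.QuotCat ⥤ I.QuotCat :=
  CategoryTheory.Quotient.lift I.rel
    { obj := fun X => (CategoryTheory.Quotient.functor I.rel).obj (X ⊙ᵣ F)
      map := fun f => (CategoryTheory.Quotient.functor I.rel).map (f ⊵ᵣ F)
      map_id := fun X => by rw [MonoidalRightAction.id_actionHomLeft, CategoryTheory.Functor.map_id]
      map_comp := fun f g => by rw [MonoidalRightAction.comp_actionHomLeft, CategoryTheory.Functor.map_comp] }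
    (fun X Y f g h => by
      refine CategoryTheory.Quotient.sound _ ?_
      let φ : (X ⟶ Y) →+ (X ⊙ᵣ F ⟶ Y ⊙ᵣ F) :=
        AddMonoidHom.mk' (fun f => f ⊵ᵣ F) (fun f g => AdditiveAction.add_left f g F)
      have h' : φ (f - g) ∈ I.hom _ _ := I.action F h
      rw [map_sub] at h'
      exact h')

/-- The induced action on the quotient by a stable ideal. -/
instance StableIdeal.quotAction (I : StableIdeal 𝒞 D) : MonoidalRightAction 𝒞 I.QuotCat where
  actionObj X F := ⟨X.as ⊙ᵣ F⟩
  actionHomLeft f F := (I.actionFunctor F).map f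
  actionHomRight X _ _ α := (CategoryTheory.Quotient.functor I.rel).map (X.as ⊴ᵣ α)
  actionHom {c c' d d'} f α :=
    (I.actionFunctor c).map f ≫ (CategoryTheory.Quotient.functor I.rel).map (d'.as ⊴ᵣ α)
  actionAssocIso X F G := (CategoryTheory.Quotient.functor I.rel).mapIso (αᵣ X.as F G)
  actionUnitIso X := (CategoryTheory.Quotient.functor I.rel).mapIso (ρᵣ X.as)
  actionHom_def f g := rfl
  actionHomRight_id c d := congrArg (CategoryTheory.Quotient.functor I.rel).map
    (MonoidalRightAction.actionHomRight_id c d.as)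
  id_actionHomLeft c d := congrArg (CategoryTheory.Quotient.functor I.rel).map
    (MonoidalRightAction.id_actionHomLeft c d.as)
  actionHom_comp := by
    rintro c c' c'' ⟨d⟩ ⟨d'⟩ ⟨d''⟩ ⟨f⟩ ⟨f'⟩ g g'
    refine congrArg (CategoryTheory.Quotient.functor I.rel).map ?_
    have := MonoidalRightAction.actionHom_comp f f' g g'
    rwa [actionHom_def, actionHom_def, actionHom_def] at this
  actionAssocIso_hom_naturality := by
    rintro ⟨d⟩ ⟨d'⟩ c₁ c₂ c₃ c₄ ⟨f⟩ g h
    refine congrArg (CategoryTheory.Quotient.functor I.rel).map ?_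
    have := MonoidalRightAction.actionAssocIso_hom_naturality f g h
    rwa [actionHom_def, actionHom_def, actionHom_def] at this
  actionUnitIso_hom_naturality := by
    rintro ⟨d⟩ ⟨d'⟩ ⟨f⟩
    exact congrArg (CategoryTheory.Quotient.functor I.rel).map
      (MonoidalRightAction.actionUnitIso_hom_naturality f)
  actionHomRight_whiskerRight f c d := congrArg (CategoryTheory.Quotient.functor I.rel).map
    (MonoidalRightAction.actionHomRight_whiskerRight f c d.as)
  whiskerRight_actionHomLeft c _ _ f d := congrArg (CategoryTheory.Quotient.functor I.rel).map
    (MonoidalRightAction.whiskerRight_actionHomLeft c f d.as)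
  actionHom_associator c₁ c₂ c₃ d := congrArg (fun f => (CategoryTheory.Quotient.functor I.rel).map f)
    (MonoidalRightAction.actionHom_associator c₁ c₂ c₃ d.as)
  actionHom_leftUnitor c d := congrArg (CategoryTheory.Quotient.functor I.rel).map
    (MonoidalRightAction.actionHom_leftUnitor c d.as)
  actionHom_rightUnitor c d := congrArg (CategoryTheory.Quotient.functor I.rel).map
    (MonoidalRightAction.actionHom_rightUnitor c d.as)

end Ideals

/-! ### Subquotients and cell `2`-representations -/

section Subquotients

variable (𝒞 : Type*) [Category* 𝒞] [MonoidalCategory 𝒞] [Preadditive 𝒞]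
  {M : Type*} [Category* M] [Preadditive M] [MonoidalRightAction 𝒞 M] [AdditiveAction 𝒞 M]

/-- The class of objects given by a set of indecomposable objects. -/
def ofSet (Q : Set (Ind 𝒞 M)) : ObjectProperty M := fun X => ∃ Y ∈ Q, Y.1 = X

/-- The indecomposable objects that belong to one of the vertices in `Q`. -/
def indOf (Q : Set (Vertex 𝒞 M)) : Set (Ind 𝒞 M) := {X | ∃ ρ ∈ Q, X.MemVertex 𝒞 ρ}

/-- The sub-`2`-representation generated by the indecomposable objects in `Q`, modulo the sum of
all its stable ideals that contain no identity morphism of an object in `R`. -/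
abbrev Subquotient (Q R : Set (Ind 𝒞 M)) : Type _ :=
  (avoidingIdeal 𝒞 (D := (generated 𝒞 (ofSet 𝒞 Q)).FullSubcategory)
    (fun X => ofSet 𝒞 R X.obj)).QuotCat

/-- For an upper set `Q` of vertices and a minimal element `ρ` of `Q`, the simple transitive
subquotient of `M` in the step from `Q \ {ρ}` to `Q` of a weak Jordan-Hölder series: the
sub-`2`-representation with the indecomposable objects in `Q`, modulo its largest stable ideal
that contains no identity morphism of an object in `ρ`. (This ideal contains the identity
morphisms of the objects in `Q \ {ρ}`.) -/
abbrev SimpleSubquotient (Q : Set (Vertex 𝒞 M)) (ρ : Vertex 𝒞 M) : Type _ :=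
  Subquotient 𝒞 (indOf 𝒞 Q) (indOf 𝒞 {ρ})

end Subquotients

section Cell

variable {𝒞 : Type*} [Category* 𝒞] [MonoidalCategory 𝒞] [Preadditive 𝒞] [AdditiveAction 𝒞 𝒞]

/-- The cell `2`-representation of a left cell `L`: the sub-`2`-representation generated by `L` of
the principal `2`-representation (the action of `𝒞` on itself), modulo its largest stable ideal
that contains no identity morphism of an element of `L`. -/
abbrev CellRep (L : Set (Ind 𝒞 𝒞)) : Type _ := Subquotient 𝒞 L L

end Cell

/-! ### Projective functors -/

section Projective

open scoped ModuleCat.Algebra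

variable (k : Type*) [Field k] (A : Type u) [Ring A] [Algebra k A] [FiniteDimensional k A]

attribute [local instance] ModuleCat.moduleOfAlgebraModule
  ModuleCat.isScalarTower_of_algebra_moduleCat endofunctorMonoidalCategory

/-- The `k`-subspace `f V` of a left `A`-module `V`. -/
abbrev corner {A : Type u} [Ring A] [Algebra k A] (f : A) (V : Type u) [AddCommGroup V]
    [Module k V] [Module A V] [IsScalarTower k A V] : Submodule k V :=
  LinearMap.range (Algebra.lsmul k k V f)

instance (V : FGModuleCat.{u} A) : Module.Finite k V.obj := Module.Finite.trans A V.obj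

instance (e f : A) (V : FGModuleCat.{u} A) :
    Module.Finite A (↥(Ideal.span {e}) ⊗[k] ↥(corner k f V.obj)) :=
  haveI : Module.Finite k ↥(Ideal.span {e}) :=
    Module.Finite.of_injective ((Ideal.span {e}).subtype.restrictScalars k)
      Subtype.val_injective
  Module.Finite.of_restrictScalars_finite k A _

/-- The map `f V → f W` induced by an `A`-linear map `V → W`. -/
def cornerMap (f : A) {V W : FGModuleCat.{u} A} (g : V ⟶ W) :
    ↥(corner k f V.obj) →ₗ[k] ↥(corner k f W.obj) :=
  LinearMap.restrict (g.hom.hom.restrictScalars k) (by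
    rintro _ ⟨v, rfl⟩
    exact ⟨g.hom.hom v, by simp⟩)

/-- The functor `Ae ⊗ fA ⊗_A -` on finite-dimensional left `A`-modules, where `fA ⊗_A V` is
identified with `f V` via `fa ⊗ v ↦ fav`, and `A` acts on the left tensor factor. -/
def bimoduleFunctor (e f : A) : FGModuleCat.{u} A ⥤ FGModuleCat.{u} A where
  obj V := FGModuleCat.of A (↥(Ideal.span {e}) ⊗[k] ↥(corner k f V.obj))
  map g := FGModuleCat.ofHom
    (TensorProduct.AlgebraTensorModule.lTensor A _ (cornerMap k A f g))
  map_id V := by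
    apply FGModuleCat.hom_ext
    apply TensorProduct.AlgebraTensorModule.ext
    intro a v
    rfl
  map_comp g h := by
    apply FGModuleCat.hom_ext
    apply TensorProduct.AlgebraTensorModule.ext
    intro a v
    rfl

instance (e f : A) : (bimoduleFunctor k A e f).Additive where
  map_add {V W g h} := by
    apply FGModuleCat.hom_ext
    apply TensorProduct.AlgebraTensorModule.ext
    intro a v
    exact TensorProduct.tmul_add a (cornerMap k A f g v) (cornerMap k A f h v)

instance (e f : A) : (bimoduleFunctor k A e f).Linear k where
  map_smul {V W} g r := by
    apply FGModuleCat.hom_ext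
    apply TensorProduct.AlgebraTensorModule.ext
    intro a v
    exact (TensorProduct.tmul_smul (R := k) r a (cornerMap k A f g v)).trans (algebraMap_smul A r (a ⊗ₜ[k] (cornerMap k A f g v))).symm

/-- Contraction with a linear form on `A`. -/
def contract (e f f' : A) (c : A →ₗ[k] k) (V : FGModuleCat.{u} A) :
    ↥(corner k f' ((bimoduleFunctor k A e f).obj V).obj) →ₗ[k] ↥(corner k f V.obj) where
  toFun x := TensorProduct.lid k _ (LinearMap.rTensor _
    (c ∘ₗ (Ideal.span {e}).subtype.restrictScalars k)
    (show ↥(Ideal.span {e}) ⊗[k] ↥(corner k f V.obj) from x.1))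
  map_add' x y := by
    erw [map_add, map_add]
  map_smul' r x := by
    have h : (show ↥(Ideal.span {e}) ⊗[k] ↥(corner k f V.obj) from (r • x).1) =
      r • (show ↥(Ideal.span {e}) ⊗[k] ↥(corner k f V.obj) from x.1) :=
      algebraMap_smul A r (show ↥(Ideal.span {e}) ⊗[k] ↥(corner k f V.obj) from x.1)
    rw [h, map_smul, map_smul]
    rfl

/-- The map sending `v` to `f' (b e ⊗ v)`. -/
def expand (e f f' b : A) (V : FGModuleCat.{u} A) :
    ↥(corner k f V.obj) →ₗ[k] ↥(corner k f' ((bimoduleFunctor k A e f).obj V).obj) where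
  toFun v := ⟨f' • ((⟨b * e, Ideal.mul_mem_left _ _ (Ideal.mem_span_singleton_self e)⟩ :
    ↥(Ideal.span {e})) ⊗ₜ[k] v), ⟨(show ↥(Ideal.span {e}) ⊗[k] ↥(corner k f V.obj) from
      (⟨b * e, Ideal.mul_mem_left _ _ (Ideal.mem_span_singleton_self e)⟩ :
        ↥(Ideal.span {e})) ⊗ₜ[k] v), rfl⟩⟩
  map_add' x y := by
    apply Subtype.ext
    exact (congrArg (f' • ·) (TensorProduct.tmul_add _ _ _)).trans (smul_add _ _ _)
  map_smul' r x := by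
    apply Subtype.ext
    let t : ↥(Ideal.span {e}) ⊗[k] ↥(corner k f V.obj) :=
      (⟨b * e, Ideal.mul_mem_left _ _ (Ideal.mem_span_singleton_self e)⟩ :
        ↥(Ideal.span {e})) ⊗ₜ[k] x
    have h₁ : f' • (r • t) = r • (f' • t) := smul_comm _ _ _
    have h₂ : algebraMap k A r • (f' • t) = r • (f' • t) := algebraMap_smul A r _
    exact (congrArg (f' • ·) (TensorProduct.tmul_smul _ _ _)).trans (h₁.trans h₂.symm)

lemma sum_expand_contract {ι : Type*} [Fintype ι] (b : Module.Basis ι k A) (e f f' : A)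
    (he : IsIdempotentElem e) (hf' : IsIdempotentElem f') (V : FGModuleCat.{u} A)
    (x : ↥(corner k f' ((bimoduleFunctor k A e f).obj V).obj)) :
    ∑ i, expand k A e f f' (b i) V (contract k A e f f' (b.coord i) V x) = x := by
  let T := ↥(Ideal.span {e}) ⊗[k] ↥(corner k f V.obj)
  have key : ∀ t : T, ∑ i, (⟨b i * e, Ideal.mul_mem_left _ _ (Ideal.mem_span_singleton_self e)⟩ :
      ↥(Ideal.span {e})) ⊗ₜ[k] (TensorProduct.lid k _ (LinearMap.rTensor _
        (b.coord i ∘ₗ (Ideal.span {e}).subtype.restrictScalars k) t)) = t := by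
    intro t
    induction t using TensorProduct.induction_on with
    | zero => simp
    | add s t hs ht =>
      simp only [map_add, TensorProduct.tmul_add, Finset.sum_add_distrib, hs, ht]
    | tmul a v =>
      simp only [LinearMap.rTensor_tmul, TensorProduct.lid_tmul, ← TensorProduct.smul_tmul,
        ← TensorProduct.sum_tmul]
      congr 1
      apply Subtype.ext
      obtain ⟨a, ha⟩ := a
      obtain ⟨c, rfl⟩ := Ideal.mem_span_singleton'.1 ha
      have : ∑ i, (b.repr (c * e) i • b i) * e = c * e := by
        rw [← Finset.sum_mul, b.sum_repr, mul_assoc, he.eq]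
      simpa using this
  obtain ⟨_, y, rfl⟩ := x
  apply Subtype.ext
  have h₁ : f' • (show T from f' • (show T from y)) = f' • (show T from y) := by
    rw [smul_smul, hf'.eq]
  refine Eq.trans ?_ h₁
  refine Eq.trans ?_ (congrArg (f' • ·) (key (f' • (show T from y))))
  refine Eq.trans ?_ (Finset.smul_sum (M := A) (N := T)).symm
  exact AddSubmonoidClass.coe_finsetSum _ _

/-- The natural transformation induced by `contract`. -/
def contractNat (e f e' f' : A) (c : A →ₗ[k] k) :
    bimoduleFunctor k A e f ⋙ bimoduleFunctor k A e' f' ⟶ bimoduleFunctor k A e' f where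
  app V := FGModuleCat.ofHom
    (TensorProduct.AlgebraTensorModule.lTensor A _ (contract k A e f f' c V))
  naturality V W g := by
    apply FGModuleCat.hom_ext
    apply TensorProduct.AlgebraTensorModule.ext
    intro a x
    refine congrArg (fun y => a ⊗ₜ[k] y) ?_
    have key : ∀ t : ↥(Ideal.span {e}) ⊗[k] ↥(corner k f V.obj),
        TensorProduct.lid k _ (LinearMap.rTensor _
          (c ∘ₗ (Ideal.span {e}).subtype.restrictScalars k)
          (LinearMap.lTensor _ (cornerMap k A f g) t)) =
        cornerMap k A f g (TensorProduct.lid k _ (LinearMap.rTensor _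
          (c ∘ₗ (Ideal.span {e}).subtype.restrictScalars k) t)) := by
      intro t
      induction t using TensorProduct.induction_on with
      | zero => simp
      | add s t hs ht => simp only [map_add, hs, ht]
      | tmul a v => simp
    exact key x.1

/-- The natural transformation induced by `expand`. -/
def expandNat (e f e' f' b : A) :
    bimoduleFunctor k A e' f ⟶ bimoduleFunctor k A e f ⋙ bimoduleFunctor k A e' f' where
  app V := FGModuleCat.ofHom
    (TensorProduct.AlgebraTensorModule.lTensor A _ (expand k A e f f' b V))
  naturality V W g := by
    apply FGModuleCat.hom_ext
    apply TensorProduct.AlgebraTensorModule.ext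
    intro a x
    refine congrArg (fun y => a ⊗ₜ[k] y) ?_
    apply Subtype.ext
    exact (((bimoduleFunctor k A e f).map g).hom.hom.map_smul f'
      (show ↥(Ideal.span {e}) ⊗[k] ↥(corner k f V.obj) from
        (⟨b * e, Ideal.mul_mem_left _ _ (Ideal.mem_span_singleton_self e)⟩ :
          ↥(Ideal.span {e})) ⊗ₜ[k] x)).symm

lemma sum_contractNat_expandNat {ι : Type*} [Fintype ι] (b : Module.Basis ι k A)
    (e f e' f' : A) (he : IsIdempotentElem e) (hf' : IsIdempotentElem f') :
    ∑ i, contractNat k A e f e' f' (b.coord i) ≫ expandNat k A e f e' f' (b i) = 𝟙 _ := by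
  apply NatTrans.ext
  funext V
  rw [NatTrans.app_sum]
  apply FGModuleCat.hom_ext
  apply TensorProduct.AlgebraTensorModule.ext
  intro a x
  have h := (TensorProduct.tmul_sum (R := k) a Finset.univ (fun i => expand k A e f f' (b i) V
    (contract k A e f f' (b.coord i) V x))).symm
  rw [sum_expand_contract k A b e f f' he hf' V x] at h
  refine Eq.trans ?_ h
  let B := bimoduleFunctor k A e f ⋙ bimoduleFunctor k A e' f'
  let φ : (B.obj V ⟶ B.obj V) →+ (B.obj V).obj :=
    AddMonoidHom.mk' (fun g => g.hom.hom (a ⊗ₜ[k] x)) (fun g h => rfl)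
  exact map_sum φ (fun i => (contractNat k A e f e' f' (b.coord i) ≫
    expandNat k A e f e' f' (b i)).app V) Finset.univ

variable {A} {C : Type*} [Category* C] [Preadditive C] (E : C ≌ FGModuleCat.{u} A)

/-- The functor `Ae ⊗ fA ⊗_A -` on a category `C` that is equivalent to the category of
finite-dimensional left `A`-modules. -/
def bimoduleFunctorOn (e f : A) : C ⥤ C := E.functor ⋙ bimoduleFunctor k A e f ⋙ E.inverse

/-- The projective functors on `C`: the functors isomorphic to direct summands of finite direct
sums of copies of the identity functor and of the functors `Ae ⊗ fA ⊗_A -`, where `e` and `f` are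
idempotents of `A`. -/
def projectiveFunctor : ObjectProperty (C ⥤ C) :=
  addClosure (fun F => F = 𝟭 C ∨
    ∃ e f : A, IsIdempotentElem e ∧ IsIdempotentElem f ∧ F = bimoduleFunctorOn k E e f)

instance (e f : A) [Linear k C] [E.functor.Linear k] : (bimoduleFunctorOn k E e f).Linear k := by
  unfold bimoduleFunctorOn
  infer_instance

lemma projectiveFunctor_linear [Linear k C] [E.functor.Linear k] {F : C ⥤ C} (hF : projectiveFunctor k E F)
    (r : k) {X Y : C} (g : X ⟶ Y) : F.map (r • g) = r • F.map g := by
  obtain ⟨n, G, p, q, hG, h⟩ := hF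
  have hG' : ∀ i, (G i).map (r • g) = r • (G i).map g := fun i => by
    rcases hG i with h | ⟨e, f, -, -, h⟩ <;> rw [h] <;> simp
  have key : ∀ f : X ⟶ Y, F.map f = ∑ i, (p i).app X ≫ (G i).map f ≫ (q i).app Y := fun f => by
    have := congrArg (fun α => F.map f ≫ α.app Y) h
    simp only [NatTrans.app_sum, Preadditive.comp_sum, NatTrans.comp_app, NatTrans.id_app,
      Category.comp_id] at this
    rw [← this]
    exact Finset.sum_congr rfl fun i _ => by simp
  rw [key, key g, Finset.smul_sum]
  exact Finset.sum_congr rfl fun i _ => by simp [hG']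

variable [E.functor.Additive]

instance (e f : A) : (bimoduleFunctorOn k E e f).Additive := by
  unfold bimoduleFunctorOn
  infer_instance

lemma projectiveFunctor_additive {F : C ⥤ C} (hF : projectiveFunctor k E F) : F.Additive := by
  obtain ⟨n, G, p, q, hG, h⟩ := hF
  have hG' : ∀ i, (G i).Additive := fun i => by
    rcases hG i with h | ⟨e, f, -, -, h⟩ <;> rw [h] <;> infer_instance
  refine ⟨fun {X Y f g} => ?_⟩
  have key : ∀ f : X ⟶ Y, F.map f = ∑ i, (p i).app X ≫ (G i).map f ≫ (q i).app Y := fun f => by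
    have := congrArg (fun α => F.map f ≫ α.app Y) h
    simp only [NatTrans.app_sum, Preadditive.comp_sum, NatTrans.comp_app, NatTrans.id_app,
      Category.comp_id] at this
    rw [← this]
    exact Finset.sum_congr rfl fun i _ => by simp
  rw [key, key f, key g, ← Finset.sum_add_distrib]
  exact Finset.sum_congr rfl fun i _ => by simp [(hG' i).map_add]

lemma bimoduleFunctorOn_comp (e f e' f' : A) (he : IsIdempotentElem e) (hf : IsIdempotentElem f)
    (he' : IsIdempotentElem e') (hf' : IsIdempotentElem f') :
    projectiveFunctor k E (bimoduleFunctorOn k E e f ⋙ bimoduleFunctorOn k E e' f') := by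
  let B := bimoduleFunctor k A e f
  let B' := bimoduleFunctor k A e' f'
  let b := Module.finBasis k A
  let θ : bimoduleFunctorOn k E e f ⋙ bimoduleFunctorOn k E e' f' ≅
      E.functor ⋙ (B ⋙ B') ⋙ E.inverse :=
    Functor.isoWhiskerLeft (E.functor ⋙ B) (Functor.isoWhiskerRight E.counitIso (B' ⋙ E.inverse))
  let W : (B ⋙ B' ⟶ B ⋙ B') →+
      (E.functor ⋙ (B ⋙ B') ⋙ E.inverse ⟶ E.functor ⋙ (B ⋙ B') ⋙ E.inverse) :=
    AddMonoidHom.mk' (fun α => Functor.whiskerLeft E.functor (Functor.whiskerRight α E.inverse))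
      (fun α β => by ext X; simp)
  refine addClosure_of_fintype (fun _ => bimoduleFunctorOn k E e' f)
    (fun i => θ.hom ≫ Functor.whiskerLeft E.functor
      (Functor.whiskerRight (contractNat k A e f e' f' (b.coord i)) E.inverse))
    (fun i => Functor.whiskerLeft E.functor
      (Functor.whiskerRight (expandNat k A e f e' f' (b i)) E.inverse) ≫ θ.inv)
    (fun _ => Or.inr ⟨e', f, he', hf, rfl⟩) ?_
  have h := congrArg W (sum_contractNat_expandNat k A b e f e' f' he hf')
  rw [map_sum] at h
  have hW : W (𝟙 _) = 𝟙 _ := by ext X; simp [W]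
  rw [hW] at h
  have h' := congrArg (fun α => θ.hom ≫ α ≫ θ.inv) h
  simp only [Preadditive.comp_sum, Preadditive.sum_comp, Category.id_comp, Iso.hom_inv_id] at h'
  rw [← h']
  refine Finset.sum_congr rfl fun i _ => ?_
  ext X
  simp only [W, AddMonoidHom.mk'_apply, Functor.whiskerRight_comp, Functor.whiskerLeft_comp,
    NatTrans.comp_app, Category.assoc]
  exact Category.assoc (θ.hom.app X) _ _

lemma projectiveFunctor_comp {F G : C ⥤ C} (hF : projectiveFunctor k E F)
    (hG : projectiveFunctor k E G) : projectiveFunctor k E (F ⋙ G) := by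
  have hGadd := projectiveFunctor_additive k E hG
  obtain ⟨n, Y, p, q, hY, h⟩ := hF
  let W : (F ⟶ F) →+ (F ⋙ G ⟶ F ⋙ G) :=
    AddMonoidHom.mk' (fun α => Functor.whiskerRight α G) (fun α β => by ext X; simp)
  refine addClosure_trans (fun i => Y i ⋙ G) (fun i => Functor.whiskerRight (p i) G)
    (fun i => Functor.whiskerRight (q i) G) (fun i => ?_) ?_
  · have hG' := hG
    obtain ⟨m, Z, p', q', hZ, h'⟩ := hG'
    let W' : (G ⟶ G) →+ (Y i ⋙ G ⟶ Y i ⋙ G) :=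
      AddMonoidHom.mk' (fun α => Functor.whiskerLeft (Y i) α) (fun α β => by ext X; simp)
    refine addClosure_trans (fun j => Y i ⋙ Z j) (fun j => Functor.whiskerLeft (Y i) (p' j))
      (fun j => Functor.whiskerLeft (Y i) (q' j)) (fun j => ?_) ?_
    · rcases hY i with hi | ⟨e, f, he, hf, hi⟩
      · rw [hi]
        exact addClosure_of_mem (hZ j)
      · rcases hZ j with hj | ⟨e', f', he', hf', hj⟩
        · rw [hj]
          exact addClosure_of_mem (hY i)
        · rw [hi, hj]
          exact bimoduleFunctorOn_comp k E e f e' f' he hf he' hf'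
    · have h₁ := congrArg W' h'
      rw [map_sum] at h₁
      have h₂ : W' (𝟙 _) = 𝟙 _ := by ext X; simp [W']
      rw [h₂] at h₁
      rw [← h₁]
      refine Finset.sum_congr rfl fun i _ => ?_
      ext X
      simp [W']
  · have h₁ := congrArg W h
    rw [map_sum] at h₁
    have h₂ : W (𝟙 _) = 𝟙 _ := by ext X; simp [W]
    rw [h₂] at h₁
    rw [← h₁]
    refine Finset.sum_congr rfl fun i _ => ?_
    ext X
    simp [W]

instance : (projectiveFunctor k E).IsMonoidal where
  prop_unit := addClosure_of_mem (Or.inl rfl)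
  prop_tensor _ _ h₁ h₂ := projectiveFunctor_comp k E h₁ h₂

/-- The `2`-category of projective functors on `C`, as a monoidal category: objects are the
projective functors on `C`, morphisms are natural transformations, and the monoidal product
`F ⊗ G` is the composition `F ⋙ G` (first `F`, then `G`). -/
abbrev ProjCat : Type _ := (projectiveFunctor k E).FullSubcategory

instance : MonoidalCategory (ProjCat k E) :=
  ObjectProperty.fullMonoidalSubcategory (projectiveFunctor k E)

instance : AdditiveAction (ProjCat k E) (ProjCat k E) where
  add_left f g F := by
    have := projectiveFunctor_additive k E F.property
    apply ObjectProperty.hom_ext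
    ext X
    exact F.obj.map_add
  add_right X _ _ α β := rfl

instance [Linear k C] [E.functor.Linear k] : LinearAction k (ProjCat k E) (ProjCat k E) where
  smul_left r f F := by
    apply ObjectProperty.hom_ext
    ext X
    exact projectiveFunctor_linear k E F.property r _
  smul_right X _ _ r α := rfl

/-- The `1`-morphism `Ae ⊗ fA ⊗_A -`, for idempotents `e` and `f`. -/
def projMor (e f : A) (he : IsIdempotentElem e) (hf : IsIdempotentElem f) : ProjCat k E :=
  ⟨bimoduleFunctorOn k E e f, addClosure_of_mem (Or.inr ⟨e, f, he, hf, rfl⟩)⟩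

end Projective

/-! ### Assumptions on the algebra -/

section Algebras

variable {A : Type*} [Ring A]

/-- Primitive idempotents. -/
def IsPrimitiveIdempotent (e : A) : Prop :=
  IsIdempotentElem e ∧ e ≠ 0 ∧ ∀ a b : A, IsIdempotentElem a → IsIdempotentElem b →
    a * b = 0 → b * a = 0 → e = a + b → a = 0 ∨ b = 0

/-- `1 = e 0 + e 1 + ... + e (n - 1)` is a decomposition into pairwise orthogonal primitive
idempotents. -/
structure IsPrimitiveDecomposition {n : ℕ} (e : Fin n → A) : Prop where
  complete : CompleteOrthogonalIdempotents e
  primitive : ∀ i, IsPrimitiveIdempotent (e i)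

/-- A ring with a primitive decomposition `e` of `1` is basic if the indecomposable projective
modules `A e i` are pairwise non-isomorphic. -/
def IsBasic {n : ℕ} (e : Fin n → A) : Prop :=
  ∀ i j, Nonempty (↥(Ideal.span {e i}) ≃ₗ[A] ↥(Ideal.span {e j})) → i = j

/-- A ring is connected (indecomposable as a ring): it is nonzero and has no central idempotents
except `0` and `1`. -/
def IsConnectedRing (A : Type*) [Ring A] : Prop :=
  Nontrivial A ∧ ∀ z ∈ Set.center A, IsIdempotentElem z → z = 0 ∨ z = 1

end Algebras

end TwoRep

set_option linter.unusedSectionVars false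

/-! Everything is governed by one 1-morphism, T = A ⊗_k - (`tensorA`). Each bimodule Ae ⊗ fA is a
direct summand of A ⊗ A, so every 1-morphism is a summand of a sum of copies of 𝟙 and T
(`addClosure_unit_tensorA`), and the sums of copies of T absorb composition on both sides. A simple
transitive subquotient turns out to be determined by whether T acts on it by zero.

Let a be the regular module. Then T = a ⊗ Hom(a, -) (`Copower`) is a comonad, and a morphism G a ⟶ H
a induces a morphism T ⊗ G ⟶ H (`coext`). Hence a T-coalgebra U in any 2-representation gives an
equivariant functor G ↦ G U (`psiFunctor`) from `EvalCat`, the category with Hom(G, H) = Hom(G a, H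
a). As G a is a summand of a sum of copies of a, every morphism G U ⟶ H U is a sum of coalgebra
endomorphisms of U composed with images of morphisms G a ⟶ H a (`exists_sum_psi`). If U is local,
its coalgebra endomorphisms are scalars up to a nilpotent radical, so the functor is full modulo the
largest stable ideal. It is also faithful modulo that ideal, because the identity of a factors
through T f for every nonzero f (`exists_factor`). If T does not act by zero, a local summand of a
cofree coalgebra T Y supplies such a U (`exists_coalg_quotient`), and the subquotient is the
idempotent completion of `EvalCat`, whatever M is. If T acts by zero, the subquotient is the
idempotent completion of the full image of G ↦ G X, whose kernel has a description not involving X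
(`toQuot_action_eq_zero_iff`). `equivalent_of_sameKernel` turns both descriptions into equivalences,
and `subquotient_equivalent_iff` is the resulting criterion.

For the cells: 𝟙 is not a summand of T, since otherwise all cyclic A-modules would be projective and
A would be semisimple, hence simple by connectedness. So T acts by zero on L₀. It does not on the L
i, whose elements are summands of T.

For the diagram: a local coalgebra can be recovered, by applying T, from any nonzero summand of G U.
Hence if Y is a summand of T X and Z a nonzero summand of F Y, then Y is a summand of T Z
(`retract_action_of_retract`), and vertices on which T is nonzero are maximal. A strict step X → Y
has to use T, so it ends in such a vertex and starts in one of the other kind: the diagram is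
bipartite. The same reversal shows that a decoration contains each left cell of 𝒥 that it meets
(`exists_decoration_eq`). -/

namespace TwoRep

/-! ### Fitting's lemma in finite-dimensional algebras. -/

section Ring

variable (k : Type*) [Field k] {R : Type*} [Ring R] [Algebra k R] [FiniteDimensional k R]

include k in
/-- Finite-dimensional algebras are strongly `π`-regular. -/
lemma exists_pow_eq_pow_two_mul (x : R) :
    ∃ (n : ℕ) (y : R), 0 < n ∧ Commute x y ∧ x ^ n = x ^ (2 * n) * y := by
  let S := Algebra.adjoin k {x}
  have _ : IsMulCommutative S := Algebra.isMulCommutative_adjoin k (by simp)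
  have hS : IsArtinianRing S := IsArtinianRing.of_finite k S
  let z : S := ⟨x, Algebra.subset_adjoin rfl⟩
  -- The descending chain of ideals generated by the powers of z stabilises.
  obtain ⟨n, y, hy⟩ := IsArtinian.exists_pow_succ_smul_dvd z (1 : S)
  have h1 : z ^ (n + 1) = z ^ (n + 1) * (z * y) := by
    have : z ^ n = z ^ (n + 1) * y := by simpa using hy.symm
    calc z ^ (n + 1) = z ^ n * z := pow_succ _ _
      _ = (z ^ (n + 1) * y) * z := by rw [← this]
      _ = _ := by ring
  have h2 : ∀ m : ℕ, z ^ (n + 1) = z ^ (n + 1) * (z * y) ^ m := by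
    intro m
    induction m with
    | zero => simp
    | succ m ih =>
      calc z ^ (n + 1) = z ^ (n + 1) * (z * y) := h1
        _ = (z ^ (n + 1) * (z * y) ^ m) * (z * y) := by rw [← ih]
        _ = _ := by ring
  have h3 : z ^ (n + 1) = z ^ (2 * (n + 1)) * y ^ (n + 1) := by
    refine (h2 (n + 1)).trans ?_
    ring
  -- The exponent is n + 1 because it has to be positive even when the chain is constant.
  refine ⟨n + 1, (y ^ (n + 1) : S), Nat.succ_pos _, ?_, ?_⟩
  · have : z * y ^ (n + 1) = y ^ (n + 1) * z := mul_comm _ _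
    exact congrArg Subtype.val this
  · exact congrArg Subtype.val h3

include k in
/-- An element of a finite-dimensional algebra which is idempotent modulo an ideal can be replaced
by an idempotent. Here the ideal is given by the kernel of a ring homomorphism. -/
lemma exists_idempotent_lift {S : Type*} [Ring S] (φ : R →+* S) (x : R)
    (hx : φ x * φ x = φ x) : ∃ e : R, e * e = e ∧ φ e = φ x := by
  obtain ⟨n, y, hn, hxy, h⟩ := exists_pow_eq_pow_two_mul k x
  have hc : Commute (x ^ n) y := hxy.pow_left n
  -- This is the Fitting idempotent of x. Its image is φ x because φ x equals all its positive
  -- powers, so that x ^ n = x ^ (2n) y becomes φ x = φ x φ y.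
  refine ⟨x ^ n * y, ?_, ?_⟩
  · calc x ^ n * y * (x ^ n * y) = x ^ n * (y * x ^ n) * y := by simp only [mul_assoc]
      _ = x ^ n * (x ^ n * y) * y := by rw [hc.eq]
      _ = (x ^ (2 * n) * y) * y := by rw [two_mul, pow_add]; simp only [mul_assoc]
      _ = x ^ n * y := by rw [← h]
  · have hp : ∀ m : ℕ, 0 < m → φ x ^ m = φ x := fun m hm => IsIdempotentElem.pow_eq hx (by omega)
    have := congrArg φ h
    simp only [map_mul, map_pow] at this ⊢
    rw [hp n hn, hp (2 * n) (by omega)] at this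
    rw [hp n hn, ← this]

variable [IsAlgClosed k]

/-- If a finite-dimensional algebra has no nontrivial idempotents, every element is the sum of a
scalar and a nilpotent element. -/
lemma exists_isNilpotent_sub (h : ∀ e : R, e * e = e → e = 0 ∨ e = 1) (x : R) :
    ∃ c : k, IsNilpotent (x - c • (1 : R)) := by
  rcases subsingleton_or_nontrivial R with hR | hR
  · exact ⟨0, 1, Subsingleton.elim _ _⟩
  obtain ⟨c, hc⟩ := spectrum.nonempty_of_isAlgClosed_of_finiteDimensional k x
  refine ⟨c, ?_⟩
  have hz : ¬ IsUnit (x - c • (1 : R)) := fun hu => hc (by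
    rw [spectrum.mem_resolventSet_iff, Algebra.algebraMap_eq_smul_one]
    have := hu.neg
    rwa [neg_sub] at this)
  obtain ⟨n, y, hn, hxy, h'⟩ := exists_pow_eq_pow_two_mul k (x - c • (1 : R))
  generalize x - c • (1 : R) = z at *
  have hcm : Commute (z ^ n) y := hxy.pow_left n
  have he : z ^ n * y * (z ^ n * y) = z ^ n * y := by
    calc z ^ n * y * (z ^ n * y) = z ^ n * (y * z ^ n) * y := by simp only [mul_assoc]
      _ = z ^ n * (z ^ n * y) * y := by rw [hcm.eq]
      _ = (z ^ (2 * n) * y) * y := by rw [two_mul, pow_add]; simp only [mul_assoc]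
      _ = z ^ n * y := by rw [← h']
  -- The Fitting idempotent of z is 0, and then z is nilpotent, or it is 1, and then z is a unit,
  -- which the choice of c in the spectrum excludes.
  rcases h _ he with h0 | h1
  · exact ⟨n, by rw [h', two_mul, pow_add, mul_assoc, h0, mul_zero]⟩
  · exact absurd ((isUnit_pow_iff hn.ne').1
      ⟨⟨z ^ n, y, h1, by rw [← hcm.eq, h1]⟩, rfl⟩) hz

include k in
-- A nonzero scalar plus a nilpotent element is a unit.
lemma isUnit_or_isNilpotent (h : ∀ e : R, e * e = e → e = 0 ∨ e = 1) (x : R) :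
    IsUnit x ∨ IsNilpotent x := by
  obtain ⟨c, hc⟩ := exists_isNilpotent_sub k h x
  rcases eq_or_ne c 0 with rfl | h0
  · right; simpa using hc
  · left
    have h1 : IsUnit (c • (1 : R)) := by
      rw [← Algebra.algebraMap_eq_smul_one]
      exact (IsUnit.mk0 c h0).map _
    have : x = (x - c • (1 : R)) + c • (1 : R) := by simp
    rw [this]
    exact IsNilpotent.isUnit_add_right_of_commute hc h1 (by
      rw [← Algebra.algebraMap_eq_smul_one]; exact (Algebra.commutes _ _).symm)

include k in
/-- In a finite-dimensional algebra without nontrivial idempotents, the nilpotent elements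
lie in the radical. -/
lemma mem_jacobson_of_isNilpotent (h : ∀ e : R, e * e = e → e = 0 ∨ e = 1) {x : R}
    (hx : IsNilpotent x) : x ∈ Ring.jacobson R := by
  rcases subsingleton_or_nontrivial R with hR | hR
  · rw [Subsingleton.elim x 0]; exact zero_mem _
  have key : ∀ y : R, IsNilpotent (y * x) := by
    intro y
    refine (isUnit_or_isNilpotent k h (y * x)).resolve_left fun hu => ?_
    obtain ⟨u, hu⟩ := hu.exists_left_inv
    have h1 : (u * y) * x = 1 := by rw [mul_assoc, hu]
    obtain ⟨n, hn⟩ := hx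
    -- A left inverse of x gives left inverses of all its powers, which contradicts nilpotency.
    have h2 : ∀ m : ℕ, (u * y) ^ m * x ^ m = 1 := by
      intro m
      induction m with
      | zero => simp
      | succ m ih =>
        rw [pow_succ, pow_succ', mul_assoc, ← mul_assoc (u * y) x, h1, one_mul, ih]
    have := h2 n
    rw [hn, mul_zero] at this
    exact zero_ne_one this
  rw [← Ideal.jacobson_bot, Ideal.mem_jacobson_iff]
  intro y
  obtain ⟨u, hu⟩ := (IsNilpotent.isUnit_one_add (key y)).exists_left_inv
  refine ⟨u, ?_⟩
  rw [Ideal.mem_bot]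
  rw [mul_add, mul_one] at hu
  rw [mul_assoc, add_comm, hu, sub_self]

end Ring

/-! ### Objects with local endomorphism rings. -/

section Local

variable {D : Type*} [Category* D] [Preadditive D]

/-- The endomorphism ring of `X` has no nontrivial idempotents. -/
def TrivIdem (X : D) : Prop := ∀ e : X ⟶ X, e ≫ e = e → e = 0 ∨ e = 𝟙 X

/-- Splitting e and 1 - e exhibits X as the biproduct of the two images. From here on
indecomposability is used only through the endomorphism ring. -/
lemma IsIndec.trivIdem [IsIdempotentComplete D] {X : D} (hX : IsIndec X) : TrivIdem X := by
  intro e he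
  obtain ⟨Y, i, r, hir, hri⟩ := IsIdempotentComplete.idempotents_split X e he
  obtain ⟨Z, i', r', hir', hri'⟩ := IsIdempotentComplete.idempotents_split X (𝟙 X - e)
    (Idempotents.idem_of_id_sub_idem e he)
  have hre : r ≫ i = e := hri
  have hre' : r' ≫ i' = 𝟙 X - e := hri'
  have ei' : i' ≫ e = 0 := by
    have : i' ≫ (𝟙 X - e) = i' := by rw [← hre', ← Category.assoc, hir', Category.id_comp]
    rw [Preadditive.comp_sub, Category.comp_id] at this
    exact sub_eq_self.1 this
  have ei : i ≫ e = i := by rw [← hre, ← Category.assoc, hir, Category.id_comp]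
  have er' : e ≫ r' = 0 := by
    have h1 : (𝟙 X - e) ≫ r' = r' := by rw [← hre', Category.assoc, hir', Category.comp_id]
    rw [Preadditive.sub_comp, Category.id_comp] at h1
    exact sub_eq_self.1 h1
  have er : e ≫ r = r := by rw [← hre, Category.assoc, hir, Category.comp_id]
  let b : BinaryBicone Y Z :=
    { pt := X, fst := r, snd := r', inl := i, inr := i'
      inl_fst := hir
      inl_snd := by rw [← ei, Category.assoc, er', comp_zero]
      inr_fst := by rw [← er, ← Category.assoc, ei', zero_comp]
      inr_snd := hir' }
  have hb : b.IsBilimit := isBinaryBilimitOfTotal b (by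
    change r ≫ i + r' ≫ i' = 𝟙 X
    rw [hre, hre']; abel)
  rcases hX.2 b ⟨hb⟩ ⟨Iso.refl _⟩ with hY | hZ
  · left
    rw [← hre, hY.eq_of_tgt r 0, zero_comp]
  · right
    rw [hZ.eq_of_tgt r' 0, zero_comp] at hre'
    exact (sub_eq_zero.1 hre'.symm).symm

lemma isIndec_of_trivIdem {X : D} (h0 : ¬ IsZero X) (h : TrivIdem X) : IsIndec X := by
  refine ⟨h0, fun Y Z b ⟨hb⟩ ⟨e⟩ => ?_⟩
  have h1 : (e.inv ≫ b.fst ≫ b.inl ≫ e.hom) ≫ (e.inv ≫ b.fst ≫ b.inl ≫ e.hom) =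
      e.inv ≫ b.fst ≫ b.inl ≫ e.hom := by simp
  rcases h _ h1 with h2 | h2
  · left
    rw [IsZero.iff_id_eq_zero]
    have := congrArg (fun f => (b.inl ≫ e.hom) ≫ f ≫ (e.inv ≫ b.fst)) h2
    simpa using this
  · right
    rw [IsZero.iff_id_eq_zero]
    have := congrArg (fun f => (b.inr ≫ e.hom) ≫ f ≫ (e.inv ≫ b.snd)) h2
    simpa using this.symm

/-- A nonzero retract of an object without nontrivial idempotents is isomorphic to it. -/
lemma TrivIdem.retract_symm {X Y : D} (hY : TrivIdem Y) (hX : ¬ IsZero X) (h : Retract X Y) :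
    Nonempty (X ≅ Y) := by
  have h1 : (h.r ≫ h.i) ≫ h.r ≫ h.i = h.r ≫ h.i := by simp
  rcases hY _ h1 with h2 | h2
  · exfalso
    apply hX
    rw [IsZero.iff_id_eq_zero]
    have := congrArg (fun f => h.i ≫ f ≫ h.r) h2
    simpa using this
  · exact ⟨⟨h.i, h.r, h.retract, h2⟩⟩

lemma TrivIdem.of_iso {X Y : D} (hY : TrivIdem Y) (h : X ≅ Y) : TrivIdem X := by
  intro e he
  have h1 : (h.inv ≫ e ≫ h.hom) ≫ h.inv ≫ e ≫ h.hom = h.inv ≫ e ≫ h.hom := by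
    simp [reassoc_of% he]
  rcases hY _ h1 with h2 | h2
  · left
    have := congrArg (fun f => h.hom ≫ f ≫ h.inv) h2
    simpa using this
  · right
    have := congrArg (fun f => h.hom ≫ f ≫ h.inv) h2
    simpa using this

variable (k : Type*) [Field k] [IsAlgClosed k] [Linear k D]

lemma end_trivial {X : D} (h : TrivIdem X) (e : End X) (he : e * e = e) : e = 0 ∨ e = 1 :=
  h e he

include k in
lemma isIso_or_isNilpotent {X : D} [FiniteDimensional k (X ⟶ X)] (h : TrivIdem X) (x : X ⟶ X) :
    IsIso x ∨ IsNilpotent (show End X from x) := by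
  have : FiniteDimensional k (End X) := ‹_›
  rcases isUnit_or_isNilpotent k (R := End X) (end_trivial h) x with h1 | h1
  · left; exact (isUnit_iff_isIso x).1 h1
  · right; exact h1

lemma exists_scalar {X : D} [FiniteDimensional k (X ⟶ X)] (h : TrivIdem X) (x : X ⟶ X) :
    ∃ c : k, IsNilpotent (show End X from x - c • 𝟙 X) := by
  have : FiniteDimensional k (End X) := ‹_›
  exact exists_isNilpotent_sub k (R := End X) (end_trivial h) x

include k in
/-- If a sum of endomorphisms of an object with local endomorphism ring is invertible, then one of
the summands is. -/
lemma exists_isIso_of_sum {X : D} [FiniteDimensional k (X ⟶ X)] (h : TrivIdem X)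
    (hX : ¬ IsZero X) {ι : Type*} (s : Finset ι) (x : ι → (X ⟶ X)) (hs : IsIso (∑ i ∈ s, x i)) :
    ∃ i ∈ s, IsIso (x i) := by
  have : FiniteDimensional k (End X) := ‹_›
  -- Non-invertible endomorphisms are nilpotent, hence lie in the Jacobson radical, which is closed
  -- under sums and contains no unit.
  by_contra! hcon
  have h1 : ∀ i ∈ s, (show End X from x i) ∈ Ring.jacobson (End X) := fun i hi =>
    mem_jacobson_of_isNilpotent k (end_trivial h)
      ((isIso_or_isNilpotent k h (x i)).resolve_left (hcon i hi))
  have h2 : (show End X from ∑ i ∈ s, x i) ∈ Ring.jacobson (End X) :=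
    sum_mem (M := End X) (f := x) h1
  have hN : Nontrivial (End X) := ⟨1, 0, fun h0 => hX ((IsZero.iff_id_eq_zero X).2 h0)⟩
  have h3 : IsUnit (show End X from ∑ i ∈ s, x i) := (isUnit_iff_isIso _).2 hs
  have := Ideal.eq_top_of_isUnit_mem _ h2 h3
  exact (Ring.jacobson_lt_top (R := End X)).ne this

include k in
/-- An object with local endomorphism ring that lies in the additive closure of `S` is a retract
of an object in `S`. -/
lemma exists_retract_of_addClosure {X : D} [FiniteDimensional k (X ⟶ X)] (h : TrivIdem X)
    (hX : ¬ IsZero X) {S : ObjectProperty D} (hS : addClosure S X) :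
    ∃ Y, S Y ∧ Nonempty (Retract X Y) := by
  obtain ⟨n, Y, p, q, hY, hsum⟩ := hS
  obtain ⟨i, -, hi⟩ := exists_isIso_of_sum k h hX Finset.univ (fun i => p i ≫ q i)
    (by rw [hsum]; infer_instance)
  exact ⟨Y i, hY i, ⟨⟨p i, q i ≫ inv (p i ≫ q i), by
    rw [← Category.assoc, IsIso.hom_inv_id]⟩⟩⟩

end Local

/-! ### Permanence properties of additive closures. -/

section Closure

variable {D : Type*} [Category* D] [Preadditive D]

lemma addClosure_mono {S S' : ObjectProperty D} (h : ∀ X, S X → S' X) {X : D}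
    (hX : addClosure S X) : addClosure S' X := by
  obtain ⟨n, Y, p, q, hY, hs⟩ := hX
  exact ⟨n, Y, p, q, fun i => h _ (hY i), hs⟩

lemma addClosure_idem {S : ObjectProperty D} {X : D} (hX : addClosure (addClosure S) X) :
    addClosure S X := by
  obtain ⟨n, Y, p, q, hY, hs⟩ := hX
  exact addClosure_trans Y p q hY hs

lemma addClosure_retract {S : ObjectProperty D} {X Y : D} (h : Retract X Y)
    (hY : addClosure S Y) : addClosure S X :=
  addClosure_trans (ι := Unit) (fun _ => Y) (fun _ => h.i) (fun _ => h.r) (fun _ => hY)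
    (by simp)

/-- Additive functors preserve additive closures. -/
lemma addClosure_map {D' : Type*} [Category* D'] [Preadditive D'] (F : D ⥤ D') [F.Additive]
    {S : ObjectProperty D} {S' : ObjectProperty D'} (h : ∀ X, S X → addClosure S' (F.obj X))
    {X : D} (hX : addClosure S X) : addClosure S' (F.obj X) := by
  obtain ⟨n, Y, p, q, hY, hs⟩ := hX
  refine addClosure_trans (fun i => F.obj (Y i)) (fun i => F.map (p i)) (fun i => F.map (q i))
    (fun i => h _ (hY i)) ?_
  rw [← F.map_id, ← hs, F.map_sum]
  simp

end Closure

/-! ### Equivariant functors and their composition. -/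

section RightLinear

open Functor.LaxRightLinear Functor.OplaxRightLinear

variable {𝒞 : Type*} [Category* 𝒞] [MonoidalCategory 𝒞] {D D' D'' : Type*} [Category* D]
  [Category* D'] [Category* D''] [MonoidalRightAction 𝒞 D] [MonoidalRightAction 𝒞 D']
  [MonoidalRightAction 𝒞 D'']

/-- Construct the structure of a `𝒞`-equivariant functor from coherent isomorphisms. -/
@[reducible]
def rightLinearOfIso (Φ : D ⥤ D') (μ : ∀ (Y : D) (F : 𝒞), Φ.obj Y ⊙ᵣ F ≅ Φ.obj (Y ⊙ᵣ F))
    (nat_right : ∀ (Y : D) (F F' : 𝒞) (α : F ⟶ F'),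
      Φ.obj Y ⊴ᵣ α ≫ (μ Y F').hom = (μ Y F).hom ≫ Φ.map (Y ⊴ᵣ α))
    (nat_left : ∀ (Y Z : D) (f : Y ⟶ Z) (F : 𝒞),
      Φ.map f ⊵ᵣ F ≫ (μ Z F).hom = (μ Y F).hom ≫ Φ.map (f ⊵ᵣ F))
    (assoc : ∀ (Y : D) (F F' : 𝒞), (μ Y (F ⊗ F')).hom ≫ Φ.map (αᵣ Y F F').hom =
      (αᵣ (Φ.obj Y) F F').hom ≫ (μ Y F).hom ⊵ᵣ F' ≫ (μ (Y ⊙ᵣ F) F').hom)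
    (unit : ∀ Y : D, (ρᵣ[𝒞] (Φ.obj Y)).hom = (μ Y (𝟙_ 𝒞)).hom ≫ Φ.map (ρᵣ Y).hom) :
    Φ.RightLinear 𝒞 where
  μᵣ := fun Y F => (μ Y F).hom
  μᵣ_naturality_right := fun Y _ _ α => nat_right Y _ _ α
  μᵣ_naturality_left := fun f F => nat_left _ _ f F
  μᵣ_associativity := assoc
  μᵣ_unitality := unit
  δᵣ := fun Y F => (μ Y F).inv
  δᵣ_naturality_right := fun Y F F' α => by
    rw [Iso.eq_inv_comp, ← Category.assoc, ← nat_right, Category.assoc, Iso.hom_inv_id,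
      Category.comp_id]
  δᵣ_naturality_left := fun f F => by
    rw [Iso.eq_inv_comp, ← Category.assoc, ← nat_left, Category.assoc, Iso.hom_inv_id,
      Category.comp_id]
  δᵣ_associativity := fun Y F F' => by
    rw [Iso.inv_comp_eq, ← Category.assoc, assoc]
    simp
  δᵣ_unitality_inv := fun Y => by
    rw [Iso.eq_comp_inv, Iso.inv_comp_eq, unit, Category.assoc, ← Φ.map_comp,
      Iso.hom_inv_id, Φ.map_id, Category.comp_id]
  μᵣ_comp_δᵣ := fun Y F => (μ Y F).hom_inv_id
  δᵣ_comp_μᵣ := fun Y F => (μ Y F).inv_hom_id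

instance rightLinearComp (Φ : D ⥤ D') (Φ' : D' ⥤ D'') [Φ.RightLinear 𝒞] [Φ'.RightLinear 𝒞] :
    (Φ ⋙ Φ').RightLinear 𝒞 :=
  rightLinearOfIso _
    (fun Y F => Functor.RightLinear.μᵣIso Φ' (Φ.obj Y) F ≪≫
      Φ'.mapIso (Functor.RightLinear.μᵣIso Φ Y F))
    (fun Y F F' α => by
      simp only [Functor.comp_obj, Iso.trans_hom, Functor.mapIso_hom, Functor.comp_map,
        Category.assoc, ← Functor.map_comp, ← μᵣ_naturality_right]
      rw [Functor.map_comp, μᵣ_naturality_right_assoc])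
    (fun Y Z f F => by
      simp only [Functor.comp_obj, Iso.trans_hom, Functor.mapIso_hom, Functor.comp_map,
        Category.assoc, ← Functor.map_comp, ← μᵣ_naturality_left]
      rw [Functor.map_comp, μᵣ_naturality_left_assoc])
    (fun Y F F' => by
      simp only [Functor.comp_obj, Iso.trans_hom, Functor.mapIso_hom, Functor.comp_map,
        Category.assoc, ← Functor.map_comp, comp_actionHomLeft, μᵣ_associativity]
      simp only [Functor.map_comp]
      rw [μᵣ_associativity_assoc, μᵣ_naturality_left_assoc])
    (fun Y => by
      simp only [Functor.comp_obj, Iso.trans_hom, Functor.mapIso_hom, Functor.comp_map,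
        Category.assoc, ← Functor.map_comp, ← μᵣ_unitality])

end RightLinear

/-! ### Comparing idempotent completions of full images. -/

section Compare

open Functor.LaxRightLinear Functor.OplaxRightLinear

variable {𝒢 D D' : Type*} [Category* 𝒢] [Category* D] [Category* D'] (Ψ : 𝒢 ⥤ D) (Ψ' : 𝒢 ⥤ D')

/-- Two functors identify the same pairs of parallel morphisms. -/
def SameKernel : Prop :=
  ∀ ⦃G H : 𝒢⦄ (f g : G ⟶ H), Ψ.map f = Ψ.map g ↔ Ψ'.map f = Ψ'.map g

variable {Ψ Ψ'} in
lemma SameKernel.symm (h : SameKernel Ψ Ψ') : SameKernel Ψ' Ψ := fun _ _ f g => (h f g).symm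

/-- The map between morphisms induced by a full functor `Ψ` and a second functor. -/
noncomputable def transfer [Ψ.Full] {G H : 𝒢} (x : Ψ.obj G ⟶ Ψ.obj H) : Ψ'.obj G ⟶ Ψ'.obj H :=
  Ψ'.map (Ψ.preimage x)

section Transfer

variable {Ψ Ψ'} [Ψ.Full] (hk : SameKernel Ψ Ψ')

include hk

/-- The equality of kernels makes `transfer` independent of the chosen preimage; functoriality
follows. -/
lemma transfer_map {G H : 𝒢} (f : G ⟶ H) : transfer Ψ Ψ' (Ψ.map f) = Ψ'.map f :=
  (hk _ _).1 (Ψ.map_preimage _)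

lemma transfer_comp {G H K : 𝒢} (x : Ψ.obj G ⟶ Ψ.obj H) (y : Ψ.obj H ⟶ Ψ.obj K) :
    transfer Ψ Ψ' (x ≫ y) = transfer Ψ Ψ' x ≫ transfer Ψ Ψ' y := by
  obtain ⟨f, rfl⟩ := Ψ.map_surjective x
  obtain ⟨g, rfl⟩ := Ψ.map_surjective y
  rw [← Ψ.map_comp]
  simp only [transfer_map hk, Ψ'.map_comp]

lemma transfer_transfer [Ψ'.Full] {G H : 𝒢} (x : Ψ.obj G ⟶ Ψ.obj H) :
    transfer Ψ' Ψ (transfer Ψ Ψ' x) = x := by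
  obtain ⟨f, rfl⟩ := Ψ.map_surjective x
  rw [transfer_map hk, transfer_map hk.symm]

end Transfer

/-- A simultaneous presentation of an object of `D` and of an object of `D'` as images of
idempotents that correspond to the same morphism. -/
structure Presentation (Y : D) (Y' : D') where
  /-- the object that is presented as a retract of -/
  G : 𝒢
  /-- the retraction in `D` -/
  left : Retract Y (Ψ.obj G)
  /-- the retraction in `D'` -/
  right : Retract Y' (Ψ'.obj G)
  exists_map : ∃ e : G ⟶ G, Ψ.map e = left.r ≫ left.i ∧ Ψ'.map e = right.r ≫ right.i

namespace Presentation

variable {Ψ Ψ'}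

/-- The presentation with the roles of the functors exchanged. -/
def symm {Y : D} {Y' : D'} (P : Presentation Ψ Ψ' Y Y') : Presentation Ψ' Ψ Y' Y where
  G := P.G
  left := P.right
  right := P.left
  exists_map := by
    obtain ⟨e, h, h'⟩ := P.exists_map
    exact ⟨e, h', h⟩

section Trans

variable [Ψ.Full]

/-- The morphism between presented objects of `D'` that corresponds to a morphism between presented
objects of `D`. -/
noncomputable def trans {Y Z : D} {Y' Z' : D'} (P : Presentation Ψ Ψ' Y Y')
    (Q : Presentation Ψ Ψ' Z Z') (f : Y ⟶ Z) : Y' ⟶ Z' :=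
  P.right.i ≫ transfer Ψ Ψ' (P.left.r ≫ f ≫ Q.left.i) ≫ Q.right.r

variable (hk : SameKernel Ψ Ψ') {Y Z W : D} {Y' Z' W' : D'}

include hk

lemma transfer_idem (P : Presentation Ψ Ψ' Y Y') :
    transfer Ψ Ψ' (P.left.r ≫ P.left.i) = P.right.r ≫ P.right.i := by
  obtain ⟨e, h, h'⟩ := P.exists_map
  rw [← h, transfer_map hk, h']

lemma trans_id (P : Presentation Ψ Ψ' Y Y') : P.trans P (𝟙 Y) = 𝟙 Y' := by
  simp [trans, P.transfer_idem hk]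

lemma trans_comp (P : Presentation Ψ Ψ' Y Y') (Q : Presentation Ψ Ψ' Z Z')
    (R : Presentation Ψ Ψ' W W') (f : Y ⟶ Z) (g : Z ⟶ W) :
    P.trans Q f ≫ Q.trans R g = P.trans R (f ≫ g) := by
  simp only [trans, Category.assoc]
  rw [← Category.assoc Q.right.r, ← Q.transfer_idem hk, ← Category.assoc (transfer Ψ Ψ' _),
    ← transfer_comp hk, ← Category.assoc (transfer Ψ Ψ' _), ← transfer_comp hk]
  simp

lemma trans_symm_trans [Ψ'.Full] (P : Presentation Ψ Ψ' Y Y') (Q : Presentation Ψ Ψ' Z Z')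
    (f : Y ⟶ Z) : P.symm.trans Q.symm (P.trans Q f) = f := by
  simp only [trans, symm, Category.assoc]
  rw [← Category.assoc P.right.r, ← P.transfer_idem hk, ← Q.transfer_idem hk,
    ← transfer_comp hk, ← transfer_comp hk, transfer_transfer hk]
  simp

/-- Presentations of the same object of `D` present isomorphic objects of `D'`. -/
noncomputable def iso (P : Presentation Ψ Ψ' Y Y') (Q : Presentation Ψ Ψ' Y Z') : Y' ≅ Z' where
  hom := P.trans Q (𝟙 Y)
  inv := Q.trans P (𝟙 Y)
  hom_inv_id := by rw [trans_comp hk, Category.comp_id, trans_id hk]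
  inv_hom_id := by rw [trans_comp hk, Category.comp_id, trans_id hk]

end Trans

section Action

variable {𝒞 : Type*} [Category* 𝒞] [MonoidalCategory 𝒞] [MonoidalRightAction 𝒞 𝒢]
  [MonoidalRightAction 𝒞 D] [MonoidalRightAction 𝒞 D'] [Ψ.RightLinear 𝒞] [Ψ'.RightLinear 𝒞]
  {Y Z : D} {Y' Z' : D'}

/-- The retraction obtained by acting on a retraction. -/
def actRetract (Ψ : 𝒢 ⥤ D) [Ψ.RightLinear 𝒞] {G : 𝒢} (h : Retract Y (Ψ.obj G)) (F : 𝒞) :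
    Retract (Y ⊙ᵣ F) (Ψ.obj (G ⊙ᵣ F)) where
  i := h.i ⊵ᵣ F ≫ μᵣ Ψ G F
  r := δᵣ Ψ G F ≫ h.r ⊵ᵣ F
  retract := by
    rw [Category.assoc, Functor.RightLinear.μᵣ_comp_δᵣ_assoc, ← comp_actionHomLeft, h.retract,
      id_actionHomLeft]

/-- The presentation obtained by acting on a presentation. -/
def act (P : Presentation Ψ Ψ' Y Y') (F : 𝒞) : Presentation Ψ Ψ' (Y ⊙ᵣ F) (Y' ⊙ᵣ F) where
  G := P.G ⊙ᵣ F
  left := actRetract Ψ P.left F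
  right := actRetract Ψ' P.right F
  exists_map := by
    obtain ⟨e, h, h'⟩ := P.exists_map
    refine ⟨e ⊵ᵣ F, ?_, ?_⟩
    · simp only [actRetract, Category.assoc]
      rw [← comp_actionHomLeft_assoc, ← h, μᵣ_naturality_left,
        Functor.RightLinear.δᵣ_comp_μᵣ_assoc]
    · simp only [actRetract, Category.assoc]
      rw [← comp_actionHomLeft_assoc, ← h', μᵣ_naturality_left,
        Functor.RightLinear.δᵣ_comp_μᵣ_assoc]

variable [Ψ.Full] (hk : SameKernel Ψ Ψ')

/-- To identify `trans`, it suffices to exhibit one morphism in `𝒢`. -/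
lemma trans_eq (hk : SameKernel Ψ Ψ') (P : Presentation Ψ Ψ' Y Y') (Q : Presentation Ψ Ψ' Z Z')
    (f : Y ⟶ Z) (f' : Y' ⟶ Z') (x : P.G ⟶ Q.G) (hx : Ψ.map x = P.left.r ≫ f ≫ Q.left.i)
    (hx' : Ψ'.map x = P.right.r ≫ f' ≫ Q.right.i) : P.trans Q f = f' := by
  rw [trans, ← hx, transfer_map hk, hx']
  simp

/-- A converse to `trans_eq`. Together they reduce identities for `trans` to computations with a
common lift in 𝒢. -/
lemma exists_trans_map (hk : SameKernel Ψ Ψ') (P : Presentation Ψ Ψ' Y Y')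
    (Q : Presentation Ψ Ψ' Z Z') (f : Y ⟶ Z) : ∃ x : P.G ⟶ Q.G,
      Ψ.map x = P.left.r ≫ f ≫ Q.left.i ∧ Ψ'.map x = P.right.r ≫ P.trans Q f ≫ Q.right.i := by
  obtain ⟨x, hx⟩ := Ψ.map_surjective (P.left.r ≫ f ≫ Q.left.i)
  refine ⟨x, hx, ?_⟩
  simp only [trans, Category.assoc]
  rw [← Category.assoc P.right.r, ← P.transfer_idem hk, ← Q.transfer_idem hk,
    ← transfer_comp hk, ← transfer_comp hk, ← transfer_map hk, hx]
  simp

include hk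

lemma trans_act_left (P : Presentation Ψ Ψ' Y Y') (Q : Presentation Ψ Ψ' Z Z') (f : Y ⟶ Z)
    (F : 𝒞) : (P.act F).trans (Q.act F) (f ⊵ᵣ F) = P.trans Q f ⊵ᵣ F := by
  obtain ⟨x, hx, hx'⟩ := exists_trans_map hk P Q f
  refine trans_eq hk _ _ _ _ (x ⊵ᵣ F) ?_ ?_
  · simp only [act, actRetract, Category.assoc]
    rw [← comp_actionHomLeft_assoc, ← comp_actionHomLeft_assoc, Category.assoc, ← hx,
      μᵣ_naturality_left, Functor.RightLinear.δᵣ_comp_μᵣ_assoc]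
  · simp only [act, actRetract, Category.assoc]
    rw [← comp_actionHomLeft_assoc, ← comp_actionHomLeft_assoc, Category.assoc, ← hx',
      μᵣ_naturality_left, Functor.RightLinear.δᵣ_comp_μᵣ_assoc]

lemma trans_act_right (P : Presentation Ψ Ψ' Y Y') {F F' : 𝒞} (α : F ⟶ F') :
    (P.act F).trans (P.act F') (Y ⊴ᵣ α) = Y' ⊴ᵣ α := by
  obtain ⟨x, hx, hx'⟩ := P.exists_map
  refine trans_eq hk _ _ _ _ (P.G ⊴ᵣ α ≫ x ⊵ᵣ F') ?_ ?_
  · simp only [act, actRetract, Category.assoc]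
    rw [← action_exchange_assoc, ← comp_actionHomLeft_assoc, ← hx,
      μᵣ_naturality_left, μᵣ_naturality_right_assoc, Functor.RightLinear.δᵣ_comp_μᵣ_assoc,
      Functor.map_comp]
  · simp only [act, actRetract, Category.assoc]
    rw [← action_exchange_assoc, ← comp_actionHomLeft_assoc, ← hx',
      μᵣ_naturality_left, μᵣ_naturality_right_assoc, Functor.RightLinear.δᵣ_comp_μᵣ_assoc,
      Functor.map_comp]

omit hk in
-- The lift on the left, the associator of G followed by the idempotent e, does not depend on Ψ. So
-- it represents the associators on both sides of a presentation at once.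
lemma map_assoc_act (Ψ : 𝒢 ⥤ D) [Ψ.RightLinear 𝒞] {G : 𝒢} (h : Retract Y (Ψ.obj G)) (e : G ⟶ G)
    (he : Ψ.map e = h.r ≫ h.i) (F F' : 𝒞) :
    Ψ.map ((αᵣ G F F').hom ≫ (e ⊵ᵣ F) ⊵ᵣ F') = (actRetract Ψ h (F ⊗ F')).r ≫ (αᵣ Y F F').hom ≫
      (actRetract Ψ (actRetract Ψ h F) F').i := by
  have h1 : Ψ.map (αᵣ G F F').hom = δᵣ Ψ G (F ⊗ F') ≫ (αᵣ (Ψ.obj G) F F').hom ≫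
      (μᵣ Ψ G F) ⊵ᵣ F' ≫ μᵣ Ψ (G ⊙ᵣ F) F' := by
    rw [← μᵣ_associativity, Functor.RightLinear.δᵣ_comp_μᵣ_assoc]
  have h2 : μᵣ Ψ (G ⊙ᵣ F) F' ≫ Ψ.map ((e ⊵ᵣ F) ⊵ᵣ F') =
      Ψ.map (e ⊵ᵣ F) ⊵ᵣ F' ≫ μᵣ Ψ (G ⊙ᵣ F) F' := (μᵣ_naturality_left _ _ _).symm
  have h3 : μᵣ Ψ G F ≫ Ψ.map (e ⊵ᵣ F) = Ψ.map e ⊵ᵣ F ≫ μᵣ Ψ G F :=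
    (μᵣ_naturality_left _ _ _).symm
  rw [Functor.map_comp, h1]
  simp only [Category.assoc]
  rw [h2, ← comp_actionHomLeft_assoc, h3, he]
  simp [actRetract]

omit hk in
lemma map_unit_act (Ψ : 𝒢 ⥤ D) [Ψ.RightLinear 𝒞] {G : 𝒢} (h : Retract Y (Ψ.obj G)) (e : G ⟶ G)
    (he : Ψ.map e = h.r ≫ h.i) :
    Ψ.map ((ρᵣ[𝒞] G).hom ≫ e) = (actRetract Ψ h (𝟙_ 𝒞)).r ≫ (ρᵣ[𝒞] Y).hom ≫ h.i := by
  rw [Functor.map_comp, he]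
  simp [actRetract]

lemma trans_act_assoc (P : Presentation Ψ Ψ' Y Y') (F F' : 𝒞) :
    (P.act (F ⊗ F')).trans ((P.act F).act F') (αᵣ Y F F').hom = (αᵣ Y' F F').hom := by
  obtain ⟨x, hx, hx'⟩ := P.exists_map
  exact trans_eq hk _ _ _ _ _ (map_assoc_act Ψ P.left x hx F F')
    (map_assoc_act Ψ' P.right x hx' F F')

lemma trans_act_unit (P : Presentation Ψ Ψ' Y Y') :
    (P.act (𝟙_ 𝒞)).trans P (ρᵣ Y).hom = (ρᵣ Y').hom := by
  obtain ⟨x, hx, hx'⟩ := P.exists_map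
  exact trans_eq hk _ _ _ _ _ (map_unit_act Ψ P.left x hx) (map_unit_act Ψ' P.right x hx')

end Action

end Presentation

variable {Ψ Ψ'} in
-- A lift e of the idempotent need not be idempotent in 𝒢, but equality of kernels makes its image
-- under Ψ' idempotent, and that splits.
lemma exists_presentation [Ψ.Full] [IsIdempotentComplete D'] (hk : SameKernel Ψ Ψ') {Y : D} {G : 𝒢}
    (h : Retract Y (Ψ.obj G)) : ∃ Y', Nonempty (Presentation Ψ Ψ' Y Y') := by
  obtain ⟨e, he⟩ := Ψ.map_surjective (h.r ≫ h.i)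
  have he' : Ψ'.map e ≫ Ψ'.map e = Ψ'.map e := by
    rw [← Ψ'.map_comp, ← hk, Ψ.map_comp, he]; simp
  obtain ⟨Y', i, r, hir, hri⟩ := IsIdempotentComplete.idempotents_split _ _ he'
  exact ⟨Y', ⟨⟨G, h, ⟨i, r, hir⟩, e, he, hri.symm⟩⟩⟩

/-- Two categories with an action of `𝒞` are equivalent if they are the idempotent completions of
the images of full `𝒞`-equivariant functors with the same kernel. -/
theorem equivalent_of_sameKernel (k : Type*) [Field k] (𝒞 : Type*) [Category* 𝒞]
    [MonoidalCategory 𝒞] [Preadditive 𝒞] [Linear k 𝒞]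
    [Preadditive 𝒢] [Linear k 𝒢] [Preadditive D] [Linear k D] [Preadditive D'] [Linear k D']
    [MonoidalRightAction 𝒞 𝒢] [MonoidalRightAction 𝒞 D] [MonoidalRightAction 𝒞 D']
    [Ψ.RightLinear 𝒞] [Ψ'.RightLinear 𝒞] [Ψ.Additive] [Ψ'.Additive] [Ψ.Linear k] [Ψ'.Linear k]
    [Ψ.Full] [Ψ'.Full] [IsIdempotentComplete D] [IsIdempotentComplete D'] (hk : SameKernel Ψ Ψ')
    (hD : ∀ Y : D, ∃ G, Nonempty (Retract Y (Ψ.obj G)))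
    (hD' : ∀ Y : D', ∃ G, Nonempty (Retract Y (Ψ'.obj G))) : Equivalent k 𝒞 D D' := by
  have hp : ∀ Y : D, ∃ Y', Nonempty (Presentation Ψ Ψ' Y Y') := fun Y => by
    obtain ⟨G, ⟨h⟩⟩ := hD Y
    exact exists_presentation hk h
  choose obj hobj using hp
  -- The functor is defined by an arbitrary choice of presentations; `Presentation.iso` shows that a
  -- different choice gives isomorphic objects.
  let P : ∀ Y, Presentation Ψ Ψ' Y (obj Y) := fun Y => (hobj Y).some
  let Φ : D ⥤ D' :=
    { obj := obj
      map := fun {Y Z} f => (P Y).trans (P Z) f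
      map_id := fun Y => Presentation.trans_id hk _
      map_comp := fun f g => (Presentation.trans_comp hk _ _ _ f g).symm }
  have hfull : Φ.Full := ⟨fun {Y Z} g => ⟨(P Y).symm.trans (P Z).symm g,
    Presentation.trans_symm_trans hk.symm (P Y).symm (P Z).symm g⟩⟩
  have hfaithful : Φ.Faithful := ⟨fun {Y Z} f g h => by
    rw [← Presentation.trans_symm_trans hk (P Y) (P Z) f,
      ← Presentation.trans_symm_trans hk (P Y) (P Z) g]
    exact congrArg _ h⟩
  -- Present Z from the other side, then compare with the chosen presentation of the resulting Y.
  have hess : Φ.EssSurj := ⟨fun Z => by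
    obtain ⟨G, ⟨h⟩⟩ := hD' Z
    obtain ⟨Y, ⟨Q⟩⟩ := exists_presentation hk.symm h
    exact ⟨Y, ⟨Presentation.iso hk (P Y) Q.symm⟩⟩⟩
  refine ⟨Φ, { }, ⟨?_⟩, ⟨?_⟩, ?_⟩
  · intro Y Z f g
    obtain ⟨x, hx, hx'⟩ := Presentation.exists_trans_map hk (P Y) (P Z) f
    obtain ⟨y, hy, hy'⟩ := Presentation.exists_trans_map hk (P Y) (P Z) g
    refine Presentation.trans_eq hk _ _ _ _ (x + y) ?_ ?_
    · simp [hx, hy]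
    · simp [hx', hy', Φ]
  · intro Y Z f r
    obtain ⟨x, hx, hx'⟩ := Presentation.exists_trans_map hk (P Y) (P Z) f
    refine Presentation.trans_eq hk _ _ _ _ (r • x) ?_ ?_
    · simp [hx]
    · simp [hx', Φ]
  · let μ : ∀ (Y : D) (F : 𝒞), Φ.obj Y ⊙ᵣ F ≅ Φ.obj (Y ⊙ᵣ F) := fun Y F =>
      Presentation.iso hk ((P Y).act F) (P (Y ⊙ᵣ F))
    have nat_left : ∀ (Y Z : D) (f : Y ⟶ Z) (F : 𝒞),
        Φ.map f ⊵ᵣ F ≫ (μ Z F).hom = (μ Y F).hom ≫ Φ.map (f ⊵ᵣ F) := fun Y Z f F => by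
      simp only [Φ, μ, Presentation.iso]
      rw [← Presentation.trans_act_left hk, Presentation.trans_comp hk,
        Presentation.trans_comp hk, Category.comp_id, Category.id_comp]
    have nat_right : ∀ (Y : D) (F F' : 𝒞) (α : F ⟶ F'),
        Φ.obj Y ⊴ᵣ α ≫ (μ Y F').hom = (μ Y F).hom ≫ Φ.map (Y ⊴ᵣ α) := fun Y F F' α => by
      simp only [Φ, μ, Presentation.iso]
      rw [← Presentation.trans_act_right hk (P Y), Presentation.trans_comp hk,
        Presentation.trans_comp hk, Category.comp_id, Category.id_comp]
    have assoc : ∀ (Y : D) (F F' : 𝒞), (μ Y (F ⊗ F')).hom ≫ Φ.map (αᵣ Y F F').hom =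
        (αᵣ (Φ.obj Y) F F').hom ≫ (μ Y F).hom ⊵ᵣ F' ≫ (μ (Y ⊙ᵣ F) F').hom := fun Y F F' => by
      simp only [Φ, μ, Presentation.iso]
      rw [← Presentation.trans_act_left hk, Presentation.trans_comp hk,
        ← Presentation.trans_act_assoc hk, Presentation.trans_comp hk, Presentation.trans_comp hk]
      simp
    have unit : ∀ Y : D, (ρᵣ[𝒞] (Φ.obj Y)).hom = (μ Y (𝟙_ 𝒞)).hom ≫ Φ.map (ρᵣ Y).hom := fun Y => by
      simp only [Φ, μ, Presentation.iso]
      rw [Presentation.trans_comp hk, Category.id_comp, Presentation.trans_act_unit hk]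
    exact ⟨rightLinearOfIso Φ μ nat_right nat_left assoc unit⟩

end Compare

/-! ### The action as a functor in each variable. -/

section Action

variable {𝒞 : Type*} [Category* 𝒞] [MonoidalCategory 𝒞]
  {D : Type*} [Category* D] [MonoidalRightAction 𝒞 D]

/-- The action of a `1`-morphism, as a functor. -/
@[simps]
def actBy (F : 𝒞) : D ⥤ D where
  obj X := X ⊙ᵣ F
  map f := f ⊵ᵣ F

/-- The evaluation of the action at an object. -/
@[simps]
def orbit (𝒞 : Type*) [Category* 𝒞] [MonoidalCategory 𝒞] {D : Type*} [Category* D]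
    [MonoidalRightAction 𝒞 D] (X : D) : 𝒞 ⥤ D where
  obj F := X ⊙ᵣ F
  map α := X ⊴ᵣ α

/-- Acting on retracts. -/
def retractAct {X Y : D} (h : Retract X Y) (F : 𝒞) : Retract (X ⊙ᵣ F) (Y ⊙ᵣ F) := h.map (actBy F)

variable [Preadditive 𝒞] [Preadditive D] [AdditiveAction 𝒞 D]

instance (F : 𝒞) : (actBy (D := D) F).Additive := ⟨fun {_ _ _ _} => AdditiveAction.add_left _ _ F⟩

instance (X : D) : (orbit 𝒞 X).Additive := ⟨fun {_ _ _ _} => AdditiveAction.add_right X _ _⟩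

lemma zero_actionHomLeft (X Y : D) (F : 𝒞) : (0 : X ⟶ Y) ⊵ᵣ F = 0 := (actBy F).map_zero X Y

lemma neg_actionHomLeft {X Y : D} (f : X ⟶ Y) (F : 𝒞) : (-f) ⊵ᵣ F = -(f ⊵ᵣ F) :=
  (actBy F).map_neg

lemma sub_actionHomLeft {X Y : D} (f g : X ⟶ Y) (F : 𝒞) : (f - g) ⊵ᵣ F = f ⊵ᵣ F - g ⊵ᵣ F :=
  (actBy F).map_sub

lemma actionHomRight_sum (X : D) {F G : 𝒞} {ι : Type*} (s : Finset ι) (f : ι → (F ⟶ G)) :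
    X ⊴ᵣ (∑ i ∈ s, f i) = ∑ i ∈ s, X ⊴ᵣ f i := (orbit 𝒞 X).map_sum _ _

lemma actionHomRight_zero (X : D) (F G : 𝒞) : X ⊴ᵣ (0 : F ⟶ G) = 0 := (orbit 𝒞 X).map_zero _ _

end Action

/-! ### The largest stable ideal avoiding a class of objects. -/

section Avoiding

variable {𝒞 : Type*} [Category* 𝒞] [MonoidalCategory 𝒞] [Preadditive 𝒞]
  {D : Type*} [Category* D] [Preadditive D] [MonoidalRightAction 𝒞 D] [AdditiveAction 𝒞 D]

section

variable (k : Type*) [Field k] [IsAlgClosed k] [Linear k D] [∀ X Y : D, FiniteDimensional k (X ⟶ Y)]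
  {R : ObjectProperty D}

include k

/-- The largest stable ideal that avoids a class of objects with local endomorphism rings. -/
lemma mem_avoidingIdeal_iff (hR : ∀ Z, R Z → TrivIdem Z) (hR' : ∀ Z, R Z → ¬ IsZero Z) {X Y : D}
    (f : X ⟶ Y) : f ∈ (avoidingIdeal 𝒞 R).hom X Y ↔ ∀ Z, R Z → ∀ (G : 𝒞) (a : Z ⟶ X ⊙ᵣ G)
      (b : Y ⊙ᵣ G ⟶ Z), ¬ IsIso (a ≫ f ⊵ᵣ G ≫ b) := by
  -- The right-hand side of the claim is itself a stable ideal. Closure under sums is where locality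
  -- of the objects in R enters.
  let I : StableIdeal 𝒞 D :=
    { hom := fun X Y =>
        { carrier := {f | ∀ Z, R Z → ∀ (G : 𝒞) (a : Z ⟶ X ⊙ᵣ G)
            (b : Y ⊙ᵣ G ⟶ Z), ¬ IsIso (a ≫ f ⊵ᵣ G ≫ b)}
          add_mem' := fun {f g} hf hg Z hZ G a b h => by
            have h1 : a ≫ (f + g) ⊵ᵣ G ≫ b =
                ∑ i : Fin 2, (![a ≫ f ⊵ᵣ G ≫ b, a ≫ g ⊵ᵣ G ≫ b] i) := by
              simp [Fin.sum_univ_two, AdditiveAction.add_left]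
            rw [h1] at h
            obtain ⟨i, -, hi⟩ := exists_isIso_of_sum k (hR Z hZ) (hR' Z hZ) _ _ h
            fin_cases i
            · exact hf Z hZ G a b hi
            · exact hg Z hZ G a b hi
          zero_mem' := fun Z hZ G a b h => by
            rw [zero_actionHomLeft, zero_comp, comp_zero] at h
            exact hR' Z hZ ((IsZero.iff_id_eq_zero Z).2 (by
              rw [← IsIso.hom_inv_id (0 : Z ⟶ Z), zero_comp]))
          neg_mem' := fun {f} hf Z hZ G a b h => hf Z hZ G (-a) b (by
            rw [neg_actionHomLeft] at h
            simpa using h) }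
      comp_left := fun {_ _ _} f {g} hg Z hZ G a b h => hg Z hZ G (a ≫ f ⊵ᵣ G) b (by simpa using h)
      comp_right := fun {_ _ _ f} g hf Z hZ G a b h => hf Z hZ G a (g ⊵ᵣ G ≫ b) (by simpa using h)
      action := fun {X Y f} F hf Z hZ G a b h => hf Z hZ (F ⊗ G) (a ≫ (αᵣ X F G).inv)
        ((αᵣ Y F G).hom ≫ b) (by simpa using h) }
  have hI : ∀ Z, R Z → 𝟙 Z ∉ I.hom Z Z := fun Z hZ h =>
    h Z hZ (𝟙_ 𝒞) (ρᵣ Z).inv (ρᵣ Z).hom (by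
      rw [id_actionHomLeft, Category.id_comp, Iso.inv_hom_id]; infer_instance)
  constructor
  · intro hf
    -- An ideal J that avoids R lies in I: an invertible composite through an element of J would put
    -- the identity of Z in J.
    refine hf I fun J hJ U V g hg Z hZ G a b h => hJ Z hZ ?_
    have := J.comp_right (inv (a ≫ g ⊵ᵣ G ≫ b)) (J.comp_left a (J.comp_right b (J.action G hg)))
    rwa [IsIso.hom_inv_id] at this
  · intro hf J hJ
    exact hJ I hI X Y hf

lemma id_notMem_avoidingIdeal (hR : ∀ Z, R Z → TrivIdem Z) (hR' : ∀ Z, R Z → ¬ IsZero Z) {Z : D}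
    (hZ : R Z) : 𝟙 Z ∉ (avoidingIdeal 𝒞 R).hom Z Z := fun h =>
  (mem_avoidingIdeal_iff k hR hR' _).1 h Z hZ (𝟙_ 𝒞) (ρᵣ Z).inv (ρᵣ Z).hom (by
      rw [id_actionHomLeft, Category.id_comp, Iso.inv_hom_id]; infer_instance)

lemma id_mem_avoidingIdeal_iff (hR : ∀ Z, R Z → TrivIdem Z) (hR' : ∀ Z, R Z → ¬ IsZero Z) (Y : D) :
    𝟙 Y ∈ (avoidingIdeal 𝒞 R).hom Y Y ↔ ∀ Z, R Z → ¬ ActsOnto 𝒞 Y Z := by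
  rw [mem_avoidingIdeal_iff k hR hR']
  refine ⟨fun h Z hZ ⟨G, ⟨r⟩⟩ => h Z hZ G r.i r.r ?_, fun h Z hZ G a b hab => h Z hZ ⟨G, ⟨?_⟩⟩⟩
  · rw [id_actionHomLeft, Category.id_comp, r.retract]; infer_instance
  · rw [id_actionHomLeft, Category.id_comp] at hab
    exact ⟨a, b ≫ inv (a ≫ b), by rw [← Category.assoc, IsIso.hom_inv_id]⟩

end

variable (I : StableIdeal 𝒞 D)

/-- The quotient functor commutes with the action. -/
instance quotientRightLinear : (CategoryTheory.Quotient.functor I.rel).RightLinear 𝒞 :=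
  rightLinearOfIso _ (fun _ _ => Iso.refl _)
    (fun Y F F' α => (Category.comp_id _).trans (Category.id_comp _).symm)
    (fun Y Z f F => (Category.comp_id _).trans (Category.id_comp _).symm)
    (fun Y F F' => by
      refine (Category.id_comp _).trans ?_
      rw [Iso.refl_hom, Iso.refl_hom, Category.comp_id]
      refine Eq.symm ((congrArg (_ ≫ ·) (id_actionHomLeft _ _)).trans (Category.comp_id _)))
    (fun Y => (Category.id_comp _).symm)

instance (k : Type*) [Field k] [Linear k D] :
    (CategoryTheory.Quotient.functor I.rel).Linear k := Quotient.linear_functor k I.rel (I.rel_smul k)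

omit [Preadditive 𝒞] [AdditiveAction 𝒞 D] in
lemma quotient_map_eq_zero_iff {X Y : D} (f : X ⟶ Y) :
    (CategoryTheory.Quotient.functor I.rel).map f = 0 ↔ f ∈ I.hom X Y := by
  rw [← Functor.map_zero, CategoryTheory.Quotient.functor_map_eq_iff]
  simp [StableIdeal.rel]

omit [Preadditive 𝒞] [AdditiveAction 𝒞 D] in
/-- Quotients of finite-dimensional idempotent split categories are idempotent split. -/
lemma isIdempotentComplete_quotient (k : Type*) [Field k] [Linear k D]
    [∀ X Y : D, FiniteDimensional k (X ⟶ Y)] [IsIdempotentComplete D] :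
    IsIdempotentComplete I.QuotCat := by
  refine ⟨fun X p hp => ?_⟩
  let π := CategoryTheory.Quotient.functor I.rel
  obtain ⟨X⟩ := X
  obtain ⟨f, rfl⟩ := π.map_surjective (X := X) (Y := X) p
  have : FiniteDimensional k (End X) := inferInstanceAs (FiniteDimensional k (X ⟶ X))
  let φ : End X →+* End (π.obj X) :=
    { toFun := fun g => π.map g
      map_one' := π.map_id X
      map_mul' := fun g h => π.map_comp h g
      map_zero' := π.map_zero X X
      map_add' := fun g h => π.map_add }
  -- Idempotents lift along the surjection from End X to its quotient, and the lift splits already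
  -- in D.
  obtain ⟨e, he, hef⟩ := exists_idempotent_lift k φ f hp
  obtain ⟨Y, i, r, hir, hri⟩ := IsIdempotentComplete.idempotents_split X e he
  refine ⟨π.obj Y, π.map i, π.map r, ?_, ?_⟩
  · rw [← π.map_comp, hir, π.map_id]
  · rw [← π.map_comp, hri]; exact hef

end Avoiding

/-! ### Endofunctors of the form a ⊗ Hom(a, -). -/

section Copower

variable (k : Type*) [Field k] {C : Type*} [Category* C] [Preadditive C] [Linear k C]

/-- The structure of the functor `N ↦ a ⊗ Hom(a, N)` on an endofunctor `T`: the inclusion of the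
copy of `a` indexed by `v : a ⟶ N`, and the projections given by linear forms on `Hom(a, N)`. -/
structure Copower (a : C) (T : C ⥤ C) where
  /-- the inclusion of a copy of `a` -/
  lam {N : C} : (a ⟶ N) →ₗ[k] (a ⟶ T.obj N)
  lam_map {N N' : C} (v : a ⟶ N) (g : N ⟶ N') : lam v ≫ T.map g = lam (v ≫ g)
  /-- the projection onto a copy of `a` -/
  coord {N : C} (ξ : (a ⟶ N) →ₗ[k] k) : T.obj N ⟶ a
  lam_coord {N : C} (v : a ⟶ N) (ξ : (a ⟶ N) →ₗ[k] k) : lam v ≫ coord ξ = ξ v • 𝟙 a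
  ext {N Y : C} (f g : T.obj N ⟶ Y) : (∀ v : a ⟶ N, lam v ≫ f = lam v ≫ g) → f = g

namespace Copower

variable {k} {a : C} {T : C ⥤ C} (c : Copower k a T) [hfin : ∀ X Y : C, FiniteDimensional k (X ⟶ Y)]

/-- A basis of `Hom(a, N)`. -/
noncomputable abbrev basis (k : Type*) [Field k] {C : Type*} [Category* C] [Preadditive C]
    [Linear k C] [∀ X Y : C, FiniteDimensional k (X ⟶ Y)] (a N : C) :
    Module.Basis (Fin (Module.finrank k (a ⟶ N))) k (a ⟶ N) := Module.finBasis k (a ⟶ N)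

/-- A basis of Hom(a, N) exhibits T N as a finite direct sum of copies of a. -/
lemma sum_coord_lam (N : C) :
    ∑ i, c.coord ((basis k a N).coord i) ≫ c.lam (basis k a N i) = 𝟙 (T.obj N) := by
  apply c.ext
  intro v
  rw [Preadditive.comp_sum, Category.comp_id]
  conv_rhs => rw [← (basis k a N).sum_repr v, map_sum]
  refine Finset.sum_congr rfl fun i _ => ?_
  rw [reassoc_of% c.lam_coord]
  simp

/-- Maps out of `G (T N)` are determined by their restrictions to the images of the copies
of `a`. -/
lemma map_ext {C' : Type*} [Category* C'] [Preadditive C'] (G : C ⥤ C') [G.Additive] {N : C} {Y : C'}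
    (f g : G.obj (T.obj N) ⟶ Y) (h : ∀ v : a ⟶ N, G.map (c.lam v) ≫ f = G.map (c.lam v) ≫ g) :
    f = g := by
  have key : ∀ f : G.obj (T.obj N) ⟶ Y, f = ∑ i, G.map (c.coord ((basis k a N).coord i)) ≫
      G.map (c.lam (basis k a N i)) ≫ f := fun f => by
    have := congrArg (fun x => G.map x ≫ f) (c.sum_coord_lam N)
    simp only [G.map_sum, Preadditive.sum_comp, G.map_id, Category.id_comp, G.map_comp,
      Category.assoc] at this
    exact this.symm
  rw [key f, key g]
  exact Finset.sum_congr rfl fun i _ => by rw [h]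

/-- The map out of `G (T N)` with prescribed restrictions to the images of the copies of `a`. -/
noncomputable def desc {C' : Type*} [Category* C'] [Preadditive C'] [Linear k C'] (G : C ⥤ C')
    {N : C} {Y : C'} (θ : (a ⟶ N) →ₗ[k] (G.obj a ⟶ Y)) : G.obj (T.obj N) ⟶ Y :=
  ∑ i, G.map (c.coord ((basis k a N).coord i)) ≫ θ (basis k a N i)

/-- With `map_ext` this is the universal property of G (T N) = G a ⊗ Hom(a, N). Natural
transformations out of T are constructed with it and compared on the copies of a. -/
lemma map_lam_desc {C' : Type*} [Category* C'] [Preadditive C'] [Linear k C'] (G : C ⥤ C')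
    [G.Additive] [G.Linear k] {N : C} {Y : C'} (θ : (a ⟶ N) →ₗ[k] (G.obj a ⟶ Y)) (v : a ⟶ N) :
    G.map (c.lam v) ≫ c.desc G θ = θ v := by
  rw [desc, Preadditive.comp_sum]
  conv_rhs => rw [← (basis k a N).sum_repr v, map_sum]
  refine Finset.sum_congr rfl fun i _ => ?_
  rw [← Category.assoc, ← G.map_comp, c.lam_coord]
  simp

end Copower

end Copower

/-! ### The comonad T and the category `EvalCat`. -/

section Projective

variable {k : Type*} [Field k] {A : Type u} [Ring A] [Algebra k A] [FiniteDimensional k A]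
  {C : Type*} [Category* C] [Preadditive C] [Linear k C] {E : C ≌ FGModuleCat.{u} A}
  [E.functor.Additive] [E.functor.Linear k]

namespace ProjCat

instance (G : ProjCat k E) : G.obj.Additive := projectiveFunctor_additive k E G.property

instance (G : ProjCat k E) : G.obj.Linear k :=
  ⟨fun f r => projectiveFunctor_linear k E G.property r f⟩

omit [Linear k C] [E.functor.Linear k] in
lemma hom_ext_app {G H : ProjCat k E} {α β : G ⟶ H} (h : ∀ N, α.hom.app N = β.hom.app N) : α = β :=
  ObjectProperty.hom_ext _ (NatTrans.ext (funext h))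

variable {a : C} {T : ProjCat k E} (c : Copower k a T.obj)
  [hfin : ∀ X Y : C, FiniteDimensional k (X ⟶ Y)]

/-- The counit of the comonad `T`. -/
noncomputable def counit : T ⟶ 𝟙_ (ProjCat k E) :=
  ObjectProperty.homMk
    { app := fun N => (c.desc (𝟭 C) (LinearMap.id : (a ⟶ N) →ₗ[k] (a ⟶ N)) : T.obj.obj N ⟶ N)
      naturality := fun N N' g => by
        refine c.map_ext (𝟭 C) _ _ fun v => ?_
        have h1 := fun N (v : a ⟶ N) => c.map_lam_desc (𝟭 C) (LinearMap.id) v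
        simp only [Functor.id_map, LinearMap.id_apply] at h1
        change c.lam v ≫ T.obj.map g ≫ c.desc (𝟭 C) LinearMap.id =
          c.lam v ≫ c.desc (𝟭 C) LinearMap.id ≫ g
        rw [← Category.assoc, c.lam_map, h1, ← Category.assoc, h1] }

lemma lam_counit {N : C} (v : a ⟶ N) : c.lam v ≫ (counit c).hom.app N = v :=
  c.map_lam_desc (𝟭 C) (LinearMap.id) v

/-- The comultiplication of the comonad `T`. -/
noncomputable def comul : T ⟶ T ⊗ T :=
  ObjectProperty.homMk
    { app := fun N => (c.desc (𝟭 C) ((c.lam : (a ⟶ T.obj.obj N) →ₗ[k] _) ∘ₗ c.lam) :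
        T.obj.obj N ⟶ T.obj.obj (T.obj.obj N))
      naturality := fun N N' g => by
        refine c.map_ext (𝟭 C) _ _ fun v => ?_
        have h1 := fun N (v : a ⟶ N) => c.map_lam_desc (𝟭 C)
          ((c.lam : (a ⟶ T.obj.obj N) →ₗ[k] _) ∘ₗ c.lam) v
        simp only [Functor.id_map, LinearMap.comp_apply] at h1
        change c.lam v ≫ T.obj.map g ≫ c.desc (𝟭 C) (c.lam ∘ₗ c.lam) =
          c.lam v ≫ c.desc (𝟭 C) (c.lam ∘ₗ c.lam) ≫ T.obj.map (T.obj.map g)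
        rw [← Category.assoc, c.lam_map, h1, ← Category.assoc, h1, c.lam_map, c.lam_map] }

lemma lam_comul {N : C} (v : a ⟶ N) : c.lam v ≫ (comul c).hom.app N = c.lam (c.lam v) :=
  c.map_lam_desc (𝟭 C) (c.lam ∘ₗ c.lam) v

/-- The morphism `T ⊗ G ⟶ H` that corresponds to a morphism `G a ⟶ H a`. -/
noncomputable def coext {G H : ProjCat k E} (f : G.obj.obj a ⟶ H.obj.obj a) : T ⊗ G ⟶ H :=
  ObjectProperty.homMk
    { app := fun N => (c.desc G.obj (Linear.leftComp k (H.obj.obj N) f ∘ₗ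
        (H.obj.mapLinearMap k : (a ⟶ N) →ₗ[k] _)) : G.obj.obj (T.obj.obj N) ⟶ H.obj.obj N)
      naturality := fun N N' g => by
        refine c.map_ext G.obj _ _ fun v => ?_
        have h1 := fun N (v : a ⟶ N) => c.map_lam_desc G.obj
          (Linear.leftComp k (H.obj.obj N) f ∘ₗ (H.obj.mapLinearMap k : (a ⟶ N) →ₗ[k] _)) v
        change G.obj.map (c.lam v) ≫ G.obj.map (T.obj.map g) ≫ c.desc G.obj _ =
          G.obj.map (c.lam v) ≫ c.desc G.obj _ ≫ H.obj.map g
        rw [← Category.assoc, ← G.obj.map_comp, c.lam_map, h1, ← Category.assoc, h1]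
        simp }

lemma lam_coext {G H : ProjCat k E} (f : G.obj.obj a ⟶ H.obj.obj a) {N : C} (v : a ⟶ N) :
    G.obj.map (c.lam v) ≫ (coext c f).hom.app N = f ≫ H.obj.map v :=
  c.map_lam_desc G.obj (Linear.leftComp k (H.obj.obj N) f ∘ₗ
    (H.obj.mapLinearMap k : (a ⟶ N) →ₗ[k] _)) v

include c in
lemma tensor_ext {G H : ProjCat k E} {α β : T ⊗ G ⟶ H} (h : ∀ {N : C} (v : a ⟶ N),
    G.obj.map (c.lam v) ≫ α.hom.app N = G.obj.map (c.lam v) ≫ β.hom.app N) : α = β :=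
  hom_ext_app fun _ => c.map_ext G.obj _ _ h

lemma comp_app {G H K : ProjCat k E} (α : G ⟶ H) (β : H ⟶ K) (N : C) :
    (α ≫ β).hom.app N = α.hom.app N ≫ β.hom.app N := rfl

/-- For a component of a natural transformation, the extension factors through the counit. This is
what lets `psi` extend the given action. -/
lemma coext_app {G H : ProjCat k E} (α : G ⟶ H) :
    coext c (α.hom.app a) = counit c ▷ G ≫ (λ_ G).hom ≫ α := by
  refine tensor_ext c fun {N} v => ?_
  rw [lam_coext]
  change _ = G.obj.map (c.lam v) ≫ G.obj.map ((counit c).hom.app N) ≫ 𝟙 _ ≫ α.hom.app N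
  rw [← Category.assoc, ← G.obj.map_comp, lam_counit, Category.id_comp]
  exact (α.hom.naturality v).symm

/-- Composition of morphisms G a ⟶ H a becomes co-Kleisli composition for the comonad T ⊗ -. -/
lemma coext_comp {G H K : ProjCat k E} (f : G.obj.obj a ⟶ H.obj.obj a)
    (g : H.obj.obj a ⟶ K.obj.obj a) :
    coext c (f ≫ g) = comul c ▷ G ≫ (α_ T T G).hom ≫ T ◁ coext c f ≫ coext c g := by
  refine tensor_ext c fun {N} v => ?_
  rw [lam_coext]
  change _ = G.obj.map (c.lam v) ≫ G.obj.map ((comul c).hom.app N) ≫ 𝟙 _ ≫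
    (coext c f).hom.app (T.obj.obj N) ≫ (coext c g).hom.app N
  rw [Category.id_comp, ← Category.assoc, ← G.obj.map_comp, lam_comul, ← Category.assoc, lam_coext]
  exact (Category.assoc _ _ _).trans
    ((congrArg (f ≫ ·) (lam_coext c g v).symm).trans (Category.assoc _ _ _).symm)

/-- Compatibility with composing with K; the source of the equivariance of `psiFunctor`. -/
lemma coext_map {G H : ProjCat k E} (K : ProjCat k E) (f : G.obj.obj a ⟶ H.obj.obj a) :
    coext c (G := G ⊗ K) (H := H ⊗ K) (K.obj.map f) = (α_ T G K).inv ≫ coext c f ▷ K := by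
  refine tensor_ext c fun {N} v => ?_
  rw [lam_coext]
  change _ = K.obj.map (G.obj.map (c.lam v)) ≫ 𝟙 _ ≫ K.obj.map ((coext c f).hom.app N)
  rw [Category.id_comp, ← K.obj.map_comp, lam_coext, K.obj.map_comp]
  rfl

lemma coext_add {G H : ProjCat k E} (f g : G.obj.obj a ⟶ H.obj.obj a) :
    coext c (f + g) = coext c f + coext c g := by
  refine tensor_ext c fun {N} v => ?_
  change _ = _ ≫ ((coext c f).hom.app N + (coext c g).hom.app N)
  rw [lam_coext, Preadditive.comp_add, lam_coext, lam_coext, Preadditive.add_comp]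

lemma coext_smul {G H : ProjCat k E} (r : k) (f : G.obj.obj a ⟶ H.obj.obj a) :
    coext c (r • f) = r • coext c f := by
  refine tensor_ext c fun {N} v => ?_
  change _ = _ ≫ (r • (coext c f).hom.app N)
  rw [lam_coext, Linear.comp_smul, lam_coext, Linear.smul_comp]

lemma comul_coassoc : comul c ≫ comul c ▷ T ≫ (α_ T T T).hom = comul c ≫ T ◁ comul c := by
  refine hom_ext_app fun N => c.map_ext (𝟭 C) _ _ fun v => ?_
  change c.lam v ≫ (comul c).hom.app N ≫ T.obj.map ((comul c).hom.app N) ≫ 𝟙 _ =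
    c.lam v ≫ (comul c).hom.app N ≫ (comul c).hom.app (T.obj.obj N)
  rw [Category.comp_id, ← Category.assoc, lam_comul, c.lam_map, lam_comul, ← Category.assoc,
    lam_comul, lam_comul]

lemma comul_counit : comul c ≫ T ◁ counit c ≫ (ρ_ T).hom = 𝟙 T := by
  refine hom_ext_app fun N => c.map_ext (𝟭 C) _ _ fun v => ?_
  change c.lam v ≫ (comul c).hom.app N ≫ (counit c).hom.app (T.obj.obj N) ≫ 𝟙 _ = c.lam v ≫ 𝟙 _
  rw [Category.comp_id, ← Category.assoc, lam_comul, lam_counit, Category.comp_id]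

end ProjCat

/-- The category with the same objects as `𝒞`, where morphisms from `G` to `H` are morphisms
from `G a` to `H a`. -/
structure EvalCat (E : C ≌ FGModuleCat.{u} A) (a : C) where
  /-- the underlying functor -/
  fn : ProjCat k E

namespace EvalCat

variable {a : C}

instance : Category (EvalCat (k := k) E a) where
  Hom X Y := X.fn.obj.obj a ⟶ Y.fn.obj.obj a
  id X := 𝟙 (X.fn.obj.obj a)
  comp f g := CategoryStruct.comp (obj := C) f g
  id_comp f := Category.id_comp (obj := C) f
  comp_id f := Category.comp_id (obj := C) f
  assoc f g h := Category.assoc (obj := C) f g h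

instance : Preadditive (EvalCat (k := k) E a) where
  homGroup X Y := inferInstanceAs (AddCommGroup (X.fn.obj.obj a ⟶ Y.fn.obj.obj a))
  add_comp _ _ _ f g h := Preadditive.add_comp (C := C) _ _ _ f g h
  comp_add _ _ _ f g h := Preadditive.comp_add (C := C) _ _ _ f g h

instance : Linear k (EvalCat (k := k) E a) where
  homModule X Y := inferInstanceAs (Module k (X.fn.obj.obj a ⟶ Y.fn.obj.obj a))
  smul_comp _ _ _ r f g := Linear.smul_comp (C := C) _ _ _ r f g
  comp_smul _ _ _ f r g := Linear.comp_smul (C := C) _ _ _ f r g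

instance : MonoidalRightAction (ProjCat k E) (EvalCat (k := k) E a) where
  actionObj X F := ⟨X.fn ⊗ F⟩
  actionHomLeft f F := F.obj.map f
  actionHomRight X _ _ α := α.hom.app (X.fn.obj.obj a)
  actionAssocIso X F G :=
    { hom := 𝟙 (G.obj.obj (F.obj.obj (X.fn.obj.obj a)))
      inv := 𝟙 (G.obj.obj (F.obj.obj (X.fn.obj.obj a)))
      hom_inv_id := Category.id_comp (obj := C) _
      inv_hom_id := Category.id_comp (obj := C) _ }
  actionUnitIso X :=
    { hom := 𝟙 (X.fn.obj.obj a)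
      inv := 𝟙 (X.fn.obj.obj a)
      hom_inv_id := Category.id_comp (obj := C) _
      inv_hom_id := Category.id_comp (obj := C) _ }
  actionHom_def _ _ := rfl
  actionHomRight_id _ _ := rfl
  id_actionHomLeft F _ := F.obj.map_id _
  actionHom_comp {F F' F'' X X' X''} f f' α α' := by
    change F.obj.map (CategoryStruct.comp (obj := C) f f') ≫ α.hom.app _ ≫ α'.hom.app _ =
      (F.obj.map f ≫ α.hom.app _) ≫ F'.obj.map f' ≫ α'.hom.app _
    rw [F.obj.map_comp, Category.assoc, Category.assoc, α.hom.naturality_assoc]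
  actionAssocIso_hom_naturality {X X' F F' G G'} f α β := by
    change (G.obj.map (F.obj.map f) ≫ (α ⊗ₘ β).hom.app _) ≫ 𝟙 _ =
      𝟙 _ ≫ G.obj.map (F.obj.map f ≫ α.hom.app _) ≫ β.hom.app _
    rw [MonoidalCategory.tensorHom_def]
    change (G.obj.map (F.obj.map f) ≫ G.obj.map (α.hom.app _) ≫ β.hom.app _) ≫ 𝟙 _ = _
    rw [Category.comp_id, Category.id_comp, G.obj.map_comp, Category.assoc]
  actionUnitIso_hom_naturality f := (Category.id_comp (obj := C) f).trans
    (Category.comp_id (obj := C) f).symm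
  actionHomRight_whiskerRight α K X := by
    change K.obj.map (α.hom.app _) = 𝟙 _ ≫ K.obj.map (α.hom.app _) ≫ 𝟙 _
    rw [Category.id_comp, Category.comp_id]
  whiskerRight_actionHomLeft K _ _ α X := by
    change α.hom.app _ = 𝟙 _ ≫ α.hom.app _ ≫ 𝟙 _
    rw [Category.id_comp, Category.comp_id]
  actionHom_associator F G H X := by
    change 𝟙 _ ≫ 𝟙 _ ≫ 𝟙 _ = 𝟙 _ ≫ H.obj.map (𝟙 _)
    rw [H.obj.map_id]
    simp
  actionHom_leftUnitor F X := by
    change 𝟙 _ = 𝟙 _ ≫ F.obj.map (𝟙 _)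
    rw [F.obj.map_id, Category.id_comp]
  actionHom_rightUnitor F X := (Category.id_comp (obj := C) _).symm

end EvalCat

end Projective

/-! ### Coalgebras over T and the functors they define. -/

section Coalgebras

variable {k : Type*} [Field k] {A : Type u} [Ring A] [Algebra k A] [FiniteDimensional k A]
  {C : Type*} [Category* C] [Preadditive C] [Linear k C] {E : C ≌ FGModuleCat.{u} A}
  [E.functor.Additive] [E.functor.Linear k]
  {a : C} {T : ProjCat k E} (c : Copower k a T.obj)
  [hfin : ∀ X Y : C, FiniteDimensional k (X ⟶ Y)]
  {M : Type*} [Category* M] [Preadditive M] [MonoidalRightAction (ProjCat k E) M]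

open ProjCat

/-- A coalgebra over the comonad `T` in a category on which projective functors act. -/
structure Coalg (M : Type*) [Category* M] [Preadditive M] [MonoidalRightAction (ProjCat k E) M] where
  /-- the underlying object -/
  pt : M
  /-- the coaction -/
  str : pt ⟶ pt ⊙ᵣ T
  str_counit : str ≫ pt ⊴ᵣ counit c ≫ (ρᵣ pt).hom = 𝟙 pt
  str_coassoc : str ≫ str ⊵ᵣ T = str ≫ pt ⊴ᵣ comul c ≫ (αᵣ pt T T).hom

variable {c}

/-- Morphisms of coalgebras. -/
def IsCoalgHom (U V : Coalg c M) (β : U.pt ⟶ V.pt) : Prop := β ≫ V.str = U.str ≫ β ⊵ᵣ T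

namespace IsCoalgHom

variable {U V W : Coalg c M}

lemma id (U : Coalg c M) : IsCoalgHom U U (𝟙 _) := by simp [IsCoalgHom]

lemma comp {β : U.pt ⟶ V.pt} {γ : V.pt ⟶ W.pt} (hβ : IsCoalgHom U V β) (hγ : IsCoalgHom V W γ) :
    IsCoalgHom U W (β ≫ γ) := by
  rw [IsCoalgHom, Category.assoc, hγ, ← Category.assoc, hβ, comp_actionHomLeft, Category.assoc]

variable [AdditiveAction (ProjCat k E) M]

lemma add {β γ : U.pt ⟶ V.pt} (hβ : IsCoalgHom U V β) (hγ : IsCoalgHom U V γ) :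
    IsCoalgHom U V (β + γ) := by
  rw [IsCoalgHom, Preadditive.add_comp, hβ, hγ, AdditiveAction.add_left, Preadditive.comp_add]

lemma smul [Linear k M] [LinearAction k (ProjCat k E) M] {β : U.pt ⟶ V.pt}
    (hβ : IsCoalgHom U V β) (r : k) : IsCoalgHom U V (r • β) := by
  rw [IsCoalgHom, Linear.smul_comp, hβ, LinearAction.smul_left, Linear.comp_smul]

end IsCoalgHom

namespace Coalg

variable (U V : Coalg c M)

/-- The coaction on `G U`. -/
noncomputable def coact (G : ProjCat k E) : U.pt ⊙ᵣ G ⟶ U.pt ⊙ᵣ (T ⊗ G) :=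
  U.str ⊵ᵣ G ≫ (αᵣ U.pt T G).inv

lemma coact_naturality {G H : ProjCat k E} (α : G ⟶ H) :
    U.pt ⊴ᵣ α ≫ U.coact H = U.coact G ≫ U.pt ⊴ᵣ (T ◁ α) := by
  rw [coact, coact, action_exchange_assoc, whiskerRight_actionHomLeft, Category.assoc,
    Iso.inv_hom_id_assoc]

lemma coact_counit (G : ProjCat k E) :
    U.coact G ≫ U.pt ⊴ᵣ (counit c ▷ G ≫ (λ_ G).hom) = 𝟙 _ := by
  rw [coact, actionHomRight_comp, actionHomRight_whiskerRight, actionHom_leftUnitor]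
  simp only [Category.assoc, Iso.inv_hom_id_assoc]
  rw [← comp_actionHomLeft, ← comp_actionHomLeft, str_counit, id_actionHomLeft]

/-- Coassociativity of U, whiskered by G. It matches the comultiplication in `coext_comp` and so
makes `psi` functorial. -/
lemma coact_coact (G : ProjCat k E) :
    U.coact G ≫ U.coact (T ⊗ G) = U.coact G ≫ U.pt ⊴ᵣ (comul c ▷ G ≫ (α_ T T G).hom) := by
  have h1 : (U.pt ⊴ᵣ (α_ T T G).hom) = (αᵣ U.pt (T ⊗ T) G).hom ≫ (αᵣ U.pt T T).hom ⊵ᵣ G ≫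
      (αᵣ (U.pt ⊙ᵣ T) T G).inv ≫ (αᵣ U.pt T (T ⊗ G)).inv := by
    have := actionHom_associator T T G U.pt
    rw [← Category.assoc, ← Iso.eq_comp_inv, ← Iso.eq_comp_inv] at this
    rw [this]
    simp
  rw [coact, coact, actionHomRight_comp, actionHomRight_whiskerRight, h1]
  simp only [Category.assoc, Iso.inv_hom_id_assoc, actionHomLeft_tensor]
  rw [← comp_actionHomLeft_assoc, str_coassoc]
  simp

/-- The functor from `EvalCat` to `M` defined by a coalgebra, on morphisms. -/
noncomputable def psi {G H : ProjCat k E} (f : G.obj.obj a ⟶ H.obj.obj a) :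
    U.pt ⊙ᵣ G ⟶ U.pt ⊙ᵣ H := U.coact G ≫ U.pt ⊴ᵣ coext c f

/-- On components of natural transformations `psi` is the given action, by the counit law of U. The
new content is that all other morphisms G a ⟶ H a act as well. -/
lemma psi_app {G H : ProjCat k E} (α : G ⟶ H) : U.psi (α.hom.app a) = U.pt ⊴ᵣ α := by
  rw [psi, coext_app, ← Category.assoc (counit c ▷ G), actionHomRight_comp, ← Category.assoc,
    coact_counit, Category.id_comp]

lemma psi_id (G : ProjCat k E) : U.psi (𝟙 (G.obj.obj a)) = 𝟙 (U.pt ⊙ᵣ G) :=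
  (U.psi_app (𝟙 G)).trans (actionHomRight_id _ _)

lemma psi_comp {G H K : ProjCat k E} (f : G.obj.obj a ⟶ H.obj.obj a)
    (g : H.obj.obj a ⟶ K.obj.obj a) :
    U.psi (f ≫ g) = U.psi f ≫ U.psi g := by
  rw [psi, coext_comp, ← Category.assoc (comul c ▷ G), actionHomRight_comp, ← Category.assoc,
    ← coact_coact, actionHomRight_comp, psi, psi, Category.assoc, Category.assoc,
    ← Category.assoc (U.coact (T ⊗ G)), ← coact_naturality]
  simp

lemma psi_map {G H : ProjCat k E} (K : ProjCat k E) (f : G.obj.obj a ⟶ H.obj.obj a) :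
    U.psi (G := G ⊗ K) (H := H ⊗ K) (K.obj.map f) =
      (αᵣ U.pt G K).hom ≫ U.psi f ⊵ᵣ K ≫ (αᵣ U.pt H K).inv := by
  have h1 : (U.pt ⊴ᵣ (α_ T G K).inv) = (αᵣ U.pt T (G ⊗ K)).hom ≫ (αᵣ (U.pt ⊙ᵣ T) G K).hom ≫
      (αᵣ U.pt T G).inv ⊵ᵣ K ≫ (αᵣ U.pt (T ⊗ G) K).inv := by
    have := actionHom_associator T G K U.pt
    rw [← cancel_epi (U.pt ⊴ᵣ (α_ T G K).hom), ← actionHomRight_comp, Iso.hom_inv_id,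
      actionHomRight_id, reassoc_of% this]
    simp
  rw [psi, coext_map, psi, coact, coact, actionHomRight_comp, h1, actionHomRight_whiskerRight]
  simp

section Additive

variable [AdditiveAction (ProjCat k E) M]

lemma psi_add {G H : ProjCat k E} (f g : G.obj.obj a ⟶ H.obj.obj a) :
    U.psi (f + g) = U.psi f + U.psi g := by
  rw [psi, coext_add, AdditiveAction.add_right, Preadditive.comp_add]
  rfl

/-- `psi` as an additive map. -/
noncomputable def psiHom (G H : ProjCat k E) :
    (G.obj.obj a ⟶ H.obj.obj a) →+ (U.pt ⊙ᵣ G ⟶ U.pt ⊙ᵣ H) :=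
  AddMonoidHom.mk' U.psi U.psi_add

lemma psi_sum {G H : ProjCat k E} {ι : Type*} (s : Finset ι)
    (f : ι → (G.obj.obj a ⟶ H.obj.obj a)) : U.psi (∑ i ∈ s, f i) = ∑ i ∈ s, U.psi (f i) :=
  map_sum (U.psiHom G H) f s

lemma psi_zero (G H : ProjCat k E) : U.psi (0 : G.obj.obj a ⟶ H.obj.obj a) = 0 :=
  map_zero (U.psiHom G H)

lemma psi_smul [Linear k M] [LinearAction k (ProjCat k E) M] {G H : ProjCat k E} (r : k)
    (f : G.obj.obj a ⟶ H.obj.obj a) : U.psi (r • f) = r • U.psi f := by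
  rw [psi, coext_smul, LinearAction.smul_right, Linear.comp_smul]
  rfl

end Additive

/-- The functor from `EvalCat` to `M` defined by a coalgebra. -/
noncomputable def psiFunctor : EvalCat (k := k) E a ⥤ M where
  obj G := U.pt ⊙ᵣ G.fn
  map {G H} f := U.psi (G := G.fn) (H := H.fn) f
  map_id G := U.psi_id G.fn
  map_comp {G H K} f g := U.psi_comp (G := G.fn) (H := H.fn) (K := K.fn) f g

noncomputable instance : U.psiFunctor.RightLinear (ProjCat k E) :=
  rightLinearOfIso _ (fun G F => (αᵣ U.pt G.fn F).symm)
    (fun G F F' α => by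
      change (U.pt ⊙ᵣ G.fn) ⊴ᵣ α ≫ (αᵣ U.pt G.fn F').inv =
        (αᵣ U.pt G.fn F).inv ≫ U.psi (G := G.fn ⊗ F) (H := G.fn ⊗ F') ((G.fn ◁ α).hom.app a)
      rw [psi_app, whiskerRight_actionHomLeft, Iso.inv_hom_id_assoc])
    (fun G H f F => by
      change U.psi (G := G.fn) (H := H.fn) f ⊵ᵣ F ≫ (αᵣ U.pt H.fn F).inv =
        (αᵣ U.pt G.fn F).inv ≫ U.psi (G := G.fn ⊗ F) (H := H.fn ⊗ F) (F.obj.map f)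
      rw [psi_map, Iso.inv_hom_id_assoc])
    (fun G F F' => by
      change (αᵣ U.pt G.fn (F ⊗ F')).inv ≫ U.psi (G := G.fn ⊗ (F ⊗ F')) (H := (G.fn ⊗ F) ⊗ F')
          ((α_ G.fn F F').inv.hom.app a) = (αᵣ (U.pt ⊙ᵣ G.fn) F F').hom ≫
          (αᵣ U.pt G.fn F).inv ⊵ᵣ F' ≫ (αᵣ U.pt (G.fn ⊗ F) F').inv
      rw [psi_app, Iso.inv_comp_eq]
      have := actionHom_associator G.fn F F' U.pt
      rw [← cancel_epi (U.pt ⊴ᵣ (α_ G.fn F F').hom), ← actionHomRight_comp, Iso.hom_inv_id,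
        actionHomRight_id, reassoc_of% this]
      simp)
    (fun G => by
      change (ρᵣ (U.pt ⊙ᵣ G.fn)).hom = (αᵣ U.pt G.fn (𝟙_ _)).inv ≫
        U.psi (G := G.fn ⊗ 𝟙_ _) (H := G.fn) ((ρ_ G.fn).hom.hom.app a)
      rw [psi_app, actionHom_rightUnitor, Iso.inv_hom_id_assoc])

instance [AdditiveAction (ProjCat k E) M] : U.psiFunctor.Additive :=
  ⟨fun {G H} f g => U.psi_add (G := G.fn) (H := H.fn) f g⟩

instance [AdditiveAction (ProjCat k E) M] [Linear k M] [LinearAction k (ProjCat k E) M] :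
    U.psiFunctor.Linear k :=
  ⟨fun {G H} f r => U.psi_smul (G := G.fn) (H := H.fn) r f⟩

variable {U V} in
/-- Morphisms of coalgebras commute with `psi`. -/
lemma _root_.TwoRep.IsCoalgHom.psi_comm {β : U.pt ⟶ V.pt} (hβ : IsCoalgHom U V β)
    {G H : ProjCat k E} (f : G.obj.obj a ⟶ H.obj.obj a) :
    β ⊵ᵣ G ≫ V.psi f = U.psi f ≫ β ⊵ᵣ H := by
  rw [psi, psi, Category.assoc, action_exchange, coact, coact, ← Category.assoc,
    ← comp_actionHomLeft_assoc, hβ, comp_actionHomLeft, actionHomLeft_tensor]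
  simp

variable (c) in
/-- The cofree coalgebra `T X`. -/
@[simps]
noncomputable def cofree (X : M) : Coalg c M where
  pt := X ⊙ᵣ T
  str := X ⊴ᵣ comul c ≫ (αᵣ X T T).hom
  str_counit := by
    have := congrArg (X ⊴ᵣ ·) (comul_counit c)
    simp only [actionHomRight_comp, whiskerRight_actionHomLeft, actionHom_rightUnitor,
      Category.assoc, Iso.inv_hom_id_assoc, actionHomRight_id] at this
    simpa only [Category.assoc] using this
  str_coassoc := by
    have := congrArg (fun x => X ⊴ᵣ x ≫ (αᵣ X T (T ⊗ T)).hom ≫ (αᵣ (X ⊙ᵣ T) T T).hom)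
      (comul_coassoc c)
    simp only [actionHomRight_comp, Category.assoc, actionHom_associator,
      actionHomRight_whiskerRight, Iso.inv_hom_id_assoc, whiskerRight_actionHomLeft] at this
    simpa only [Category.assoc, comp_actionHomLeft] using this

lemma isCoalgHom_str : IsCoalgHom U (cofree c U.pt) U.str := U.str_coassoc.symm

lemma isCoalgHom_actionHomLeft {X Y : M} (φ : X ⟶ Y) :
    IsCoalgHom (cofree c X) (cofree c Y) (φ ⊵ᵣ T) := by
  change φ ⊵ᵣ T ≫ Y ⊴ᵣ comul c ≫ (αᵣ Y T T).hom = (X ⊴ᵣ comul c ≫ (αᵣ X T T).hom) ≫ (φ ⊵ᵣ T) ⊵ᵣ T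
  rw [← action_exchange_assoc, actionHomLeft_tensor]
  simp

/-- The coaction comes from the morphism `lam (𝟙 a)` from a to T a, since its extension is the
unitor of T. Identities about coactions can therefore be verified on morphisms of C. -/
lemma str_eq_psi : U.str = (ρᵣ U.pt).inv ≫ U.psi (G := 𝟙_ (ProjCat k E)) (H := T) (c.lam (𝟙 a)) := by
  have h : coext c (G := 𝟙_ (ProjCat k E)) (H := T) (c.lam (𝟙 a)) = (ρ_ T).hom := by
    refine tensor_ext c fun {N} v => ?_
    rw [lam_coext, c.lam_map, Category.id_comp]
    exact (Category.comp_id _).symm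
  rw [psi, h, coact, actionHom_rightUnitor, unit_actionHomRight]
  simp

/-- The morphisms of coalgebras `T U ⟶ U` given by linear forms on `End a`. -/
lemma isCoalgHom_psi_coord (ξ : (a ⟶ a) →ₗ[k] k) :
    IsCoalgHom (cofree c U.pt) U
      (U.psi (G := T) (H := 𝟙_ (ProjCat k E)) (c.coord ξ) ≫ (ρᵣ U.pt).hom) := by
  -- The condition to be a morphism of coalgebras is the image under `psi` of this identity, which
  -- is tested on the copies of a.
  have h1 : c.coord ξ ≫ c.lam (𝟙 a) = (comul c).hom.app a ≫ T.obj.map (c.coord ξ) := by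
    refine c.ext _ _ fun v => ?_
    rw [reassoc_of% c.lam_coord, ← Category.assoc, lam_comul, c.lam_map, c.lam_coord]
    simp
  have e1 : U.psi (G := T) (H := T) (c.coord ξ ≫ c.lam (𝟙 a)) =
      U.psi (G := T) (H := 𝟙_ (ProjCat k E)) (c.coord ξ) ≫ U.psi (c.lam (𝟙 a)) :=
    U.psi_comp (H := 𝟙_ (ProjCat k E)) _ _
  have e2 : U.psi (G := T) (H := T) ((comul c).hom.app a ≫ T.obj.map (c.coord ξ)) =
      U.psi (G := T) (H := T ⊗ T) ((comul c).hom.app a) ≫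
      U.psi (G := T ⊗ T) (H := 𝟙_ (ProjCat k E) ⊗ T) (T.obj.map (c.coord ξ)) ≫
      U.psi (G := 𝟙_ (ProjCat k E) ⊗ T) (H := T) ((λ_ T).hom.hom.app a) := by
    rw [← U.psi_comp, ← U.psi_comp]
    exact congrArg (fun x => U.psi (G := T) (H := T) ((comul c).hom.app a ≫ x))
      (Category.comp_id (T.obj.map (c.coord ξ))).symm
  rw [U.psi_app, U.psi_app, U.psi_map (G := T) (H := 𝟙_ (ProjCat k E)) T, actionHom_leftUnitor] at e2
  change (_ ≫ _) ≫ U.str = (U.pt ⊴ᵣ comul c ≫ (αᵣ U.pt T T).hom) ≫ (_ ≫ _) ⊵ᵣ T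
  rw [str_eq_psi, Category.assoc, Iso.hom_inv_id_assoc, ← e1, h1, e2]
  simp

/-- The action of endomorphisms of `a` on a coalgebra. -/
noncomputable def psiEnd (b : a ⟶ a) : U.pt ⟶ U.pt :=
  (ρᵣ U.pt).inv ≫ U.psi (G := 𝟙_ (ProjCat k E)) (H := 𝟙_ (ProjCat k E)) b ≫ (ρᵣ U.pt).hom

section Decomposition

variable [AdditiveAction (ProjCat k E) M]

/-- Every morphism between coalgebras is a sum of compositions of morphisms of coalgebras with the
action of endomorphisms of `a`. -/
lemma exists_sum_psiEnd (φ : U.pt ⟶ V.pt) : ∃ (n : ℕ) (β : Fin n → (U.pt ⟶ V.pt))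
    (b : Fin n → (a ⟶ a)), (∀ i, IsCoalgHom U V (β i)) ∧ φ = ∑ i, β i ≫ V.psiEnd (b i) := by
  let x := Copower.basis k a a
  refine ⟨_, fun i => U.str ≫ φ ⊵ᵣ T ≫ V.psi (G := T) (H := 𝟙_ (ProjCat k E)) (c.coord (x.coord i)) ≫
    (ρᵣ V.pt).hom, fun i => x i, fun i => ?_, ?_⟩
  · exact U.isCoalgHom_str.comp ((isCoalgHom_actionHomLeft φ).comp (V.isCoalgHom_psi_coord _))
  -- By the counit law, φ is the coaction followed by T φ and the counit. The first two are
  -- morphisms of coalgebras, so only the counit has to be decomposed.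
  have h1 : φ = U.str ≫ φ ⊵ᵣ T ≫ V.pt ⊴ᵣ counit c ≫ (ρᵣ V.pt).hom := by
    rw [← action_exchange_assoc, unit_actionHomRight]
    have := U.str_counit
    simp only [Category.assoc, Iso.inv_hom_id, Category.comp_id]
    rw [← Category.assoc (U.pt ⊴ᵣ counit c), ← Category.assoc U.str, this, Category.id_comp]
  -- At a the counit T a ⟶ a is, by its definition, the sum of the coordinate projections followed
  -- by the basis elements of End a.
  have h2 : V.pt ⊴ᵣ counit c = ∑ i, V.psi (G := T) (H := 𝟙_ (ProjCat k E)) (c.coord (x.coord i)) ≫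
      V.psi (G := 𝟙_ (ProjCat k E)) (H := 𝟙_ (ProjCat k E)) (x i) := by
    have h3 : ∀ i, V.psi (G := T) (H := 𝟙_ (ProjCat k E)) (c.coord (x.coord i)) ≫
        V.psi (G := 𝟙_ (ProjCat k E)) (H := 𝟙_ (ProjCat k E)) (x i) =
        V.psi (G := T) (H := 𝟙_ (ProjCat k E)) (c.coord (x.coord i) ≫ x i) := fun i =>
      (V.psi_comp (G := T) (H := 𝟙_ (ProjCat k E)) (K := 𝟙_ (ProjCat k E)) _ _).symm
    rw [Finset.sum_congr rfl fun i _ => h3 i, ← V.psi_sum (G := T) (H := 𝟙_ (ProjCat k E)),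
      ← V.psi_app]
    congr 1
  conv_lhs => rw [h1, h2, Preadditive.sum_comp, Preadditive.comp_sum, Preadditive.comp_sum]
  refine Finset.sum_congr rfl fun i _ => ?_
  simp [psiEnd]

/-- Every morphism `G U ⟶ H V` is a sum of compositions of morphisms induced by morphisms of
coalgebras with morphisms induced by morphisms `G a ⟶ H a`. -/
lemma exists_sum_psi (hproj : ∀ G : ProjCat k E, addClosure (fun N => N = a) (G.obj.obj a))
    {G H : ProjCat k E} (φ : U.pt ⊙ᵣ G ⟶ V.pt ⊙ᵣ H) : ∃ (ι : Type) (_ : Fintype ι)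
    (β : ι → (U.pt ⟶ V.pt)) (f : ι → (G.obj.obj a ⟶ H.obj.obj a)),
    (∀ i, IsCoalgHom U V (β i)) ∧ φ = ∑ i, β i ⊵ᵣ G ≫ V.psi (f i) := by
  obtain ⟨n, Y, p, q, hY, hpq⟩ := hproj G
  obtain ⟨n', Y', p', q', hY', hpq'⟩ := hproj H
  obtain rfl : Y = fun _ => a := funext hY
  obtain rfl : Y' = fun _ => a := funext hY'
  let I := 𝟙_ (ProjCat k E)
  -- G a and H a are summands of sums of copies of a, so `psi` cuts φ into blocks U ⟶ V, to which
  -- the case G = H = 𝟙 applies.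
  choose m β b hβ hb using fun (i : Fin n) (j : Fin n') => exists_sum_psiEnd U V
    ((ρᵣ U.pt).inv ≫ U.psi (G := I) (H := G) (q i) ≫ φ ≫ V.psi (G := H) (H := I) (p' j) ≫
      (ρᵣ V.pt).hom)
  refine ⟨Σ (ij : Fin n × Fin n'), Fin (m ij.1 ij.2), inferInstance, fun x => β x.1.1 x.1.2 x.2,
    fun x => p x.1.1 ≫ b x.1.1 x.1.2 x.2 ≫ q' x.1.2, fun x => hβ _ _ _, ?_⟩
  have key : ∀ i j, U.psi (G := I) (H := G) (q i) ≫ φ ≫ V.psi (G := H) (H := I) (p' j) =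
      ∑ l, β i j l ⊵ᵣ I ≫ V.psi (G := I) (H := I) (b i j l) := fun i j => by
    have := congrArg (fun x => (ρᵣ[ProjCat k E] U.pt).hom ≫ x ≫ (ρᵣ[ProjCat k E] V.pt).inv) (hb i j)
    simp only [Category.assoc, Iso.hom_inv_id, Iso.hom_inv_id_assoc, Category.comp_id] at this
    rw [this, Preadditive.sum_comp, Preadditive.comp_sum]
    refine Finset.sum_congr rfl fun l _ => ?_
    simp [psiEnd, I]
  have h1 : (𝟙 (U.pt ⊙ᵣ G)) = ∑ i, U.psi (G := G) (H := I) (p i) ≫ U.psi (G := I) (H := G) (q i) := by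
    rw [← U.psi_id, ← hpq, U.psi_sum]
    exact Finset.sum_congr rfl fun i _ => U.psi_comp (H := I) _ _
  have h2 : (𝟙 (V.pt ⊙ᵣ H)) = ∑ i, V.psi (G := H) (H := I) (p' i) ≫ V.psi (G := I) (H := H) (q' i) := by
    rw [← V.psi_id, ← hpq', V.psi_sum]
    exact Finset.sum_congr rfl fun i _ => V.psi_comp (H := I) _ _
  calc φ = 𝟙 _ ≫ φ ≫ 𝟙 _ := by simp
    _ = ∑ ij : Fin n × Fin n', U.psi (G := G) (H := I) (p ij.1) ≫
        (U.psi (G := I) (H := G) (q ij.1) ≫ φ ≫ V.psi (G := H) (H := I) (p' ij.2)) ≫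
        V.psi (G := I) (H := H) (q' ij.2) := by
      rw [h1, h2, Fintype.sum_prod_type]
      simp only [Preadditive.sum_comp, Preadditive.comp_sum, Category.assoc]
      exact Finset.sum_comm
    _ = _ := by
      rw [Fintype.sum_sigma]
      refine Finset.sum_congr rfl fun ij _ => ?_
      rw [key, Preadditive.sum_comp, Preadditive.comp_sum]
      refine Finset.sum_congr rfl fun l _ => ?_
      rw [Category.assoc, ← Category.assoc, ← (hβ _ _ _).psi_comm, Category.assoc]
      congr 1
      exact ((V.psi_comp (G := G) (H := I) (K := H) (p ij.1) (b ij.1 ij.2 l ≫ q' ij.2)).trans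
        (congrArg _ (V.psi_comp (G := I) (H := I) (K := H) _ _))).symm

end Decomposition

end Coalg

end Coalgebras

/-! ### Local coalgebras and the radical filtration. -/

section LocalCoalgebras

variable {k : Type*} [Field k] {A : Type u} [Ring A] [Algebra k A] [FiniteDimensional k A]
  {C : Type*} [Category* C] [Preadditive C] [Linear k C] {E : C ≌ FGModuleCat.{u} A}
  [E.functor.Additive] [E.functor.Linear k]
  {a : C} {T : ProjCat k E} {c : Copower k a T.obj}
  [hfin : ∀ X Y : C, FiniteDimensional k (X ⟶ Y)]
  {M : Type*} [Category* M] [Preadditive M] [MonoidalRightAction (ProjCat k E) M]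

open ProjCat

namespace Coalg

/-- Coalgebras without nontrivial idempotent endomorphisms. -/
def IsLocal (U : Coalg c M) : Prop :=
  ∀ ε : U.pt ⟶ U.pt, IsCoalgHom U U ε → ε ≫ ε = ε → ε = 0 ∨ ε = 𝟙 _

/-- Idempotent endomorphisms of coalgebras split. -/
lemma exists_split [IsIdempotentComplete M] (U : Coalg c M) {ε : U.pt ⟶ U.pt}
    (hε : IsCoalgHom U U ε) (hεε : ε ≫ ε = ε) : ∃ (V : Coalg c M) (i : V.pt ⟶ U.pt)
    (r : U.pt ⟶ V.pt), IsCoalgHom V U i ∧ IsCoalgHom U V r ∧ i ≫ r = 𝟙 _ ∧ r ≫ i = ε := by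
  obtain ⟨V, i, r, hir, hri⟩ := IsIdempotentComplete.idempotents_split _ ε hεε
  have hri' : r ≫ i = ε := hri
  have hiε : i ≫ ε = i := by rw [← hri', reassoc_of% hir]
  have hεr : ε ≫ r = r := by rw [← hri', Category.assoc, hir, Category.comp_id]
  have hε' : ε ≫ U.str = U.str ≫ ε ⊵ᵣ T := hε
  -- As ε is a morphism of coalgebras, the coaction restricts to its image.
  have h1 : i ≫ U.str = (i ≫ U.str ≫ r ⊵ᵣ T) ≫ i ⊵ᵣ T := by
    rw [Category.assoc, Category.assoc, ← comp_actionHomLeft, hri', ← hε', reassoc_of% hiε]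
  refine ⟨⟨V, i ≫ U.str ≫ r ⊵ᵣ T, ?_, ?_⟩, i, r, h1, ?_, hir, hri⟩
  · have h2 := congrArg (fun x => i ≫ x ≫ r) U.str_counit
    simp only [Category.assoc, Category.id_comp, hir] at h2
    rw [← h2, Category.assoc, Category.assoc, ← action_exchange_assoc, unit_actionHomRight]
    simp
  · have h2 := congrArg (fun x => i ≫ x ≫ (r ⊵ᵣ T) ⊵ᵣ T) U.str_coassoc
    simp only [Category.assoc] at h2
    rw [comp_actionHomLeft, Category.assoc, Category.assoc, ← comp_actionHomLeft_assoc, hri',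
      comp_actionHomLeft, ← reassoc_of% hε', reassoc_of% hiε, h2, Category.assoc, Category.assoc,
      ← action_exchange_assoc, actionHomLeft_tensor]
    simp
  · change r ≫ i ≫ U.str ≫ r ⊵ᵣ T = U.str ≫ r ⊵ᵣ T
    rw [← Category.assoc, hri', ← Category.assoc, hε', Category.assoc, ← comp_actionHomLeft, hεr]

section

variable [AdditiveAction (ProjCat k E) M] [Linear k M] [LinearAction k (ProjCat k E) M]
  [hfinM : ∀ X Y : M, FiniteDimensional k (X ⟶ Y)] [IsAlgClosed k]

/-- End V embeds in End U by f ↦ r ≫ f ≫ i, and the image misses the identity. This provides the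
measure for inductions that split off direct summands. -/
lemma finrank_end_lt {V U : M} {i : V ⟶ U} {r : U ⟶ V} (h : i ≫ r = 𝟙 V) (h' : r ≫ i ≠ 𝟙 U) :
    Module.finrank k (V ⟶ V) < Module.finrank k (U ⟶ U) := by
  let φ : (V ⟶ V) →ₗ[k] (U ⟶ U) := Linear.leftComp k U r ∘ₗ Linear.rightComp k V i
  have hφ : ∀ f, φ f = r ≫ f ≫ i := fun f => rfl
  have hinj : Function.Injective φ := fun f g hfg => by
    have := congrArg (fun x => i ≫ x ≫ r) hfg
    simpa [hφ, h, reassoc_of% h] using this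
  rw [← LinearMap.finrank_range_of_inj hinj]
  refine Submodule.finrank_lt fun htop => h' ?_
  have : 𝟙 U ∈ LinearMap.range φ := htop ▸ Submodule.mem_top
  obtain ⟨f, hf⟩ := this
  rw [hφ] at hf
  have h1 : f = 𝟙 V := by
    have := congrArg (fun x => i ≫ x ≫ r) hf
    simpa [h, reassoc_of% h] using this
  rw [h1, Category.id_comp] at hf
  exact hf

include hfinM in
/-- Every indecomposable retract of a coalgebra is a retract of a local one. -/
lemma exists_isLocal [IsIdempotentComplete M] {Y : M} (hY : TrivIdem Y) (hY0 : ¬ IsZero Y)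
    (U : Coalg c M) (h : Nonempty (Retract Y U.pt)) :
    ∃ V : Coalg c M, V.IsLocal ∧ Nonempty (Retract Y V.pt) := by
  induction hn : Module.finrank k (U.pt ⟶ U.pt) using Nat.strong_induction_on generalizing U with
  | _ n ih =>
  by_cases hU : U.IsLocal
  · exact ⟨U, hU, h⟩
  unfold IsLocal at hU
  push Not at hU
  obtain ⟨ε, hε, hεε, hε0, hε1⟩ := hU
  have hε' : IsCoalgHom U U (𝟙 _ - ε) := by
    rw [sub_eq_add_neg, ← neg_one_smul k ε]
    exact (IsCoalgHom.id U).add (hε.smul _)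
  obtain ⟨V, i, r, -, -, hir, hri⟩ := U.exists_split hε hεε
  obtain ⟨W, i', r', -, -, hir', hri'⟩ := U.exists_split hε' (Idempotents.idem_of_id_sub_idem ε hεε)
  have hadd : addClosure (fun X => X = V.pt ∨ X = W.pt) U.pt := by
    refine ⟨2, ![V.pt, W.pt], fun x => ?_, fun x => ?_, ?_, ?_⟩
    · exact match x with | 0 => r | 1 => r'
    · exact match x with | 0 => i | 1 => i'
    · intro x; fin_cases x <;> simp
    · rw [Fin.sum_univ_two]
      change r ≫ i + r' ≫ i' = _
      rw [hri, hri']; abel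
  obtain ⟨X, hX, hr⟩ := exists_retract_of_addClosure k hY hY0 (addClosure_retract h.some hadd)
  rcases hX with rfl | rfl
  · exact ih _ (hn ▸ finrank_end_lt hir (hri ▸ hε1)) V hr rfl
  · refine ih _ (hn ▸ finrank_end_lt hir' (hri' ▸ fun h1 => hε0 (by simpa using h1))) W hr rfl

variable (U : Coalg c M)

/-- The algebra of endomorphisms of a coalgebra. -/
def endAlg : Subalgebra k (End U.pt) where
  carrier := {β | IsCoalgHom U U β}
  mul_mem' hβ hγ := IsCoalgHom.comp hγ hβ
  add_mem' hβ hγ := hβ.add hγ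
  algebraMap_mem' r := (IsCoalgHom.id U).smul r

instance : FiniteDimensional k (End U.pt) := inferInstanceAs (FiniteDimensional k (U.pt ⟶ U.pt))

instance : FiniteDimensional k U.endAlg := inferInstance

variable {U} in
lemma IsLocal.endAlg (hU : U.IsLocal) (e : U.endAlg) (he : e * e = e) : e = 0 ∨ e = 1 := by
  rcases hU e.1 e.2 (congrArg Subtype.val he) with h | h
  · exact Or.inl (Subtype.ext h)
  · exact Or.inr (Subtype.ext h)

/-- The morphisms `G U ⟶ H U` induced by the powers of the radical of the endomorphism ring. -/
def radHom (s : ℕ) (G H : ProjCat k E) : AddSubgroup (U.pt ⊙ᵣ G ⟶ U.pt ⊙ᵣ H) :=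
  AddSubgroup.closure {φ | ∃ x ∈ Ring.jacobson U.endAlg ^ s, ∃ f : G.obj.obj a ⟶ H.obj.obj a,
    φ = (x.1 : U.pt ⟶ U.pt) ⊵ᵣ G ≫ U.psi f}

/-- Morphisms of coalgebras commute with `psi`, so the radical factors can be collected on one side.
The degree reads t + s because multiplication in `End` is composition in the opposite order. -/
lemma radHom_comp {s t : ℕ} {G H K : ProjCat k E} {φ : U.pt ⊙ᵣ G ⟶ U.pt ⊙ᵣ H}
    {ψ : U.pt ⊙ᵣ H ⟶ U.pt ⊙ᵣ K} (hφ : φ ∈ U.radHom s G H) (hψ : ψ ∈ U.radHom t H K) :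
    φ ≫ ψ ∈ U.radHom (t + s) G K := by
  induction hφ using AddSubgroup.closure_induction with
  | zero => rw [zero_comp]; exact zero_mem _
  | add _ _ _ _ h1 h2 => rw [Preadditive.add_comp]; exact add_mem h1 h2
  | neg _ _ h => rw [Preadditive.neg_comp]; exact neg_mem h
  | mem φ hφ =>
    obtain ⟨x, hx, f, rfl⟩ := hφ
    induction hψ using AddSubgroup.closure_induction with
    | zero => rw [comp_zero]; exact zero_mem _
    | add _ _ _ _ h1 h2 => rw [Preadditive.comp_add]; exact add_mem h1 h2
    | neg _ _ h => rw [Preadditive.comp_neg]; exact neg_mem h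
    | mem ψ hψ =>
      obtain ⟨y, hy, g, rfl⟩ := hψ
      refine AddSubgroup.subset_closure ⟨y * x, Ideal.IsTwoSided.pow_add (I := Ring.jacobson U.endAlg) t s ▸
        Ideal.mul_mem_mul hy hx, f ≫ g, ?_⟩
      have h1 : IsCoalgHom U U y.1 := y.2
      rw [psi_comp, Category.assoc, ← Category.assoc (U.psi f), ← h1.psi_comm]
      change _ = ((x.1 : U.pt ⟶ U.pt) ≫ (y.1 : U.pt ⟶ U.pt)) ⊵ᵣ G ≫ _
      rw [comp_actionHomLeft]
      simp only [Category.assoc]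

/-- Degree zero is everything, by `exists_sum_psi`; so degree one is closed under composition with
arbitrary morphisms G U ⟶ H U. -/
lemma mem_radHom_zero (hproj : ∀ G : ProjCat k E, addClosure (fun N => N = a) (G.obj.obj a))
    {G H : ProjCat k E} (φ : U.pt ⊙ᵣ G ⟶ U.pt ⊙ᵣ H) : φ ∈ U.radHom 0 G H := by
  obtain ⟨ι, _, β, f, hβ, rfl⟩ := exists_sum_psi U U hproj φ
  refine sum_mem fun i _ => AddSubgroup.subset_closure ⟨⟨β i, hβ i⟩, ?_, f i, rfl⟩
  rw [Submodule.pow_zero, Ideal.one_eq_top]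
  exact Submodule.mem_top

lemma pow_mem_radHom {s : ℕ} {G : ProjCat k E} {φ : End (U.pt ⊙ᵣ G)} (hφ : φ ∈ U.radHom 1 G G) :
    (φ ^ (s + 1) : End (U.pt ⊙ᵣ G)) ∈ U.radHom (s + 1) G G := by
  induction s with
  | zero => simpa using hφ
  | succ s ih =>
    rw [pow_succ]
    exact U.radHom_comp hφ ih

lemma isNilpotent_of_mem_radHom {G : ProjCat k E} {φ : U.pt ⊙ᵣ G ⟶ U.pt ⊙ᵣ G}
    (hφ : φ ∈ U.radHom 1 G G) : IsNilpotent (show End (U.pt ⊙ᵣ G) from φ) := by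
  have : IsArtinianRing U.endAlg := IsArtinianRing.of_finite k _
  obtain ⟨s, hs⟩ := IsSemiprimaryRing.isNilpotent (R := U.endAlg)
  -- One more than the exponent that kills the radical, since `pow_mem_radHom` concerns positive
  -- powers only.
  refine ⟨s + 1, ?_⟩
  have h1 := U.pow_mem_radHom (s := s) hφ
  have h2 : Ring.jacobson U.endAlg ^ (s + 1) = 0 := by
    rw [Submodule.pow_succ, hs, zero_mul]
  have h3 : U.radHom (s + 1) G G ≤ ⊥ := by
    refine (AddSubgroup.closure_le _).2 ?_
    rintro _ ⟨x, hx, f, rfl⟩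
    rw [h2] at hx
    have : x = 0 := hx
    subst this
    change (0 : U.pt ⟶ U.pt) ⊵ᵣ G ≫ _ = 0
    rw [zero_actionHomLeft, zero_comp]
  exact h3 h1

/-- Modulo the radical, every morphism `G U ⟶ H U` comes from a morphism `G a ⟶ H a`. -/
lemma exists_psi_add (hproj : ∀ G : ProjCat k E, addClosure (fun N => N = a) (G.obj.obj a))
    (hU : U.IsLocal) {G H : ProjCat k E} (φ : U.pt ⊙ᵣ G ⟶ U.pt ⊙ᵣ H) :
    ∃ f : G.obj.obj a ⟶ H.obj.obj a, φ - U.psi f ∈ U.radHom 1 G H := by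
  obtain ⟨ι, _, β, f, hβ, rfl⟩ := exists_sum_psi U U hproj φ
  -- Locality makes each coalgebra endomorphism a scalar plus an element of the radical, and the
  -- scalars can be absorbed in the f i.
  choose r hr using fun i => exists_isNilpotent_sub k (R := U.endAlg) hU.endAlg ⟨β i, hβ i⟩
  refine ⟨∑ i, r i • f i, ?_⟩
  rw [U.psi_sum, ← Finset.sum_sub_distrib]
  refine sum_mem fun i _ => AddSubgroup.subset_closure
    ⟨⟨β i, hβ i⟩ - r i • 1, by rw [Submodule.pow_one]; exact mem_jacobson_of_isNilpotent k hU.endAlg (hr i), f i, ?_⟩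
  change _ = (β i - r i • 𝟙 U.pt) ⊵ᵣ G ≫ _
  rw [sub_actionHomLeft, LinearAction.smul_left, id_actionHomLeft, Preadditive.sub_comp, U.psi_smul]
  simp

/-- If `f : G a ⟶ H a` is nonzero, then the identity of `a` factors through `T f`. -/
lemma _root_.TwoRep.ProjCat.exists_factor (c : Copower k a T.obj)
    (hproj : ∀ G : ProjCat k E, addClosure (fun N => N = a) (G.obj.obj a))
    {G H : ProjCat k E} {f : G.obj.obj a ⟶ H.obj.obj a} (hf : f ≠ 0) :
    ∃ (s : a ⟶ T.obj.obj (G.obj.obj a)) (t : T.obj.obj (H.obj.obj a) ⟶ a),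
      s ≫ T.obj.map f ≫ t = 𝟙 a := by
  obtain ⟨n, Y, p, q, hY, hpq⟩ := hproj G
  obtain rfl : Y = fun _ => a := funext hY
  have : ∃ i, q i ≫ f ≠ 0 := by
    by_contra! hcon
    apply hf
    rw [← Category.id_comp f, ← hpq, Preadditive.sum_comp]
    exact Finset.sum_eq_zero fun i _ => by rw [Category.assoc, hcon, comp_zero]
  obtain ⟨i, hi⟩ := this
  obtain ⟨ξ, hξ⟩ := Module.Projective.exists_dual_eq_one k hi
  -- Under T f the copy of a indexed by q i goes to the copy indexed by q i ≫ f, which is nonzero,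
  -- and ξ projects back onto it.
  refine ⟨c.lam (q i), c.coord ξ, ?_⟩
  rw [reassoc_of% c.lam_map, c.lam_coord, hξ, one_smul]

end

end Coalg

end LocalCoalgebras

/-! ### Retracts of images, and factorisations through nilpotent morphisms. -/

section

variable {𝒢 D : Type*} [Category* 𝒢] [Preadditive 𝒢] [Category* D] [Preadditive D]

/-- Objects in the additive closure of the retracts of the image of an additive functor are
retracts of objects in the image. -/
lemma exists_retract_of_addClosure_image [HasFiniteBiproducts 𝒢] (Ψ : 𝒢 ⥤ D) [Ψ.Additive] {X : D}
    (hX : addClosure (fun W => ∃ G, Nonempty (Retract W (Ψ.obj G))) X) :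
    ∃ G, Nonempty (Retract X (Ψ.obj G)) := by
  obtain ⟨n, Y, p, q, hY, hpq⟩ := hX
  choose G hG using hY
  let r := fun i => (hG i).some
  refine ⟨⨁ G, ⟨⟨∑ i, p i ≫ (r i).i ≫ Ψ.map (biproduct.ι G i),
    ∑ i, Ψ.map (biproduct.π G i) ≫ (r i).r ≫ q i, ?_⟩⟩⟩
  rw [Preadditive.sum_comp, ← hpq]
  refine Finset.sum_congr rfl fun i _ => ?_
  rw [Preadditive.comp_sum, Finset.sum_eq_single i]
  · simp only [Category.assoc]
    rw [← Ψ.map_comp_assoc, biproduct.ι_π_self]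
    simp
  · intro j _ hj
    simp only [Category.assoc]
    rw [← Ψ.map_comp_assoc, biproduct.ι_π_ne _ hj.symm]
    simp
  · simp

/-- Nonzero idempotents are not nilpotent. -/
lemma not_isNilpotent_of_idem {X : D} {e : X ⟶ X} (he : e ≫ e = e) (h0 : e ≠ 0) :
    ¬ IsNilpotent (show End X from e) := fun ⟨n, hn⟩ => h0 (by
  have h1 : ∀ m : ℕ, (show End X from e) ^ (m + 1) = (show End X from e) := fun m => by
    induction m with
    | zero => rw [pow_one]
    | succ m ih => rw [pow_succ, ih]; exact he
  have h2 := h1 n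
  rw [pow_succ, hn, zero_mul] at h2
  exact h2.symm)

/-- The identity of a nonzero object does not factor through a morphism that generates a nil
ideal. -/
lemma not_isIso_of_isNilpotent {X Y Z : D} (hZ : ¬ IsZero Z) (a : Z ⟶ X) (ν : X ⟶ Y) (b : Y ⟶ Z)
    (hν : ∀ x : Y ⟶ X, IsNilpotent (show End X from ν ≫ x)) : ¬ IsIso (a ≫ ν ≫ b) := fun hu => by
  have h1 : a ≫ ν ≫ b ≫ inv (a ≫ ν ≫ b) = 𝟙 Z := by
    have := IsIso.hom_inv_id (a ≫ ν ≫ b)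
    simpa only [Category.assoc] using this
  -- The factorisation of the identity of Z makes this a nonzero idempotent of X, although it lies
  -- in the nil ideal.
  refine not_isNilpotent_of_idem (e := ν ≫ b ≫ inv (a ≫ ν ≫ b) ≫ a) ?_ (fun h0 => hZ ?_) (hν _)
  · simp only [Category.assoc]
    rw [reassoc_of% h1]
  · rw [IsZero.iff_id_eq_zero]
    have := congrArg (fun x => a ≫ x ≫ ν ≫ b ≫ inv (a ≫ ν ≫ b)) h0
    simp only [Category.assoc, reassoc_of% h1, h1] at this
    simpa using this

end

section

/-- The projection to the quotient by the largest stable ideal that avoids `R`. -/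
abbrev toQuot (𝒞 : Type*) [Category* 𝒞] [MonoidalCategory 𝒞] {D : Type*} [Category* D]
    [Preadditive D] [MonoidalRightAction 𝒞 D] (R : ObjectProperty D) :
    D ⥤ (avoidingIdeal 𝒞 R).QuotCat :=
  CategoryTheory.Quotient.functor (avoidingIdeal 𝒞 R).rel

end

/-! ### Generating the quotient from one object. -/

section RetractQuotient

variable (k : Type*) [Field k] [IsAlgClosed k] {𝒞 : Type*} [Category* 𝒞] [MonoidalCategory 𝒞]
  [Preadditive 𝒞]
  {D : Type*} [Category* D] [Preadditive D] [Linear k D] [MonoidalRightAction 𝒞 D]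
  [AdditiveAction 𝒞 D] [hfinD : ∀ X Y : D, FiniteDimensional k (X ⟶ Y)]
  {R : ObjectProperty D} (hR : ∀ Z, R Z → TrivIdem Z) (hR' : ∀ Z, R Z → ¬ IsZero Z)
  (hgen : ∀ X : D, addClosure (fun W => ∃ (Y : D) (G : 𝒞),
    (R Y ∨ ∀ Z, R Z → ¬ ActsOnto 𝒞 Y Z) ∧ Nonempty (W ≅ Y ⊙ᵣ G)) X)

include k hR hR' hgen in
-- Generators that do not act onto R die in the quotient, and those in R are reached from U. Finite
-- biproducts of 1-morphisms merge the summands into one G U.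
lemma exists_retract_quotient [HasFiniteBiproducts 𝒞] (U : D)
    (h : ∀ Y, R Y → ActsOnto 𝒞 U Y)
    (X : (avoidingIdeal 𝒞 R).QuotCat) : ∃ G : 𝒞, Nonempty (Retract X
      ((toQuot 𝒞 R).obj (U ⊙ᵣ G))) := by
  let I := avoidingIdeal 𝒞 R
  let π := CategoryTheory.Quotient.functor I.rel
  refine exists_retract_of_addClosure_image (orbit 𝒞 U ⋙ π) ?_
  refine addClosure_idem (addClosure_map π (S := _) ?_ (hgen X.as))
  rintro W ⟨Y, G, hY, ⟨e⟩⟩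
  refine addClosure_of_mem (addClosure_of_mem ?_)
  rcases hY with hY | hY
  · obtain ⟨H, ⟨r⟩⟩ := h Y hY
    exact ⟨H ⊗ G, ⟨((Retract.ofIso e).trans ((retractAct r G).trans
      (Retract.ofIso (αᵣ U H G).symm))).map π⟩⟩
  · have h0 : 𝟙 Y ∈ I.hom Y Y := (id_mem_avoidingIdeal_iff k hR hR' Y).2 hY
    have h1 : 𝟙 (Y ⊙ᵣ G) ∈ I.hom (Y ⊙ᵣ G) (Y ⊙ᵣ G) := by
      rw [← id_actionHomLeft]; exact I.action G h0
    have h2 : π.map (𝟙 W) = 0 := by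
      have : 𝟙 W = e.hom ≫ 𝟙 (Y ⊙ᵣ G) ≫ e.inv := by simp
      rw [this, π.map_comp, π.map_comp, (quotient_map_eq_zero_iff I _).2 h1]
      simp
    -- Here W vanishes in the quotient, so it is a retract of anything.
    exact ⟨𝟙_ _, ⟨⟨0, 0, by rw [zero_comp, ← h2, π.map_id]⟩⟩⟩

end RetractQuotient

/-! ### Subquotients on which T does not act by zero. -/

section Subquotients

variable {k : Type*} [Field k] [IsAlgClosed k] {A : Type u} [Ring A] [Algebra k A]
  [FiniteDimensional k A]
  {C : Type*} [Category* C] [Preadditive C] [Linear k C] {E : C ≌ FGModuleCat.{u} A}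
  [E.functor.Additive] [E.functor.Linear k]
  {a : C} {T : ProjCat k E} (c : Copower k a T.obj)
  [hfin : ∀ X Y : C, FiniteDimensional k (X ⟶ Y)]
  {D : Type*} [Category* D] [Preadditive D] [Linear k D] [MonoidalRightAction (ProjCat k E) D]
  [AdditiveAction (ProjCat k E) D] [LinearAction k (ProjCat k E) D]
  [hfinD : ∀ X Y : D, FiniteDimensional k (X ⟶ Y)]

open ProjCat

section Coalgebra

variable (hproj : ∀ G : ProjCat k E, addClosure (fun N => N = a) (G.obj.obj a))
  {c} (U : Coalg c D) (hU : U.IsLocal)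

namespace Coalg

omit hU in
lemma radHom_action {n : ℕ} {G H : ProjCat k E} (K : ProjCat k E) {ν : U.pt ⊙ᵣ G ⟶ U.pt ⊙ᵣ H}
    (hν : ν ∈ U.radHom n G H) :
    (αᵣ U.pt G K).hom ≫ ν ⊵ᵣ K ≫ (αᵣ U.pt H K).inv ∈ U.radHom n (G ⊗ K) (H ⊗ K) := by
  induction hν using AddSubgroup.closure_induction with
  | zero => rw [zero_actionHomLeft, zero_comp, comp_zero]; exact zero_mem _
  | add _ _ _ _ h1 h2 =>
    rw [AdditiveAction.add_left, Preadditive.add_comp, Preadditive.comp_add]; exact add_mem h1 h2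
  | neg _ _ h =>
    rw [neg_actionHomLeft, Preadditive.neg_comp, Preadditive.comp_neg]; exact neg_mem h
  | mem φ hφ =>
    obtain ⟨x, hx, f, rfl⟩ := hφ
    refine AddSubgroup.subset_closure ⟨x, hx, K.obj.map f, ?_⟩
    rw [U.psi_map, actionHomLeft_tensor]
    simp

include hproj

/-- The radical part is stable under the action and generates nil ideals, so no identity of a
nonzero object factors through it. This kills the obstruction to fullness. -/
lemma mem_avoidingIdeal_of_radHom {R : ObjectProperty D} (hR : ∀ Z, R Z → TrivIdem Z)
    (hR' : ∀ Z, R Z → ¬ IsZero Z) {G H : ProjCat k E} {ν : U.pt ⊙ᵣ G ⟶ U.pt ⊙ᵣ H}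
    (hν : ν ∈ U.radHom 1 G H) :
    ν ∈ (avoidingIdeal (ProjCat k E) R).hom (U.pt ⊙ᵣ G) (U.pt ⊙ᵣ H) := by
  rw [mem_avoidingIdeal_iff k hR hR']
  intro Z hZ K a b hab
  have h1 := U.radHom_action K hν
  generalize hν' : (αᵣ U.pt G K).hom ≫ ν ⊵ᵣ K ≫ (αᵣ U.pt H K).inv = ν' at h1
  have h2 : ∀ x : U.pt ⊙ᵣ (H ⊗ K) ⟶ U.pt ⊙ᵣ (G ⊗ K),
      IsNilpotent (show End (U.pt ⊙ᵣ (G ⊗ K)) from ν' ≫ x) := fun x => by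
    have h3 := U.radHom_comp h1 (U.mem_radHom_zero hproj x)
    rw [zero_add] at h3
    exact U.isNilpotent_of_mem_radHom h3
  refine not_isIso_of_isNilpotent (hR' Z hZ) (a ≫ (αᵣ U.pt G K).inv) ν' ((αᵣ U.pt H K).hom ≫ b)
    h2 ?_
  rw [← hν']
  simpa using hab

include hU

/-- For a local coalgebra, nonzero morphisms `f : G a ⟶ H a` induce morphisms that generate the
identity, up to nilpotent morphisms. -/
lemma exists_isIso_of_ne_zero {G H : ProjCat k E} {f : G.obj.obj a ⟶ H.obj.obj a} (hf : f ≠ 0)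
    {φ : U.pt ⊙ᵣ G ⟶ U.pt ⊙ᵣ H} (hφ : φ - U.psi f ∈ U.radHom 1 G H) :
    ∃ (s : U.pt ⟶ (U.pt ⊙ᵣ G) ⊙ᵣ T) (t : (U.pt ⊙ᵣ H) ⊙ᵣ T ⟶ U.pt), s ≫ φ ⊵ᵣ T ≫ t = 𝟙 U.pt := by
  let I := 𝟙_ (ProjCat k E)
  obtain ⟨s, t, hst⟩ := exists_factor c hproj hf
  have h1 : U.psi (G := I) (H := G ⊗ T) s ≫ U.psi (G := G ⊗ T) (H := H ⊗ T) (T.obj.map f) ≫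
      U.psi (G := H ⊗ T) (H := I) t = 𝟙 _ := by
    rw [← U.psi_comp, ← U.psi_comp]
    exact (congrArg (U.psi (G := I) (H := I)) hst).trans (U.psi_id I)
  rw [U.psi_map] at h1
  let s' : U.pt ⊙ᵣ I ⟶ (U.pt ⊙ᵣ G) ⊙ᵣ T := U.psi (G := I) (H := G ⊗ T) s ≫ (αᵣ U.pt G T).hom
  let t' : (U.pt ⊙ᵣ H) ⊙ᵣ T ⟶ U.pt ⊙ᵣ I := (αᵣ U.pt H T).inv ≫ U.psi (G := H ⊗ T) (H := I) t
  have h2 : s' ≫ U.psi f ⊵ᵣ T ≫ t' = 𝟙 _ := by simpa [s', t'] using h1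
  -- The factorisation for `psi f` differs from the one for φ by a radical, hence nilpotent, term,
  -- so the composite stays invertible.
  have h3 : s' ≫ (φ - U.psi f) ⊵ᵣ T ≫ t' ∈ U.radHom 1 I I := by
    generalize φ - U.psi f = ν at hφ
    have h4 := U.radHom_action T hφ
    have := U.radHom_comp (U.mem_radHom_zero hproj (U.psi (G := I) (H := G ⊗ T) s))
      (U.radHom_comp h4 (U.mem_radHom_zero hproj (U.psi (G := H ⊗ T) (H := I) t)))
    simpa [s', t'] using this
  have h5 : IsUnit (show End (U.pt ⊙ᵣ I) from s' ≫ φ ⊵ᵣ T ≫ t') := by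
    have h6 : s' ≫ φ ⊵ᵣ T ≫ t' = 𝟙 _ + s' ≫ (φ - U.psi f) ⊵ᵣ T ≫ t' := by
      rw [sub_actionHomLeft, ← h2]
      simp
    rw [h6]
    exact IsNilpotent.isUnit_one_add (U.isNilpotent_of_mem_radHom h3)
  have h7 : IsIso (s' ≫ φ ⊵ᵣ T ≫ t') := (isUnit_iff_isIso _).1 h5
  refine ⟨(ρᵣ[ProjCat k E] U.pt).inv ≫ s', t' ≫ inv (s' ≫ φ ⊵ᵣ T ≫ t') ≫ (ρᵣ U.pt).hom, ?_⟩
  have h8 := IsIso.hom_inv_id (s' ≫ φ ⊵ᵣ T ≫ t')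
  simp only [Category.assoc] at h8 ⊢
  rw [reassoc_of% h8, Iso.inv_hom_id]

/-- A local coalgebra can be recovered from any nonzero retract of an object `G U`. -/
lemma retract_of_retract {Z : D} (hZ : ¬ IsZero Z) {G : ProjCat k E}
    (h : Retract Z (U.pt ⊙ᵣ G)) : Nonempty (Retract U.pt (Z ⊙ᵣ T)) := by
  obtain ⟨f, hf⟩ := U.exists_psi_add hproj hU (h.r ≫ h.i)
  -- If f were zero, the idempotent with image Z would lie in the radical part and so be nilpotent.
  have hf0 : f ≠ 0 := by
    rintro rfl
    rw [U.psi_zero, sub_zero] at hf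
    refine not_isNilpotent_of_idem (e := h.r ≫ h.i) (by simp) (fun h0 => hZ ?_)
      (U.isNilpotent_of_mem_radHom hf)
    rw [IsZero.iff_id_eq_zero]
    have := congrArg (fun f => h.i ≫ f ≫ h.r) h0
    simpa using this
  obtain ⟨s, t, hst⟩ := U.exists_isIso_of_ne_zero hproj hU hf0 hf
  rw [comp_actionHomLeft] at hst
  exact ⟨⟨s ≫ h.r ⊵ᵣ T, h.i ⊵ᵣ T ≫ t, by simpa using hst⟩⟩

end Coalg

end Coalgebra

section TypeOne

variable (hproj : ∀ G : ProjCat k E, addClosure (fun N => N = a) (G.obj.obj a))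
  {R : ObjectProperty D} (hR : ∀ Z, R Z → TrivIdem Z) (hR' : ∀ Z, R Z → ¬ IsZero Z)
  (hgen : ∀ X : D, addClosure (fun W => ∃ (Y : D) (G : ProjCat k E),
    (R Y ∨ ∀ Z, R Z → ¬ ActsOnto (ProjCat k E) Y Z) ∧ Nonempty (W ≅ Y ⊙ᵣ G)) X)
  (htrans : ∀ Y Z, R Y → R Z → ActsOnto (ProjCat k E) Y Z)

include hproj hR hR' hgen htrans in
/-- The structure of a simple transitive subquotient on which `T` does not act by zero. -/
theorem exists_coalg_quotient [IsIdempotentComplete D] [HasFiniteBiproducts (ProjCat k E)]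
    (h1 : ∃ Y Z, R Y ∧ R Z ∧ Nonempty (Retract Z (Y ⊙ᵣ T))) : ∃ U : Coalg c D,
    (U.psiFunctor ⋙ toQuot (ProjCat k E) R).Full ∧
    (U.psiFunctor ⋙ toQuot (ProjCat k E) R).Faithful ∧
    ∀ X, ∃ G, Nonempty (Retract X ((U.psiFunctor ⋙ toQuot (ProjCat k E) R).obj G)) := by
  let I := avoidingIdeal (ProjCat k E) R
  let π := CategoryTheory.Quotient.functor I.rel
  obtain ⟨Y, Z, hY, hZ, hr⟩ := h1
  -- Z is a summand of T Y, which underlies a cofree coalgebra. A local coalgebra having Z as a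
  -- summand then acts onto Z and, by transitivity, onto all of R.
  obtain ⟨U, hU, ⟨r⟩⟩ := Coalg.exists_isLocal (hR Z hZ) (hR' Z hZ) (Coalg.cofree c Y) hr
  have hUZ : ActsOnto (ProjCat k E) U.pt Z := ⟨𝟙_ _, ⟨r.trans (Retract.ofIso (ρᵣ U.pt).symm)⟩⟩
  have hUR : ∀ Y, R Y → ActsOnto (ProjCat k E) U.pt Y := fun Y hY => hUZ.trans _ (htrans Z Y hZ hY)
  refine ⟨U, ⟨?_⟩, ?_, fun X => ?_⟩
  · intro G H φ
    obtain ⟨φ, rfl⟩ := π.map_surjective (X := U.pt ⊙ᵣ G.fn) (Y := U.pt ⊙ᵣ H.fn) φ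
    obtain ⟨f, hf⟩ := U.exists_psi_add hproj hU φ
    refine ⟨f, ?_⟩
    change π.map (U.psi f) = π.map φ
    refine Eq.symm (sub_eq_zero.1 ?_)
    rw [← π.map_sub, quotient_map_eq_zero_iff]
    exact U.mem_avoidingIdeal_of_radHom hproj hR hR' hf
  · refine ⟨fun {G H} f g hfg => ?_⟩
    by_contra hne
    have h1 : π.map (U.psi (G := G.fn) (H := H.fn) (f - g)) = 0 :=
      ((U.psiFunctor ⋙ π).map_sub (f := f) (g := g)).trans (sub_eq_zero.2 hfg)
    rw [quotient_map_eq_zero_iff] at h1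
    obtain ⟨s, t, hst⟩ := U.exists_isIso_of_ne_zero hproj hU (G := G.fn) (H := H.fn) (f := f - g)
      (sub_ne_zero.2 hne) (φ := U.psi (f - g)) (by rw [sub_self]; exact zero_mem _)
    -- A nonzero morphism in the kernel would put the identity of U in the ideal, although U acts
    -- onto Z.
    have h2 : 𝟙 U.pt ∈ I.hom U.pt U.pt := by
      rw [← hst]
      exact I.comp_left s (I.comp_right t (I.action T h1))
    exact (id_mem_avoidingIdeal_iff k hR hR' _).1 h2 Z hZ hUZ
  · obtain ⟨G, hG⟩ := exists_retract_quotient k hR hR' hgen U.pt hUR X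
    exact ⟨⟨G⟩, hG⟩

end TypeOne

end Subquotients

/-! ### Top classes: the common setting for subquotients and cell 2-representations. -/

section

variable (k : Type*) [Field k] [IsAlgClosed k] {D : Type*} [Category* D] [Preadditive D] [Linear k D]

include k in
-- The nilpotent elements of a local endomorphism ring lie in its radical, a proper two-sided ideal.
lemma TrivIdem.isNilpotent_comp {X : D} [FiniteDimensional k (X ⟶ X)] (h : TrivIdem X)
    (hX : ¬ IsZero X) {n : X ⟶ X} (hn : IsNilpotent (show End X from n)) (x : X ⟶ X) :
    IsNilpotent (show End X from n ≫ x) := by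
  have : FiniteDimensional k (End X) := ‹_›
  refine (isIso_or_isNilpotent k h (n ≫ x)).resolve_left fun hiso => ?_
  have h1 : (show End X from n ≫ x) ∈ Ring.jacobson (End X) :=
    Ideal.mul_mem_left _ (show End X from x) (mem_jacobson_of_isNilpotent k (end_trivial h) hn)
  have hN : Nontrivial (End X) := ⟨1, 0, fun h0 => hX ((IsZero.iff_id_eq_zero X).2 h0)⟩
  exact (Ring.jacobson_lt_top (R := End X)).ne
    (Ideal.eq_top_of_isUnit_mem _ h1 ((isUnit_iff_isIso _).2 hiso))

end

section

variable (𝒞 : Type*) [Category* 𝒞] [MonoidalCategory 𝒞] [Preadditive 𝒞]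
  {D : Type*} [Category* D] [Preadditive D] [MonoidalRightAction 𝒞 D]

/-- A nonempty class `R` of objects with local endomorphism rings that forms a single class for the
action preorder, and such that `D` is generated by `R` and by objects that do not act onto `R`. -/
structure IsTopClass (R : ObjectProperty D) : Prop where
  nonempty : ∃ Z, R Z
  trivIdem : ∀ Z, R Z → TrivIdem Z
  not_isZero : ∀ Z, R Z → ¬ IsZero Z
  gen : ∀ X : D, addClosure (fun W => ∃ (Y : D) (G : 𝒞),
    (R Y ∨ ∀ Z, R Z → ¬ ActsOnto 𝒞 Y Z) ∧ Nonempty (W ≅ Y ⊙ᵣ G)) X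
  trans : ∀ Y Z, R Y → R Z → ActsOnto 𝒞 Y Z

/-- `T` does not act by zero on the class `R`. -/
def ActsNonzero {𝒞} [Category* 𝒞] [MonoidalCategory 𝒞] [MonoidalRightAction 𝒞 D] (T : 𝒞)
    (R : ObjectProperty D) : Prop :=
  ∃ Y Z, R Y ∧ R Z ∧ Nonempty (Retract Z (Y ⊙ᵣ T))

end

/-! ### Equivariance of orbit functors. -/

section Orbit

variable {𝒞 : Type*} [Category* 𝒞] [MonoidalCategory 𝒞]
  {D : Type*} [Category* D] [MonoidalRightAction 𝒞 D]

instance orbitRightLinear (X : D) : (orbit 𝒞 X).RightLinear 𝒞 :=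
  rightLinearOfIso _ (fun G F => (αᵣ X G F).symm)
    (fun G F F' α => by
      change (X ⊙ᵣ G) ⊴ᵣ α ≫ (αᵣ X G F').inv = (αᵣ X G F).inv ≫ X ⊴ᵣ (G ◁ α)
      rw [whiskerRight_actionHomLeft, Iso.inv_hom_id_assoc])
    (fun G H f F => by
      change (X ⊴ᵣ f) ⊵ᵣ F ≫ (αᵣ X H F).inv = (αᵣ X G F).inv ≫ X ⊴ᵣ (f ▷ F)
      rw [actionHomRight_whiskerRight, Iso.inv_hom_id_assoc])
    (fun G F F' => by
      change (αᵣ X G (F ⊗ F')).inv ≫ X ⊴ᵣ (α_ G F F').inv =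
        (αᵣ (X ⊙ᵣ G) F F').hom ≫ (αᵣ X G F).inv ⊵ᵣ F' ≫ (αᵣ X (G ⊗ F) F').inv
      rw [Iso.inv_comp_eq]
      have := actionHom_associator G F F' X
      rw [← cancel_epi (X ⊴ᵣ (α_ G F F').hom), ← actionHomRight_comp, Iso.hom_inv_id,
        actionHomRight_id, reassoc_of% this]
      simp)
    (fun G => by
      change (ρᵣ (X ⊙ᵣ G)).hom = (αᵣ X G (𝟙_ _)).inv ≫ X ⊴ᵣ (ρ_ G).hom
      rw [actionHom_rightUnitor, Iso.inv_hom_id_assoc])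

instance {k : Type*} [Field k] [Preadditive 𝒞] [Linear k 𝒞] [Preadditive D] [Linear k D]
    [AdditiveAction 𝒞 D] [LinearAction k 𝒞 D] (X : D) : (orbit 𝒞 X).Linear k :=
  ⟨fun f r => LinearAction.smul_right X r f⟩

end Orbit

/-! ### Uniqueness when T does not act by zero. -/

section TypeOne

variable {k : Type*} [Field k] [IsAlgClosed k] {A : Type u} [Ring A] [Algebra k A]
  [FiniteDimensional k A]
  {C : Type*} [Category* C] [Preadditive C] [Linear k C] {E : C ≌ FGModuleCat.{u} A}
  [E.functor.Additive] [E.functor.Linear k]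
  {a : C} {T : ProjCat k E} (c : Copower k a T.obj)
  [hfin : ∀ X Y : C, FiniteDimensional k (X ⟶ Y)]
  {D : Type*} [Category* D] [Preadditive D] [Linear k D] [MonoidalRightAction (ProjCat k E) D]
  [AdditiveAction (ProjCat k E) D] [LinearAction k (ProjCat k E) D]
  [hfinD : ∀ X Y : D, FiniteDimensional k (X ⟶ Y)] [IsIdempotentComplete D]
  {D' : Type*} [Category* D'] [Preadditive D'] [Linear k D'] [MonoidalRightAction (ProjCat k E) D']
  [AdditiveAction (ProjCat k E) D'] [LinearAction k (ProjCat k E) D']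
  [hfinD' : ∀ X Y : D', FiniteDimensional k (X ⟶ Y)] [IsIdempotentComplete D']

include c in
-- Both quotients are idempotent completions of full and faithful images of the same `EvalCat`; in
-- particular both kernels are trivial.
theorem equivalent_of_actsNonzero
    (hproj : ∀ G : ProjCat k E, addClosure (fun N => N = a) (G.obj.obj a))
    [HasFiniteBiproducts (ProjCat k E)]
    {R : ObjectProperty D} (hR : IsTopClass (ProjCat k E) R) (h : ActsNonzero T R)
    {R' : ObjectProperty D'} (hR' : IsTopClass (ProjCat k E) R') (h' : ActsNonzero T R') :
    Equivalent k (ProjCat k E) (avoidingIdeal (ProjCat k E) R).QuotCat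
      (avoidingIdeal (ProjCat k E) R').QuotCat := by
  obtain ⟨U, h1, h2, h3⟩ := exists_coalg_quotient c hproj hR.trivIdem hR.not_isZero hR.gen hR.trans h
  obtain ⟨U', h1', h2', h3'⟩ :=
    exists_coalg_quotient c hproj hR'.trivIdem hR'.not_isZero hR'.gen hR'.trans h'
  have := isIdempotentComplete_quotient (avoidingIdeal (ProjCat k E) R) k
  have := isIdempotentComplete_quotient (avoidingIdeal (ProjCat k E) R') k
  refine equivalent_of_sameKernel (Ψ := U.psiFunctor ⋙ toQuot (ProjCat k E) R)
    (Ψ' := U'.psiFunctor ⋙ toQuot (ProjCat k E) R') k (ProjCat k E) ?_ h3 h3'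
  exact fun G H f g => ⟨fun h => congrArg _ (Functor.map_injective _ h),
    fun h => congrArg _ (Functor.map_injective _ h)⟩

end TypeOne

/-! ### Uniqueness when T acts by zero. -/

section TypeZero

variable {k : Type*} [Field k] [IsAlgClosed k] {𝒞 : Type*} [Category* 𝒞] [MonoidalCategory 𝒞]
  [Preadditive 𝒞] [Linear k 𝒞] {T : 𝒞}
  {D : Type*} [Category* D] [Preadditive D] [Linear k D] [MonoidalRightAction 𝒞 D]
  [AdditiveAction 𝒞 D] [LinearAction k 𝒞 D]
  [hfinD : ∀ X Y : D, FiniteDimensional k (X ⟶ Y)]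
  (hpr : ∀ G : 𝒞, addClosure (fun F => F = 𝟙_ 𝒞 ∨ F = T) G)
  (hTr : ∀ G : 𝒞, addClosure (fun F => F = T) (G ⊗ T))
  {R : ObjectProperty D} (hR : IsTopClass 𝒞 R) (h0 : ¬ ActsNonzero T R)

include hTr hR h0 k in
-- Vanishing of T on R spreads to all X. If X is built from objects G Y, then T X is built from
-- copies of T Y, because T absorbs G. A local Z would then be a summand of one T Y, with Y either
-- in R or not acting onto R.
lemma not_retract_action (X Z : D) (hZ : R Z) : IsEmpty (Retract Z (X ⊙ᵣ T)) := by
  refine ⟨fun r => ?_⟩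
  have h1 : addClosure (fun W => ∃ Y : D, (R Y ∨ ∀ Z, R Z → ¬ ActsOnto 𝒞 Y Z) ∧ W = Y ⊙ᵣ T)
      (X ⊙ᵣ T) := by
    refine addClosure_map (actBy T) (fun W => ?_) (hR.gen X)
    rintro ⟨Y, G, hY, ⟨e⟩⟩
    refine addClosure_retract ((retractAct (Retract.ofIso e) T).trans
      (Retract.ofIso (αᵣ Y G T).symm)) ?_
    refine addClosure_map (orbit 𝒞 Y) (fun F hF => addClosure_of_mem ⟨Y, hY, ?_⟩) (hTr G)
    rw [hF]
    rfl
  obtain ⟨_, ⟨Y, hY, rfl⟩, ⟨r'⟩⟩ := exists_retract_of_addClosure k (hR.trivIdem Z hZ)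
    (hR.not_isZero Z hZ) (addClosure_retract r h1)
  rcases hY with hY | hY
  · exact h0 ⟨Y, Z, hY, hZ, ⟨r'⟩⟩
  · exact hY Z hZ ⟨T, ⟨r'⟩⟩

include hpr hTr hR h0 k in
-- The identity of G is a sum of morphisms through 𝟙 and T. One term stays invertible on the local
-- object Z, and it cannot be one through T.
lemma exists_isIso_through_unit {X Z : D} (hZ : R Z) {G : 𝒞} (a : Z ⟶ X ⊙ᵣ G) (b : X ⊙ᵣ G ⟶ Z)
    (hab : IsIso (a ≫ b)) : ∃ (p : G ⟶ 𝟙_ 𝒞) (q : 𝟙_ 𝒞 ⟶ G),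
    IsIso (a ≫ X ⊴ᵣ p ≫ X ⊴ᵣ q ≫ b) := by
  obtain ⟨n, F, p, q, hF, hpq⟩ := hpr G
  have h1 : ∑ i, a ≫ X ⊴ᵣ p i ≫ X ⊴ᵣ q i ≫ b = a ≫ b := by
    have := congrArg (fun x => a ≫ X ⊴ᵣ x ≫ b) hpq
    simpa [actionHomRight_sum, Preadditive.comp_sum, Preadditive.sum_comp] using this
  obtain ⟨i, -, hi⟩ := exists_isIso_of_sum k (hR.trivIdem Z hZ) (hR.not_isZero Z hZ)
    Finset.univ (fun i => a ≫ X ⊴ᵣ p i ≫ X ⊴ᵣ q i ≫ b) (by rw [h1]; exact hab)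
  have h2 : Nonempty (Retract Z (X ⊙ᵣ F i)) :=
    ⟨⟨a ≫ X ⊴ᵣ p i, X ⊴ᵣ q i ≫ b ≫ inv (a ≫ X ⊴ᵣ p i ≫ X ⊴ᵣ q i ≫ b), by
      have := IsIso.hom_inv_id (a ≫ X ⊴ᵣ p i ≫ X ⊴ᵣ q i ≫ b)
      simpa only [Category.assoc] using this⟩⟩
  rcases hF i with hi' | hi'
  · generalize p i = p at *
    generalize q i = q at *
    generalize F i = F at *
    subst hi'
    exact ⟨p, q, hi⟩
  · rw [hi'] at h2
    exact ((not_retract_action (k := k) hTr hR h0 X Z hZ).false h2.some).elim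

include hpr hTr hR h0 k in
-- By the factorisation through 𝟙, the 1-morphism in the general description of the ideal can be
-- dropped.
lemma mem_avoidingIdeal_iff_of_not_actsNonzero {X Y : D} (f : X ⟶ Y) :
    f ∈ (avoidingIdeal 𝒞 R).hom X Y ↔ ∀ Z, R Z → ∀ (a : Z ⟶ X) (b : Y ⟶ Z), ¬ IsIso (a ≫ f ≫ b) := by
  rw [mem_avoidingIdeal_iff k hR.trivIdem hR.not_isZero]
  refine ⟨fun h Z hZ a b hab => h Z hZ (𝟙_ 𝒞) (a ≫ (ρᵣ X).inv) ((ρᵣ Y).hom ≫ b) ?_,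
    fun h Z hZ K a b hab => ?_⟩
  · have : (a ≫ (ρᵣ[𝒞] X).inv) ≫ f ⊵ᵣ 𝟙_ 𝒞 ≫ (ρᵣ Y).hom ≫ b = a ≫ f ≫ b := by simp
    rw [this]; exact hab
  · obtain ⟨p, q, hpq⟩ := exists_isIso_through_unit (k := k) hpr hTr hR h0 hZ a (f ⊵ᵣ K ≫ b) hab
    refine h Z hZ (a ≫ X ⊴ᵣ p ≫ (ρᵣ X).hom) ((ρᵣ Y).inv ≫ Y ⊴ᵣ q ≫ b) ?_
    have : (a ≫ X ⊴ᵣ p ≫ (ρᵣ X).hom) ≫ f ≫ (ρᵣ Y).inv ≫ Y ⊴ᵣ q ≫ b =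
        a ≫ X ⊴ᵣ p ≫ X ⊴ᵣ q ≫ f ⊵ᵣ K ≫ b := by
      rw [action_exchange_assoc]
      simp
    rw [this]; exact hpq

include hpr hTr hR h0 k in
lemma mem_avoidingIdeal_of_isNilpotent {X : D} (hX : TrivIdem X) (hX0 : ¬ IsZero X) {n : X ⟶ X}
    (hn : IsNilpotent (show End X from n)) : n ∈ (avoidingIdeal 𝒞 R).hom X X := by
  rw [mem_avoidingIdeal_iff_of_not_actsNonzero (k := k) hpr hTr hR h0]
  exact fun Z hZ a b => not_isIso_of_isNilpotent (hR.not_isZero Z hZ) a n b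
    (hX.isNilpotent_comp k hX0 hn)

include hpr hTr hR h0 k in
-- The point is that the right-hand side does not mention X, R or D: orbit functors into different
-- quotients have the same kernel.
lemma toQuot_action_eq_zero_iff [hfin𝒞 : FiniteDimensional k (𝟙_ 𝒞 ⟶ 𝟙_ 𝒞)]
    (hunit : TrivIdem (𝟙_ 𝒞)) {X : D} (hX : R X) {G H : 𝒞}
    (α : G ⟶ H) : (toQuot 𝒞 R).map (X ⊴ᵣ α) = 0 ↔
      ∀ (a : 𝟙_ 𝒞 ⟶ G) (b : H ⟶ 𝟙_ 𝒞), ¬ IsIso (a ≫ α ≫ b) := by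
  rw [quotient_map_eq_zero_iff]
  let I := avoidingIdeal 𝒞 R
  refine ⟨fun h a b hab => ?_, fun h => ?_⟩
  · refine id_notMem_avoidingIdeal k hR.trivIdem hR.not_isZero hX (𝒞 := 𝒞) ?_
    have h1 : 𝟙 X = ((ρᵣ X).inv ≫ X ⊴ᵣ a) ≫ X ⊴ᵣ α ≫ (X ⊴ᵣ (b ≫ inv (a ≫ α ≫ b)) ≫ (ρᵣ X).hom) := by
      have := IsIso.hom_inv_id (a ≫ α ≫ b)
      simp only [Category.assoc] at this ⊢
      rw [← actionHomRight_comp_assoc, ← actionHomRight_comp_assoc, Category.assoc, this]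
      simp
    rw [h1]
    exact I.comp_left _ (I.comp_right _ h)
  · rw [mem_avoidingIdeal_iff_of_not_actsNonzero (k := k) hpr hTr hR h0]
    intro Z hZ s t hst
    obtain ⟨p, q, h1⟩ := exists_isIso_through_unit (k := k) hpr hTr hR h0 hZ s (X ⊴ᵣ α ≫ t) hst
    obtain ⟨p', q', h2⟩ := exists_isIso_through_unit (k := k) hpr hTr hR h0 hZ
      (s ≫ X ⊴ᵣ p ≫ X ⊴ᵣ q ≫ X ⊴ᵣ α) t (by simpa using h1)
    -- Routing through 𝟙 on both sides reduces α to an endomorphism of 𝟙. It is not invertible,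
    -- hence nilpotent, and it acts nilpotently on X.
    have h3 : IsNilpotent (show End (𝟙_ 𝒞) from q ≫ α ≫ p') :=
      (isIso_or_isNilpotent k hunit _).resolve_left (h q p')
    have h4 : IsNilpotent (show End (X ⊙ᵣ 𝟙_ 𝒞) from X ⊴ᵣ (q ≫ α ≫ p')) := by
      obtain ⟨n, hn⟩ := h3
      let φ : End (𝟙_ 𝒞) →* End (X ⊙ᵣ 𝟙_ 𝒞) := (orbit 𝒞 X).mapEnd (𝟙_ 𝒞)
      refine ⟨n, ?_⟩
      have := congrArg φ hn
      rw [map_pow] at this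
      exact this.trans (actionHomRight_zero X (𝟙_ 𝒞) (𝟙_ 𝒞))
    have h5 := mem_avoidingIdeal_of_isNilpotent (k := k) hpr hTr hR h0
      ((hR.trivIdem X hX).of_iso (ρᵣ[𝒞] X))
      (fun h => hR.not_isZero X hX (h.of_iso (ρᵣ[𝒞] X).symm)) h4
    refine (mem_avoidingIdeal_iff_of_not_actsNonzero (k := k) hpr hTr hR h0 _).1 h5 Z hZ
      (s ≫ X ⊴ᵣ p) (X ⊴ᵣ q' ≫ t) ?_
    simpa using h2

include hpr hTr hR h0 k in
lemma id_action_mem_avoidingIdeal (X : D) :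
    𝟙 (X ⊙ᵣ T) ∈ (avoidingIdeal 𝒞 R).hom (X ⊙ᵣ T) (X ⊙ᵣ T) := by
  rw [mem_avoidingIdeal_iff_of_not_actsNonzero (k := k) hpr hTr hR h0]
  intro Z hZ a b hab
  refine (not_retract_action (k := k) hTr hR h0 X Z hZ).false
    ⟨a, b ≫ inv (a ≫ 𝟙 _ ≫ b), ?_⟩
  have := IsIso.hom_inv_id (a ≫ 𝟙 _ ≫ b)
  simpa only [Category.assoc, Category.id_comp] using this

include hpr hTr hR h0 k in
-- After decomposing G and H into 𝟙 and T, the blocks involving T vanish in the quotient, and those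
-- between copies of X are scalars modulo nilpotents, which lie in the ideal.
lemma toQuot_orbit_full {X : D} (hX : R X) : (orbit 𝒞 X ⋙ toQuot 𝒞 R).Full := by
  let I := avoidingIdeal 𝒞 R
  refine ⟨fun {G H} φ => ?_⟩
  obtain ⟨φ, rfl⟩ := (toQuot 𝒞 R).map_surjective (X := X ⊙ᵣ G) (Y := X ⊙ᵣ H) φ
  obtain ⟨n, F, p, q, hF, hpq⟩ := hpr G
  obtain ⟨n', F', p', q', hF', hpq'⟩ := hpr H
  have key : ∀ i j, ∃ β : F i ⟶ F' j, X ⊴ᵣ q i ≫ φ ≫ X ⊴ᵣ p' j - X ⊴ᵣ β ∈ I.hom _ _ := by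
    intro i j
    generalize X ⊴ᵣ q i ≫ φ ≫ X ⊴ᵣ p' j = ψ
    rcases hF i with hi | hi
    · rcases hF' j with hj | hj
      · generalize F i = F at *
        generalize F' j = F' at *
        subst hi
        subst hj
        have h1 := (hR.trivIdem X hX).of_iso (ρᵣ[𝒞] X)
        obtain ⟨r, hr⟩ := exists_scalar k h1 ψ
        refine ⟨r • 𝟙 _, ?_⟩
        rw [LinearAction.smul_right, actionHomRight_id]
        exact mem_avoidingIdeal_of_isNilpotent (k := k) hpr hTr hR h0 h1
          (fun h => hR.not_isZero X hX (h.of_iso (ρᵣ[𝒞] X).symm)) hr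
      · refine ⟨0, ?_⟩
        have h1 := id_action_mem_avoidingIdeal (k := k) hpr hTr hR h0 X
        rw [← hj] at h1
        rw [actionHomRight_zero, sub_zero, ← Category.comp_id ψ]
        exact I.comp_left _ h1
    · refine ⟨0, ?_⟩
      have h1 := id_action_mem_avoidingIdeal (k := k) hpr hTr hR h0 X
      rw [← hi] at h1
      rw [actionHomRight_zero, sub_zero, ← Category.id_comp ψ]
      exact I.comp_right _ h1
  choose β hβ using key
  refine ⟨∑ i, ∑ j, p i ≫ β i j ≫ q' j, ?_⟩
  change (toQuot 𝒞 R).map (X ⊴ᵣ (∑ i, ∑ j, p i ≫ β i j ≫ q' j)) = _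
  refine (sub_eq_zero.1 ?_).symm
  rw [← CategoryTheory.Functor.map_sub, quotient_map_eq_zero_iff]
  have h1 : φ = ∑ i, ∑ j, X ⊴ᵣ p i ≫ (X ⊴ᵣ q i ≫ φ ≫ X ⊴ᵣ p' j) ≫ X ⊴ᵣ q' j := by
    have h2 := congrArg (X ⊴ᵣ ·) hpq
    have h3 := congrArg (X ⊴ᵣ ·) hpq'
    simp only [actionHomRight_sum, actionHomRight_id, actionHomRight_comp] at h2 h3
    conv_lhs => rw [← Category.id_comp φ, ← Category.comp_id φ, ← h2, ← h3]
    simp only [Preadditive.sum_comp, Preadditive.comp_sum, Category.assoc]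
    exact Finset.sum_comm
  rw [h1]
  simp only [actionHomRight_sum, actionHomRight_comp]
  rw [← Finset.sum_sub_distrib]
  refine sum_mem fun i _ => ?_
  rw [← Finset.sum_sub_distrib]
  refine sum_mem fun j _ => ?_
  have h4 := I.comp_left (X ⊴ᵣ p i) (I.comp_right (X ⊴ᵣ q' j) (hβ i j))
  simpa only [Preadditive.sub_comp, Preadditive.comp_sub, Category.assoc] using h4

variable {D' : Type*} [Category* D'] [Preadditive D'] [Linear k D'] [MonoidalRightAction 𝒞 D']
  [AdditiveAction 𝒞 D'] [LinearAction k 𝒞 D']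
  [hfinD' : ∀ X Y : D', FiniteDimensional k (X ⟶ Y)]
  {R' : ObjectProperty D'} (hR' : IsTopClass 𝒞 R') (h0' : ¬ ActsNonzero T R')

include hpr hTr hR h0 hR' h0' in
theorem equivalent_of_not_actsNonzero [IsIdempotentComplete D] [IsIdempotentComplete D']
    [HasFiniteBiproducts 𝒞] [hfin𝒞 : FiniteDimensional k (𝟙_ 𝒞 ⟶ 𝟙_ 𝒞)]
    (hunit : TrivIdem (𝟙_ 𝒞)) [AdditiveAction 𝒞 𝒞] :
    Equivalent k 𝒞 (avoidingIdeal 𝒞 R).QuotCat (avoidingIdeal 𝒞 R').QuotCat := by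
  obtain ⟨X, hX⟩ := hR.nonempty
  obtain ⟨X', hX'⟩ := hR'.nonempty
  have := isIdempotentComplete_quotient (avoidingIdeal 𝒞 R) k
  have := isIdempotentComplete_quotient (avoidingIdeal 𝒞 R') k
  have := toQuot_orbit_full (k := k) hpr hTr hR h0 hX
  have := toQuot_orbit_full (k := k) hpr hTr hR' h0' hX'
  refine equivalent_of_sameKernel (Ψ := orbit 𝒞 X ⋙ toQuot 𝒞 R)
    (Ψ' := orbit 𝒞 X' ⋙ toQuot 𝒞 R') k 𝒞 (fun G H f g => ?_) ?_ ?_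
  · rw [← sub_eq_zero, ← CategoryTheory.Functor.map_sub, ← sub_eq_zero (a := CategoryTheory.Functor.map _ f), ← CategoryTheory.Functor.map_sub]
    exact (toQuot_action_eq_zero_iff (k := k) hpr hTr hR h0 hunit hX _).trans
      (toQuot_action_eq_zero_iff (k := k) hpr hTr hR' h0' hunit hX' _).symm
  · exact exists_retract_quotient k hR.trivIdem hR.not_isZero hR.gen X (fun Y => hR.trans X Y hX)
  · exact exists_retract_quotient k hR'.trivIdem hR'.not_isZero hR'.gen X' (fun Y => hR'.trans X' Y hX')

end TypeZero

/-! ### Vanishing of T is invariant under equivalence. -/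

section Distinguish

variable (k : Type*) [Field k] {𝒞 : Type*} [Category* 𝒞] [MonoidalCategory 𝒞]
  [Preadditive 𝒞] [Linear k 𝒞]
  {D : Type*} [Category* D] [Preadditive D] [Linear k D] [MonoidalRightAction 𝒞 D]
  {D' : Type*} [Category* D'] [Preadditive D'] [Linear k D'] [MonoidalRightAction 𝒞 D']

lemma Equivalent.isZero_iff (h : Equivalent k 𝒞 D D') (T : 𝒞) :
    (∀ X : D, IsZero (X ⊙ᵣ T)) ↔ ∀ X : D', IsZero (X ⊙ᵣ T) := by
  obtain ⟨Φ, hΦ, hadd, -, ⟨hlin⟩⟩ := h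
  have h1 : ∀ X : D, IsZero (X ⊙ᵣ T) ↔ IsZero (Φ.obj X ⊙ᵣ T) := fun X => by
    rw [(Functor.RightLinear.μᵣIso Φ X T).isZero_iff]
    refine ⟨fun h => Φ.map_isZero h, fun h => ?_⟩
    rw [IsZero.iff_id_eq_zero] at h ⊢
    exact Φ.map_injective (by simpa using h)
  refine ⟨fun h Y => ?_, fun h X => (h1 X).2 (h _)⟩
  have e : Φ.obj (Φ.objPreimage Y) ≅ Y := Φ.objObjPreimageIso Y
  exact ((h1 _).1 (h _)).of_iso ((actBy (D := D') T).mapIso e.symm)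

end Distinguish

section QuotientAction

variable (k : Type*) [Field k] [IsAlgClosed k] {𝒞 : Type*} [Category* 𝒞] [MonoidalCategory 𝒞]
  [Preadditive 𝒞] [Linear k 𝒞] {T : 𝒞}
  {D : Type*} [Category* D] [Preadditive D] [Linear k D] [MonoidalRightAction 𝒞 D]
  [AdditiveAction 𝒞 D] [LinearAction k 𝒞 D]
variable {R : ObjectProperty D} [hfinD : ∀ X Y : D, FiniteDimensional k (X ⟶ Y)]

include k in
-- It expresses `ActsNonzero` as a property of the quotient 2-representation, so that equivalences
-- preserve it.
lemma isZero_quotient_action_iff (hpr : ∀ G : 𝒞, addClosure (fun F => F = 𝟙_ 𝒞 ∨ F = T) G)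
    (hTr : ∀ G : 𝒞, addClosure (fun F => F = T) (G ⊗ T)) (hR : IsTopClass 𝒞 R) :
    (∀ X : (avoidingIdeal 𝒞 R).QuotCat, IsZero (X ⊙ᵣ T)) ↔ ¬ ActsNonzero T R := by
  have key : ∀ X : D, IsZero ((toQuot 𝒞 R).obj X) ↔ 𝟙 X ∈ (avoidingIdeal 𝒞 R).hom X X := fun X => by
    rw [IsZero.iff_id_eq_zero, ← CategoryTheory.Functor.map_id, quotient_map_eq_zero_iff]
  refine ⟨fun h ⟨Y, Z, hY, hZ, ⟨r⟩⟩ => ?_, fun h0 X =>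
    (key _).2 (id_action_mem_avoidingIdeal (k := k) hpr hTr hR h0 X.as)⟩
  have h1 := (key _).1 (h ((toQuot 𝒞 R).obj Y))
  exact (id_mem_avoidingIdeal_iff k hR.trivIdem hR.not_isZero _).1 h1 Z hZ
    ⟨𝟙_ 𝒞, ⟨r.trans (Retract.ofIso (ρᵣ (Y ⊙ᵣ T)).symm)⟩⟩

end QuotientAction

/-! ### Full subcategories closed under retracts. -/

section FullSubcategory

variable {M : Type*} [Category* M] [Preadditive M] (P : ObjectProperty M)

instance (k : Type*) [Field k] [Linear k M] [h : ∀ X Y : M, FiniteDimensional k (X ⟶ Y)]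
    (X Y : P.FullSubcategory) : FiniteDimensional k (X ⟶ Y) :=
  Module.Finite.of_injective (P.ι.mapLinearMap k : (X ⟶ Y) →ₗ[k] (X.obj ⟶ Y.obj))
    P.ι.map_injective

/-- Retracts in a full subcategory. -/
def retractMk {X Y : P.FullSubcategory} (h : Retract X.obj Y.obj) : Retract X Y :=
  ⟨ObjectProperty.homMk h.i, ObjectProperty.homMk h.r, by ext; exact h.retract⟩

variable {P} in
lemma trivIdem_fullSubcategory {X : P.FullSubcategory} (h : TrivIdem X.obj) : TrivIdem X := by
  intro e he
  rcases h e.hom (congrArg (·.hom) he) with h | h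
  · exact Or.inl (by ext; exact h)
  · exact Or.inr (by ext; exact h)

lemma isIdempotentComplete_fullSubcategory [IsIdempotentComplete M]
    (hP : ∀ X Y, Retract X Y → P Y → P X) : IsIdempotentComplete P.FullSubcategory := by
  refine ⟨fun X e he => ?_⟩
  obtain ⟨Y, i, r, hir, hri⟩ := IsIdempotentComplete.idempotents_split X.obj e.hom
    (congrArg (·.hom) he)
  exact ⟨⟨Y, hP Y X.obj ⟨i, r, hir⟩ X.property⟩, ObjectProperty.homMk i, ObjectProperty.homMk r,
    by ext; exact hir, by ext; exact hri⟩

lemma isZero_of_fullSubcategory {X : P.FullSubcategory} (h : IsZero X) : IsZero X.obj :=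
  P.ι.map_isZero h

end FullSubcategory

/-! ### Subquotients and cells as top classes. -/

section Subquotient

variable {𝒞 : Type*} [Category* 𝒞] [MonoidalCategory 𝒞] [Preadditive 𝒞]
  {M : Type*} [Category* M] [Preadditive M] [MonoidalRightAction 𝒞 M] [AdditiveAction 𝒞 M]

lemma generated_of_mem {S : ObjectProperty M} {X : M} (h : S X) : generated 𝒞 S X :=
  addClosure_of_mem ⟨X, 𝟙_ 𝒞, h, ⟨(ρᵣ X).symm⟩⟩

instance (Q : Set (Ind 𝒞 M)) [IsIdempotentComplete M] :
    IsIdempotentComplete (generated 𝒞 (ofSet 𝒞 Q)).FullSubcategory :=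
  isIdempotentComplete_fullSubcategory _ fun _ _ h => addClosure_retract h

/-- `R` is a nonempty equivalence class for the action preorder, contained in `Q`, and no other
element of `Q` acts onto an element of `R`. -/
structure IsTopSet (Q R : Set (Ind 𝒞 M)) : Prop where
  nonempty : R.Nonempty
  subset : R ⊆ Q
  trans : ∀ Y ∈ R, ∀ Z ∈ R, Y ≤ Z
  mem : ∀ Y ∈ Q, ∀ Z ∈ R, Y ≤ Z → Y ∈ R

variable {Q R : Set (Ind 𝒞 M)}

lemma actsOnto_fullSubcategory {P : ObjectProperty M} [ActionStable 𝒞 P] {X Y : P.FullSubcategory} :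
    ActsOnto 𝒞 X Y ↔ ActsOnto 𝒞 X.obj Y.obj := by
  constructor
  · rintro ⟨F, ⟨h⟩⟩
    exact ⟨F, ⟨h.map P.ι⟩⟩
  · rintro ⟨F, ⟨h⟩⟩
    exact ⟨F, ⟨retractMk P (X := Y) (Y := X ⊙ᵣ F) h⟩⟩

/-- The dichotomy demanded of generators is the condition `mem`: an element of Q outside R does not
act onto R. -/
lemma IsTopSet.isTopClass [IsIdempotentComplete M] (h : IsTopSet Q R) :
    IsTopClass 𝒞 (D := (generated 𝒞 (ofSet 𝒞 Q)).FullSubcategory) (fun X => ofSet 𝒞 R X.obj) where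
  nonempty := by
    obtain ⟨Z, hZ⟩ := h.nonempty
    exact ⟨⟨Z.1, generated_of_mem ⟨Z, h.subset hZ, rfl⟩⟩, Z, hZ, rfl⟩
  trivIdem := by
    rintro ⟨Z, _⟩ ⟨Z', hZ', rfl⟩
    exact trivIdem_fullSubcategory Z'.2.trivIdem
  not_isZero := by
    rintro ⟨Z, _⟩ ⟨Z', hZ', rfl⟩ h0
    exact Z'.2.1 (isZero_of_fullSubcategory _ h0)
  gen := by
    rintro ⟨X, hX⟩
    obtain ⟨n, Y, p, q, hY, hpq⟩ := hX
    refine ⟨n, fun i => ⟨Y i, addClosure_of_mem (hY i)⟩, fun i => ObjectProperty.homMk (p i),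
      fun i => ObjectProperty.homMk (q i), fun i => ?_, ?_⟩
    · obtain ⟨_, G, ⟨Z, hZ, rfl⟩, ⟨e⟩⟩ := hY i
      refine ⟨⟨Z.1, generated_of_mem ⟨Z, hZ, rfl⟩⟩, G, ?_, ⟨ObjectProperty.isoMk _ e⟩⟩
      by_cases hZR : Z ∈ R
      · exact Or.inl ⟨Z, hZR, rfl⟩
      · refine Or.inr ?_
        rintro W ⟨W', hW', hW⟩ hZW
        rw [actsOnto_fullSubcategory, ← hW] at hZW
        exact hZR (h.mem Z hZ W' hW' hZW)
    · apply (ObjectProperty.ι _).map_injective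
      rw [Functor.map_sum]
      exact hpq
  trans := by
    rintro Y Z ⟨Y', hY', hY⟩ ⟨Z', hZ', hZ⟩
    rw [actsOnto_fullSubcategory, ← hY, ← hZ]
    exact h.trans Y' hY' Z' hZ'

/-- `T` does not act by zero on the class `R`. -/
def SetActsNonzero (T : 𝒞) (R : Set (Ind 𝒞 M)) : Prop :=
  ∃ Y ∈ R, ∃ Z ∈ R, Nonempty (Retract Z.1 (Y.1 ⊙ᵣ T))

lemma IsTopSet.actsNonzero_iff (h : IsTopSet Q R) (T : 𝒞) :
    ActsNonzero (D := (generated 𝒞 (ofSet 𝒞 Q)).FullSubcategory) T (fun X => ofSet 𝒞 R X.obj) ↔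
      SetActsNonzero T R := by
  constructor
  · rintro ⟨Y, Z, ⟨Y', hY', hY⟩, ⟨Z', hZ', hZ⟩, ⟨r⟩⟩
    have r' : Retract Z.obj (Y.obj ⊙ᵣ T) := r.map (ObjectProperty.ι _)
    rw [← hY, ← hZ] at r'
    exact ⟨Y', hY', Z', hZ', ⟨r'⟩⟩
  · rintro ⟨Y, hY, Z, hZ, ⟨r⟩⟩
    let Y' : (generated 𝒞 (ofSet 𝒞 Q)).FullSubcategory :=
      ⟨Y.1, generated_of_mem ⟨Y, h.subset hY, rfl⟩⟩
    let Z' : (generated 𝒞 (ofSet 𝒞 Q)).FullSubcategory :=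
      ⟨Z.1, generated_of_mem ⟨Z, h.subset hZ, rfl⟩⟩
    exact ⟨Y', Z', ⟨Y, hY, rfl⟩, ⟨Z, hZ, rfl⟩, ⟨retractMk _ (X := Z') (Y := Y' ⊙ᵣ T) r⟩⟩

lemma isTopSet_simpleSubquotient {Q : Set (Vertex 𝒞 M)} {ρ : Vertex 𝒞 M}
    (hρ : Minimal (· ∈ Q) ρ) : IsTopSet (indOf 𝒞 Q) (indOf 𝒞 {ρ}) where
  nonempty := by
    induction ρ using Antisymmetrization.ind with
    | _ X => exact ⟨X, _, rfl, rfl⟩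
  subset := by
    rintro X ⟨_, rfl, hX⟩
    exact ⟨_, hρ.1, hX⟩
  trans := by
    rintro X ⟨_, rfl, hX⟩ Y ⟨_, rfl, hY⟩
    have h : toAntisymmetrization (· ≤ ·) X ≤ toAntisymmetrization (· ≤ ·) Y := (hX.trans hY.symm).le
    exact toAntisymmetrization_le_toAntisymmetrization_iff.1 h
  mem := by
    rintro X ⟨σ, hσ, rfl⟩ Y ⟨_, rfl, rfl⟩ h
    have h' : toAntisymmetrization (· ≤ ·) X ≤ toAntisymmetrization (· ≤ ·) Y :=
      toAntisymmetrization_le_toAntisymmetrization_iff.2 h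
    exact ⟨_, rfl, le_antisymm h' (hρ.2 hσ h')⟩

lemma isTopSet_leftCell [AdditiveAction 𝒞 𝒞] {G : 𝒞} (h : (leftCell G).Nonempty) :
    IsTopSet (leftCell G) (leftCell G) where
  nonempty := h
  subset := subset_rfl
  trans _ hY _ hZ := hY.1.trans _ hZ.2
  mem _ hY _ _ _ := hY

end Subquotient

/-! ### The criterion for equivalence with a cell 2-representation. -/

section Equivalence

variable {k : Type*} [Field k] [IsAlgClosed k] {A : Type u} [Ring A] [Algebra k A]
  [FiniteDimensional k A]
  {C : Type*} [Category* C] [Preadditive C] [Linear k C] {E : C ≌ FGModuleCat.{u} A}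
  [E.functor.Additive] [E.functor.Linear k]
  {a : C} {T : ProjCat k E} (c : Copower k a T.obj)
  [hfin : ∀ X Y : C, FiniteDimensional k (X ⟶ Y)]
  [hfin𝒞 : ∀ X Y : ProjCat k E, FiniteDimensional k (X ⟶ Y)]
  [IsIdempotentComplete (ProjCat k E)] [HasFiniteBiproducts (ProjCat k E)]
  {M : Type*} [Category* M] [Preadditive M] [Linear k M] [MonoidalRightAction (ProjCat k E) M]
  [AdditiveAction (ProjCat k E) M] [LinearAction k (ProjCat k E) M]
  [hfinM : ∀ X Y : M, FiniteDimensional k (X ⟶ Y)] [IsIdempotentComplete M]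

include c in
/-- A simple transitive subquotient is equivalent to a cell `2`-representation if and only if `T`
acts in the same way, by zero or not. -/
theorem subquotient_equivalent_iff
    (hproj : ∀ G : ProjCat k E, addClosure (fun N => N = a) (G.obj.obj a))
    (hpr : ∀ G : ProjCat k E, addClosure (fun F => F = 𝟙_ (ProjCat k E) ∨ F = T) G)
    (hTr : ∀ G : ProjCat k E, addClosure (fun F => F = T) (G ⊗ T))
    (hunit : TrivIdem (𝟙_ (ProjCat k E)))
    {Q R : Set (Ind (ProjCat k E) M)} (h : IsTopSet Q R)
    {L : Set (Ind (ProjCat k E) (ProjCat k E))} (hL : IsTopSet L L) :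
    Equivalent k (ProjCat k E) (Subquotient (ProjCat k E) Q R) (CellRep L) ↔
      (SetActsNonzero T R ↔ SetActsNonzero T L) := by
  rw [← h.actsNonzero_iff, ← hL.actsNonzero_iff]
  constructor
  · intro heq
    have h1 := heq.isZero_iff k T
    rw [isZero_quotient_action_iff k hpr hTr h.isTopClass,
      isZero_quotient_action_iff k hpr hTr hL.isTopClass] at h1
    exact not_iff_not.1 h1
  · intro hiff
    by_cases h1 : ActsNonzero
      (D := (generated (ProjCat k E) (ofSet (ProjCat k E) Q)).FullSubcategory) T
      (fun X => ofSet (ProjCat k E) R X.obj)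
    · exact equivalent_of_actsNonzero c hproj h.isTopClass h1 hL.isTopClass (hiff.1 h1)
    · exact equivalent_of_not_actsNonzero hpr hTr h.isTopClass h1 hL.isTopClass
        (fun h2 => h1 (hiff.2 h2)) hunit

end Equivalence

/-! ### Finite-dimensional modules and the functor A ⊗ -. -/

section ModuleCategory

open scoped ModuleCat.Algebra

variable (k : Type*) [Field k] (A : Type u) [Ring A] [Algebra k A] [FiniteDimensional k A]

attribute [local instance] ModuleCat.moduleOfAlgebraModule
  ModuleCat.isScalarTower_of_algebra_moduleCat

lemma fgModuleCat_finiteDimensional_hom (V W : FGModuleCat.{u} A) : FiniteDimensional k (V ⟶ W) := by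
  let φ : (V ⟶ W) →ₗ[k] (V.obj →ₗ[k] W.obj) :=
    { toFun := fun f => f.hom.hom.restrictScalars k
      map_add' := fun f g => rfl
      map_smul' := fun r f => rfl }
  refine Module.Finite.of_injective φ fun f g h => ?_
  apply FGModuleCat.hom_ext
  ext v
  exact congrArg (fun x : V.obj →ₗ[k] W.obj => x v) h

instance fgModuleCat_isIdempotentComplete : IsIdempotentComplete (FGModuleCat.{u} A) := by
  refine ⟨fun V p hp => ?_⟩
  refine ⟨FGModuleCat.of A (LinearMap.range p.hom.hom),
    FGModuleCat.ofHom (LinearMap.range p.hom.hom).subtype,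
    FGModuleCat.ofHom p.hom.hom.rangeRestrict, ?_, ?_⟩
  · apply FGModuleCat.hom_ext
    refine LinearMap.ext fun v => ?_
    obtain ⟨_, w, rfl⟩ := v
    apply Subtype.ext
    exact congrArg (fun x : V ⟶ V => x.hom.hom w) hp
  · rfl

instance fgModuleCat_hasFiniteBiproducts : HasFiniteBiproducts (FGModuleCat.{u} A) := by
  refine ⟨fun n => ⟨fun f => ?_⟩⟩
  classical
  let b : Bicone f :=
    { pt := FGModuleCat.of A (∀ i, (f i).obj)
      π := fun i => FGModuleCat.ofHom (LinearMap.proj i)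
      ι := fun i => FGModuleCat.ofHom (LinearMap.single A (fun i => (f i).obj) i)
      ι_π := fun i j => by
        split_ifs with h
        · subst h
          apply FGModuleCat.hom_ext
          refine LinearMap.ext fun v => ?_
          exact Pi.single_eq_same (M := fun i => (f i).obj) i v
        · apply FGModuleCat.hom_ext
          refine LinearMap.ext fun v => ?_
          exact Pi.single_eq_of_ne (M := fun i => (f i).obj) (Ne.symm h) v }
  refine hasBiproduct_of_total b ?_
  apply FGModuleCat.hom_ext
  refine LinearMap.ext fun v => ?_
  let φ : (b.pt ⟶ b.pt) →+ b.pt.obj := AddMonoidHom.mk' (fun g => g.hom.hom v) fun g h => rfl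
  change φ (∑ j, b.π j ≫ b.ι j) = v
  rw [map_sum]
  exact Finset.univ_sum_single (M := fun i => (f i).obj) v

/-- The regular module. -/
abbrev regular : FGModuleCat.{u} A := FGModuleCat.of A A

variable {A} in
/-- The morphism from the regular module with prescribed value at `1`. -/
def fromRegular {V : FGModuleCat.{u} A} (v : V.obj) : regular A ⟶ V :=
  FGModuleCat.ofHom (LinearMap.toSpanSingleton A V.obj v)

variable {A} in
lemma regular_hom_ext {V : FGModuleCat.{u} A} {f g : regular A ⟶ V}
    (h : f.hom.hom (1 : A) = g.hom.hom (1 : A)) : f = g := by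
  apply FGModuleCat.hom_ext
  exact LinearMap.ext_ring h

variable {A} in
lemma fromRegular_eq {V : FGModuleCat.{u} A} (f : regular A ⟶ V) :
    fromRegular (f.hom.hom (1 : A)) = f :=
  regular_hom_ext (one_smul A _)

variable {A} in
lemma fromRegular_add {V : FGModuleCat.{u} A} (v w : V.obj) :
    fromRegular (v + w) = fromRegular v + fromRegular w :=
  regular_hom_ext (smul_add (1 : A) v w)

variable {A} in
lemma fromRegular_smul {V : FGModuleCat.{u} A} (r : k) (v : V.obj) :
    fromRegular (r • v) = r • fromRegular v :=
  regular_hom_ext (smul_comm (1 : A) r v)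

variable {A} in
/-- The element `v` of the corner `1 V`. -/
def cornerOne (V : FGModuleCat.{u} A) : V.obj →ₗ[k] ↥(corner k (1 : A) V.obj) where
  toFun v := ⟨v, v, one_smul A v⟩
  map_add' _ _ := rfl
  map_smul' _ _ := rfl

/-- The element `x` of the left ideal `A 1`. -/
def spanOne : A →ₗ[A] ↥(Ideal.span {(1 : A)}) where
  toFun x := ⟨x, Ideal.mem_span_singleton'.2 ⟨x, mul_one x⟩⟩
  map_add' _ _ := rfl
  map_smul' _ _ := rfl

variable {A} in
/-- The element `1 ⊗ v` of `A ⊗ V`. -/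
noncomputable def oneTmul (V : FGModuleCat.{u} A) :
    V.obj →ₗ[k] ((bimoduleFunctor k A 1 1).obj V).obj where
  toFun v := spanOne A 1 ⊗ₜ[k] cornerOne k V v
  map_add' v w := TensorProduct.tmul_add (spanOne A 1) (cornerOne k V v) (cornerOne k V w)
  map_smul' r v := (TensorProduct.tmul_smul (R := k) r (spanOne A 1) (cornerOne k V v)).trans
    (algebraMap_smul A r (spanOne A 1 ⊗ₜ[k] cornerOne k V v)).symm

variable {A} in
-- The elements 1 ⊗ v generate A ⊗ V as an A-module.
lemma oneTmul_hom_ext {V W : FGModuleCat.{u} A} {f g : (bimoduleFunctor k A 1 1).obj V ⟶ W}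
    (h : ∀ v, f.hom.hom (oneTmul k V v) = g.hom.hom (oneTmul k V v)) : f = g := by
  apply FGModuleCat.hom_ext
  apply TensorProduct.AlgebraTensorModule.ext
  intro x v
  have h1 : (x ⊗ₜ[k] v : ↥(Ideal.span {(1 : A)}) ⊗[k] ↥(corner k (1 : A) V.obj)) =
      x.1 • (spanOne A 1 ⊗ₜ[k] cornerOne k V v.1) := by
    rw [TensorProduct.smul_tmul', ← map_smul, smul_eq_mul, mul_one]
    rfl
  rw [h1]
  refine (f.hom.hom.map_smul x.1 _).trans (Eq.trans ?_ (g.hom.hom.map_smul x.1 _).symm)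
  exact congrArg (x.1 • ·) (h v.1)

variable {A} in
/-- The projection `x ⊗ v ↦ ξ(v) x`. -/
noncomputable def coordRegular {V : FGModuleCat.{u} A} (ξ : V.obj →ₗ[k] k) :
    (bimoduleFunctor k A 1 1).obj V ⟶ regular A :=
  FGModuleCat.ofHom (TensorProduct.AlgebraTensorModule.lift
    { toFun := fun y =>
        { toFun := fun v => ξ v.1 • y.1
          map_add' := fun v w => by rw [← add_smul, ← map_add]; rfl
          map_smul' := fun r v => by
            rw [RingHom.id_apply, smul_smul, ← smul_eq_mul, ← map_smul]; rfl }
      map_add' := fun y z => LinearMap.ext fun v => smul_add (ξ v.1) y.1 z.1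
      map_smul' := fun x y => LinearMap.ext fun v => smul_comm (ξ v.1) x y.1 })

variable {A} in
lemma coordRegular_oneTmul {V : FGModuleCat.{u} A} (ξ : V.obj →ₗ[k] k) (v : V.obj) :
    (coordRegular k ξ).hom.hom (oneTmul k V v) = ξ v • (1 : A) := rfl

/-- The functor `V ↦ A ⊗ V` is a copower functor for the regular module. -/
noncomputable def copowerRegular : Copower k (regular A) (bimoduleFunctor k A 1 1) where
  lam {V} :=
    { toFun := fun v => fromRegular (oneTmul k V (v.hom.hom (1 : A)))
      map_add' := fun v w => by
        rw [← fromRegular_add, ← map_add]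
        rfl
      map_smul' := fun r v => by
        rw [RingHom.id_apply, ← fromRegular_smul, ← map_smul]
        rfl }
  lam_map {V W} v g := regular_hom_ext ((((bimoduleFunctor k A 1 1).map g).hom.hom.map_smul
    (1 : A) (oneTmul k V (v.hom.hom (1 : A)))))
  coord {V} ξ := coordRegular k (ξ ∘ₗ
    { toFun := fun v => fromRegular v
      map_add' := fromRegular_add
      map_smul' := fromRegular_smul k })
  lam_coord {V} v ξ := regular_hom_ext (by
    refine ((coordRegular k _).hom.hom.map_smul (1 : A) (oneTmul k V (v.hom.hom (1 : A)))).trans ?_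
    rw [one_smul, coordRegular_oneTmul]
    change ξ (fromRegular (v.hom.hom (1 : A))) • (1 : A) = algebraMap k A (ξ v) • (1 : A)
    rw [fromRegular_eq, algebraMap_smul])
  ext {V W} f g h := oneTmul_hom_ext k fun v => by
    have h1 := congrArg (fun x => x.hom.hom (1 : A)) (h (fromRegular v))
    have h2 : (1 : A) • oneTmul k V ((1 : A) • v) = oneTmul k V v := by rw [one_smul, one_smul]
    have h3 : f.hom.hom ((1 : A) • oneTmul k V ((1 : A) • v)) =
        g.hom.hom ((1 : A) • oneTmul k V ((1 : A) • v)) := h1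
    rwa [h2] at h3

variable {A} in
/-- The inclusion of `A e ⊗ f V` in `A ⊗ V`. -/
noncomputable def bimoduleIncl (e f : A) : bimoduleFunctor k A e f ⟶ bimoduleFunctor k A 1 1 where
  app V := FGModuleCat.ofHom (TensorProduct.AlgebraTensorModule.map
    ((spanOne A).comp (Ideal.span {e}).subtype)
    (cornerOne k V ∘ₗ (corner k f V.obj).subtype))
  naturality V W g := by
    apply FGModuleCat.hom_ext
    apply TensorProduct.AlgebraTensorModule.ext
    intro x v
    rfl

variable {A} in
/-- The projection `x ⊗ v ↦ x e ⊗ f v` from `A ⊗ V` to `A e ⊗ f V`. -/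
noncomputable def bimoduleProj (e f : A) : bimoduleFunctor k A 1 1 ⟶ bimoduleFunctor k A e f where
  app V := FGModuleCat.ofHom (TensorProduct.AlgebraTensorModule.map
    ((LinearMap.toSpanSingleton A ↥(Ideal.span {e}) ⟨e, Ideal.mem_span_singleton_self e⟩).comp
      (Ideal.span {(1 : A)}).subtype)
    ((Algebra.lsmul k k V.obj f).rangeRestrict ∘ₗ (corner k (1 : A) V.obj).subtype))
  naturality V W g := by
    apply FGModuleCat.hom_ext
    apply TensorProduct.AlgebraTensorModule.ext
    intro x v
    refine congrArg (fun y => (x.1 • (⟨e, Ideal.mem_span_singleton_self e⟩ : ↥(Ideal.span {e}))) ⊗ₜ[k] y) ?_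
    apply Subtype.ext
    exact (g.hom.hom.map_smul f v.1).symm

variable {A} in
lemma bimoduleIncl_proj {e f : A} (he : IsIdempotentElem e) (hf : IsIdempotentElem f) :
    bimoduleIncl k e f ≫ bimoduleProj k e f = 𝟙 _ := by
  apply NatTrans.ext
  funext V
  apply FGModuleCat.hom_ext
  apply TensorProduct.AlgebraTensorModule.ext
  rintro ⟨x, hx⟩ ⟨_, v, rfl⟩
  obtain ⟨y, rfl⟩ := Ideal.mem_span_singleton'.1 hx
  refine congrArg₂ (fun (x : ↥(Ideal.span {e})) (v : ↥(corner k f V.obj)) => x ⊗ₜ[k] v) ?_ ?_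
  · apply Subtype.ext
    change (y * e) * e = y * e
    rw [mul_assoc, he.eq]
  · apply Subtype.ext
    change f • f • v = f • v
    rw [smul_smul, hf.eq]

end ModuleCategory

/-! ### Transport along the equivalence with modules. -/

section Transport

variable {k : Type*} [Field k] {C : Type*} [Category* C] [Preadditive C] [Linear k C]
  {C' : Type*} [Category* C'] [Preadditive C'] [Linear k C'] (E : C ≌ C')
  [E.functor.Additive] [E.functor.Linear k]

variable (k) in
/-- The adjunction between the two functors of a linear equivalence. -/
def homEquivInverse (b : C') (N : C) : (E.inverse.obj b ⟶ N) ≃ₗ[k] (b ⟶ E.functor.obj N) :=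
  { E.symm.toAdjunction.homEquiv b N with
    map_add' := fun v w => by simp [Adjunction.homEquiv]
    map_smul' := fun r v => by simp [Adjunction.homEquiv] }

lemma homEquivInverse_apply {b : C'} {N : C} (v : E.inverse.obj b ⟶ N) :
    homEquivInverse k E b N v = E.counitInv.app b ≫ E.functor.map v := rfl

lemma homEquivInverse_comp {b : C'} {N N' : C} (v : E.inverse.obj b ⟶ N) (g : N ⟶ N') :
    homEquivInverse k E b N' (v ≫ g) = homEquivInverse k E b N v ≫ E.functor.map g := by
  simp [homEquivInverse_apply]

lemma comp_homEquivInverse {b b' : C'} {N : C} (w : b' ⟶ b) (v : E.inverse.obj b ⟶ N) :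
    homEquivInverse k E b' N (E.inverse.map w ≫ v) = w ≫ homEquivInverse k E b N v := by
  simp [homEquivInverse_apply]

/-- Transport of copowers along equivalences. -/
def Copower.transport {b : C'} {B : C' ⥤ C'} (c : Copower k b B) :
    Copower k (E.inverse.obj b) (E.functor ⋙ B ⋙ E.inverse) where
  lam {N} := E.inverse.mapLinearMap k ∘ₗ c.lam ∘ₗ (homEquivInverse k E b N).toLinearMap
  lam_map v g := by
    change E.inverse.map (c.lam _) ≫ E.inverse.map (B.map _) = E.inverse.map (c.lam _)
    rw [← E.inverse.map_comp, c.lam_map]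
    congr 2
    exact (homEquivInverse_comp E v g).symm
  coord {N} ξ := E.inverse.map (c.coord (ξ ∘ₗ (homEquivInverse k E b N).symm.toLinearMap))
  lam_coord {N} v ξ := by
    change E.inverse.map (c.lam _) ≫ E.inverse.map (c.coord _) = _
    rw [← E.inverse.map_comp, c.lam_coord]
    simp
  ext {N Y} f g h := by
    apply (homEquivInverse k E (B.obj (E.functor.obj N)) Y).injective
    refine c.ext _ _ fun v => ?_
    rw [← comp_homEquivInverse, ← comp_homEquivInverse]
    have := h ((homEquivInverse k E b N).symm v)
    refine congrArg _ ?_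
    simpa using this

end Transport

/-! ### T and the regular module inside C. -/

section Concrete

variable (k : Type*) [Field k] {A : Type u} [Ring A] [Algebra k A] [FiniteDimensional k A]
  {C : Type*} [Category* C] [Preadditive C] [Linear k C] (E : C ≌ FGModuleCat.{u} A)
  [E.functor.Additive] [E.functor.Linear k]

/-- The projective functor `A ⊗ -`. -/
abbrev tensorA : ProjCat k E := projMor k E 1 1 IsIdempotentElem.one IsIdempotentElem.one

/-- The object corresponding to the regular module. -/
abbrev regularObj : C := E.inverse.obj (regular A)

noncomputable def copowerA : Copower k (regularObj E) (tensorA k E).obj :=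
  (copowerRegular k A).transport E

include k E in
lemma finiteDimensional_hom (X Y : C) : FiniteDimensional k (X ⟶ Y) := by
  have := fgModuleCat_finiteDimensional_hom k A (E.functor.obj X) (E.functor.obj Y)
  exact Module.Finite.of_injective (E.functor.mapLinearMap k : (X ⟶ Y) →ₗ[k] _)
    E.functor.map_injective

omit [Preadditive C] [Linear k C] [E.functor.Additive] [E.functor.Linear k] in
include E k in
lemma isIdempotentComplete_of_equivalence : IsIdempotentComplete C :=
  (Idempotents.isIdempotentComplete_iff_of_equivalence E).2 inferInstance

omit [Linear k C] [E.functor.Linear k] in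
include E k in
lemma hasFiniteBiproducts_of_equivalence : HasFiniteBiproducts C := by
  have : HasFiniteProducts C := by
    have := E.symm
    refine ⟨fun n => Adjunction.hasLimitsOfShape_of_equivalence E.functor⟩
  exact HasFiniteBiproducts.of_hasFiniteProducts

include k in
/-- The regular module separates morphisms. -/
lemma regularObj_ext {N Y : C} {f g : N ⟶ Y} (h : ∀ v : regularObj E ⟶ N, v ≫ f = v ≫ g) : f = g := by
  apply E.functor.map_injective
  apply FGModuleCat.hom_ext
  refine LinearMap.ext fun v => ?_
  have h1 := congrArg (homEquivInverse k E _ _)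
    (h ((homEquivInverse k E _ _).symm (fromRegular v)))
  rw [homEquivInverse_comp, homEquivInverse_comp, LinearEquiv.apply_symm_apply] at h1
  have h2 := congrArg (fun x => x.hom.hom (1 : A)) h1
  have h3 : (E.functor.map f).hom.hom ((1 : A) • v) = (E.functor.map g).hom.hom ((1 : A) • v) := h2
  rwa [one_smul] at h3

end Concrete

/-! ### Finiteness properties of the 2-category. -/

section ProjCatInstances

variable {k : Type*} [Field k] {A : Type u} [Ring A] [Algebra k A] [FiniteDimensional k A]
  {C : Type*} [Category* C] [Preadditive C] [Linear k C] (E : C ≌ FGModuleCat.{u} A)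
  [E.functor.Additive] [E.functor.Linear k]

instance : IsIdempotentComplete (ProjCat k E) := by
  have := isIdempotentComplete_of_equivalence k E
  have := Idempotents.functor_category_isIdempotentComplete C C
  exact isIdempotentComplete_fullSubcategory _ fun _ _ h => addClosure_retract h

instance : HasFiniteBiproducts (ProjCat k E) := by
  have := hasFiniteBiproducts_of_equivalence k E
  have : HasFiniteBiproducts (C ⥤ C) := HasFiniteBiproducts.of_hasFiniteProducts
  refine ⟨fun n => ⟨fun G => ?_⟩⟩
  let b := biproduct.bicone fun i => (G i).obj
  have hb : ∑ i, b.π i ≫ b.ι i = 𝟙 b.pt := biproduct.total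
  let b' : Bicone G :=
    { pt := ⟨b.pt, addClosure_trans (fun i => (G i).obj) b.π b.ι (fun i => (G i).property) hb⟩
      π := fun i => ObjectProperty.homMk (b.π i)
      ι := fun i => ObjectProperty.homMk (b.ι i)
      ι_π := fun i j => by
        apply ObjectProperty.hom_ext
        refine (b.ι_π i j).trans ?_
        split_ifs with h
        · subst h; rfl
        · rfl }
  refine hasBiproduct_of_total b' ?_
  apply (projectiveFunctor k E).ι.map_injective
  rw [Functor.map_sum]
  exact hb

variable (k) in
/-- Whiskering a natural transformation between endofunctors of the module category. -/
abbrev conjNat {F G : FGModuleCat.{u} A ⥤ FGModuleCat.{u} A} (α : F ⟶ G) :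
    E.functor ⋙ F ⋙ E.inverse ⟶ E.functor ⋙ G ⋙ E.inverse :=
  Functor.whiskerLeft E.functor (Functor.whiskerRight α E.inverse)

/-- The bimodule `A e ⊗ f A` is a direct summand of `A ⊗ A`. -/
noncomputable def projMorRetract (e f : A) (he : IsIdempotentElem e) (hf : IsIdempotentElem f) :
    Retract (projMor k E e f he hf) (tensorA k E) where
  i := ObjectProperty.homMk (conjNat E (bimoduleIncl k e f))
  r := ObjectProperty.homMk (conjNat E (bimoduleProj k e f))
  retract := by
    apply ObjectProperty.hom_ext
    change conjNat E (bimoduleIncl k e f) ≫ conjNat E (bimoduleProj k e f) = 𝟙 _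
    rw [← Functor.whiskerLeft_comp, ← Functor.whiskerRight_comp, bimoduleIncl_proj k he hf]
    simp

/-- Every projective functor is a direct summand of a direct sum of copies of `𝟙` and `A ⊗ -`. -/
lemma addClosure_unit_tensorA (G : ProjCat k E) :
    addClosure (fun F => F = 𝟙_ (ProjCat k E) ∨ F = tensorA k E) G := by
  obtain ⟨G, n, F, p, q, hF, hpq⟩ := G
  refine addClosure_trans (fun i => (⟨F i, addClosure_of_mem (hF i)⟩ : ProjCat k E))
    (fun i => ObjectProperty.homMk (p i)) (fun i => ObjectProperty.homMk (q i)) (fun i => ?_) ?_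
  · have key : ∀ (F : C ⥤ C) (h : projectiveFunctor k E F), (F = 𝟭 C ∨
        ∃ e f : A, IsIdempotentElem e ∧ IsIdempotentElem f ∧ F = bimoduleFunctorOn k E e f) →
        addClosure (fun F => F = 𝟙_ (ProjCat k E) ∨ F = tensorA k E) (⟨F, h⟩ : ProjCat k E) := by
      rintro F h (rfl | ⟨e, f, he, hf, rfl⟩)
      · exact addClosure_of_mem (Or.inl rfl)
      · exact addClosure_retract (projMorRetract E e f he hf) (addClosure_of_mem (Or.inr rfl))
    exact key _ _ (hF i)
  · apply (projectiveFunctor k E).ι.map_injective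
    rw [Functor.map_sum]
    exact hpq

/-- Both 𝟙 ⟶ H and T ⟶ H are determined by a morphism a ⟶ H a: the first because a separates
morphisms, the second by the universal property of the copower. The general case is a direct summand
of sums of these. -/
instance projCat_finiteDimensional_hom (G H : ProjCat k E) : FiniteDimensional k (G ⟶ H) := by
  have hfin := finiteDimensional_hom k E
  let a := regularObj E
  let c := copowerA k E
  have h1 : FiniteDimensional k (𝟙_ (ProjCat k E) ⟶ H) := by
    let φ : (𝟙_ (ProjCat k E) ⟶ H) →ₗ[k] (a ⟶ H.obj.obj a) :=
      { toFun := fun α => α.hom.app a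
        map_add' := fun α β => rfl
        map_smul' := fun r α => rfl }
    refine Module.Finite.of_injective φ fun α β h => ProjCat.hom_ext_app fun N =>
      regularObj_ext k E fun v => ?_
    have h2 := fun α : 𝟙_ (ProjCat k E) ⟶ H => α.hom.naturality v
    exact (h2 α).trans ((congrArg (· ≫ H.obj.map v) h).trans (h2 β).symm)
  have h2 : FiniteDimensional k (tensorA k E ⟶ H) := by
    let φ : (tensorA k E ⟶ H) →ₗ[k] (a ⟶ H.obj.obj a) :=
      { toFun := fun α => c.lam (𝟙 a) ≫ α.hom.app a
        map_add' := fun α β => Preadditive.comp_add _ _ _ _ _ _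
        map_smul' := fun r α => Linear.comp_smul _ _ _ _ _ _ }
    refine Module.Finite.of_injective φ fun α β h => ProjCat.hom_ext_app fun N =>
      c.ext _ _ fun v => ?_
    have h2 : ∀ α : tensorA k E ⟶ H, c.lam v ≫ α.hom.app N = φ α ≫ H.obj.map v := fun α => by
      change _ = (c.lam (𝟙 a) ≫ α.hom.app a) ≫ H.obj.map v
      rw [Category.assoc, ← α.hom.naturality, reassoc_of% c.lam_map, Category.id_comp]
    rw [h2, h2, h]
  obtain ⟨n, F, p, q, hF, hpq⟩ := addClosure_unit_tensorA E G
  have h3 : ∀ i, FiniteDimensional k (F i ⟶ H) := fun i => by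
    rcases hF i with h | h <;> rw [h] <;> assumption
  let φ : (G ⟶ H) →ₗ[k] (∀ i, F i ⟶ H) := LinearMap.pi fun i => Linear.leftComp k H (q i)
  refine Module.Finite.of_injective φ fun α β h => ?_
  rw [← Category.id_comp α, ← Category.id_comp β, ← hpq, Preadditive.sum_comp, Preadditive.sum_comp]
  refine Finset.sum_congr rfl fun i _ => ?_
  rw [Category.assoc, Category.assoc]
  exact congrArg _ (congrFun h i)

/-- Projective functors map the regular module to projective modules. -/
lemma addClosure_regularObj (G : ProjCat k E) :
    addClosure (fun N => N = regularObj E) (G.obj.obj (regularObj E)) := by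
  have hfin := finiteDimensional_hom k E
  obtain ⟨n, F, p, q, hF, hpq⟩ := addClosure_unit_tensorA E G
  refine addClosure_trans (fun i => (F i).obj.obj (regularObj E)) (fun i => (p i).hom.app _)
    (fun i => (q i).hom.app _) (fun i => ?_) ?_
  · rcases hF i with h | h <;> rw [h]
    · exact addClosure_of_mem rfl
    · exact addClosure_of_fintype (fun _ => regularObj E) (fun i => (copowerA k E).coord _)
        (fun i => (copowerA k E).lam _) (fun _ => rfl) ((copowerA k E).sum_coord_lam (regularObj E))
  · let φ : (G ⟶ G) →+ (G.obj.obj (regularObj E) ⟶ G.obj.obj (regularObj E)) :=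
      AddMonoidHom.mk' (fun α => α.hom.app _) fun α β => rfl
    have := congrArg φ hpq
    rw [map_sum] at this
    exact this

end ProjCatInstances

/-! ### The ideal of sums of copies of T. -/

section Tensor

variable {k : Type*} [Field k] {A : Type u} [Ring A] [Algebra k A] [FiniteDimensional k A]
  {C : Type*} [Category* C] [Preadditive C] [Linear k C] {E : C ≌ FGModuleCat.{u} A}
  [E.functor.Additive] [E.functor.Linear k]
  {a : C} {T : ProjCat k E} {c : Copower k a T.obj}
  [hfin : ∀ X Y : C, FiniteDimensional k (X ⟶ Y)]
  {M : Type*} [Category* M] [Preadditive M] [MonoidalRightAction (ProjCat k E) M]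
  [AdditiveAction (ProjCat k E) M]

/-- `psi` transports a decomposition of the identity of G a through copies of a to one of the
identity of G U through copies of U. -/
lemma Coalg.addClosure_action (U : Coalg c M) {G : ProjCat k E}
    (hG : addClosure (fun N => N = a) (G.obj.obj a)) :
    addClosure (fun X => X = U.pt) (U.pt ⊙ᵣ G) := by
  obtain ⟨n, Y, p, q, hY, hpq⟩ := hG
  obtain rfl : Y = fun _ => a := funext hY
  refine addClosure_of_fintype (fun _ => U.pt)
    (fun i => U.psi (G := G) (H := 𝟙_ (ProjCat k E)) (p i) ≫ (ρᵣ U.pt).hom)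
    (fun i => (ρᵣ U.pt).inv ≫ U.psi (G := 𝟙_ (ProjCat k E)) (H := G) (q i)) (fun _ => rfl) ?_
  rw [← U.psi_id, ← hpq, U.psi_sum]
  refine Finset.sum_congr rfl fun i _ => ?_
  rw [Category.assoc, Iso.hom_inv_id_assoc]
  exact (U.psi_comp (H := 𝟙_ (ProjCat k E)) _ _).symm

variable (E) in
/-- Direct sums of copies of `A ⊗ -` form an ideal. -/
lemma addClosure_tensorA_left (G : ProjCat k E) :
    addClosure (fun F => F = tensorA k E) (tensorA k E ⊗ G) := by
  -- T itself is the cofree coalgebra on the unit, so the statement on coalgebras applies to it.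
  let U := Coalg.cofree (copowerA k E) (𝟙_ (ProjCat k E))
  have e : U.pt ≅ tensorA k E := λ_ (tensorA k E)
  refine addClosure_retract (Y := U.pt ⊙ᵣ G)
    ((Retract.ofIso e.symm).map (actBy (D := ProjCat k E) G)) ?_
  refine addClosure_trans (ι := Unit) (fun _ => U.pt ⊙ᵣ G) (fun _ => 𝟙 _) (fun _ => 𝟙 _)
    (fun _ => ?_) (by simp)
  refine addClosure_idem (addClosure_mono ?_ (U.addClosure_action (addClosure_regularObj E G)))
  rintro _ rfl
  exact addClosure_retract (Retract.ofIso e) (addClosure_of_mem rfl)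

variable (E) in
lemma addClosure_tensorA_right (G : ProjCat k E) :
    addClosure (fun F => F = tensorA k E) (G ⊗ tensorA k E) := by
  refine addClosure_map (actBy (D := ProjCat k E) (tensorA k E)) (fun F hF => ?_)
    (addClosure_unit_tensorA E G)
  rcases hF with rfl | rfl
  · exact addClosure_retract (Retract.ofIso (λ_ (tensorA k E))) (addClosure_of_mem rfl)
  · exact addClosure_tensorA_left E _

end Tensor

/-! ### Endomorphisms of the coalgebra T. -/

section Precomp

variable {k : Type*} [Field k] {A : Type u} [Ring A] [Algebra k A] [FiniteDimensional k A]
  {C : Type*} [Category* C] [Preadditive C] [Linear k C] {E : C ≌ FGModuleCat.{u} A}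
  [E.functor.Additive] [E.functor.Linear k]
  {a : C} {T : ProjCat k E} (c : Copower k a T.obj)
  [hfin : ∀ X Y : C, FiniteDimensional k (X ⟶ Y)]

open ProjCat

namespace ProjCat

/-- The endomorphism of `T = a ⊗ Hom(a, -)` induced by an endomorphism of `a` in the argument of
`Hom`. -/
noncomputable def precomp (x : a ⟶ a) : T ⟶ T :=
  ObjectProperty.homMk
    { app := fun N => (c.desc (𝟭 C) (c.lam ∘ₗ Linear.leftComp k N x) : T.obj.obj N ⟶ T.obj.obj N)
      naturality := fun N N' g => by
        refine c.map_ext (𝟭 C) _ _ fun v => ?_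
        have h1 := fun N (v : a ⟶ N) => c.map_lam_desc (𝟭 C) (c.lam ∘ₗ Linear.leftComp k N x) v
        simp only [Functor.id_map, LinearMap.comp_apply, Linear.leftComp_apply] at h1
        change c.lam v ≫ T.obj.map g ≫ c.desc (𝟭 C) _ = c.lam v ≫ c.desc (𝟭 C) _ ≫ T.obj.map g
        rw [← Category.assoc, c.lam_map, h1, ← Category.assoc (c.lam v), h1, c.lam_map,
          Category.assoc] }

lemma lam_precomp (x : a ⟶ a) {N : C} (v : a ⟶ N) :
    c.lam v ≫ (precomp c x).hom.app N = c.lam (x ≫ v) :=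
  c.map_lam_desc (𝟭 C) (c.lam ∘ₗ Linear.leftComp k N x) v

include c in
lemma hom_ext_lam {G : ProjCat k E} {α β : T ⟶ G}
    (h : ∀ {N : C} (v : a ⟶ N), c.lam v ≫ α.hom.app N = c.lam v ≫ β.hom.app N) : α = β :=
  hom_ext_app fun _ => c.ext _ _ h

lemma precomp_comp (x y : a ⟶ a) : precomp c x ≫ precomp c y = precomp c (y ≫ x) :=
  hom_ext_lam c fun {N} v => by
    change c.lam v ≫ (precomp c x).hom.app N ≫ (precomp c y).hom.app N = _
    rw [← Category.assoc, lam_precomp, lam_precomp, lam_precomp, Category.assoc]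

lemma precomp_id : precomp c (𝟙 a) = 𝟙 T :=
  hom_ext_lam c fun {N} v => by
    rw [lam_precomp, Category.id_comp]
    exact (Category.comp_id _).symm

/-- `precomp` as an additive map. -/
noncomputable def precompHom : (a ⟶ a) →+ (T ⟶ T) :=
  AddMonoidHom.mk' (precomp c) fun x y => hom_ext_lam c fun {N} v => by
    change _ = c.lam v ≫ ((precomp c x).hom.app N + (precomp c y).hom.app N)
    rw [Preadditive.comp_add, lam_precomp, lam_precomp, lam_precomp, Preadditive.add_comp, map_add]

/-- Evaluating on the copy of a indexed by 𝟙 a, then applying the counit, recovers x. -/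
lemma precomp_injective {x y : a ⟶ a} (h : precomp c x = precomp c y) : x = y := by
  have h1 := congrArg (fun α => c.lam (𝟙 a) ≫ α.hom.app a ≫ (counit c).hom.app a) h
  simp only [← Category.assoc] at h1
  rw [lam_precomp, lam_precomp, lam_counit, lam_counit] at h1
  simpa using h1

end ProjCat

namespace Coalg

/-- `T` as a coalgebra over itself. -/
noncomputable def base : Coalg c (ProjCat k E) where
  pt := T
  str := comul c
  str_counit := comul_counit c
  str_coassoc := by
    change comul c ≫ comul c ▷ T = comul c ≫ T ◁ comul c ≫ (α_ T T T).inv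
    rw [← Category.assoc, ← comul_coassoc, Category.assoc, Category.assoc, Iso.hom_inv_id,
      Category.comp_id]

lemma isCoalgHom_precomp (x : a ⟶ a) : IsCoalgHom (base c) (base c) (precomp c x) :=
  hom_ext_lam c fun {N} v => by
    change c.lam v ≫ (precomp c x).hom.app N ≫ (comul c).hom.app N =
      c.lam v ≫ (comul c).hom.app N ≫ T.obj.map ((precomp c x).hom.app N)
    rw [← Category.assoc, lam_precomp, lam_comul, ← Category.assoc, lam_comul, c.lam_map,
      lam_precomp]

/-- The endomorphisms of the coalgebra `T` are given by endomorphisms of `a`. -/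
lemma exists_precomp {β : T ⟶ T} (hβ : IsCoalgHom (base c) (base c) β) :
    ∃ x : a ⟶ a, β = precomp c x := by
  have hβ' : β ≫ comul c = comul c ≫ β ▷ T := hβ
  -- Compatibility with the comultiplication forces β to map the copy of a indexed by v to the copy
  -- indexed by some other morphism a ⟶ N, which the counit then identifies.
  have key : ∀ {N : C} (v : a ⟶ N), c.lam v ≫ β.hom.app N =
      c.lam (c.lam v ≫ β.hom.app N ≫ (counit c).hom.app N) := fun {N} v => by
    have h1 : c.lam (c.lam v ≫ β.hom.app N) = (c.lam v ≫ β.hom.app N) ≫ (comul c).hom.app N := by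
      have h2 := congrArg (fun α => c.lam v ≫ α.hom.app N) hβ'
      change c.lam v ≫ β.hom.app N ≫ (comul c).hom.app N =
        c.lam v ≫ (comul c).hom.app N ≫ T.obj.map (β.hom.app N) at h2
      rw [Category.assoc, h2, ← Category.assoc, lam_comul, c.lam_map]
    have h3 : (comul c).hom.app N ≫ T.obj.map ((counit c).hom.app N) = 𝟙 _ := by
      refine c.ext _ _ fun v => ?_
      rw [← Category.assoc, lam_comul, c.lam_map, lam_counit, Category.comp_id]
    rw [← Category.assoc, ← c.lam_map, h1, Category.assoc, h3, Category.comp_id]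
  refine ⟨c.lam (𝟙 a) ≫ β.hom.app a ≫ (counit c).hom.app a, hom_ext_lam c fun {N} v => ?_⟩
  rw [lam_precomp, key]
  congr 1
  have h4 : T.obj.map v ≫ β.hom.app N ≫ (counit c).hom.app N =
      β.hom.app a ≫ (counit c).hom.app a ≫ v := by
    have h5 := β.hom.naturality v
    have h6 := (counit c).hom.naturality v
    rw [reassoc_of% h5]
    exact congrArg _ h6
  rw [Category.assoc, Category.assoc, ← h4, reassoc_of% c.lam_map, Category.id_comp]

/-- Primitive idempotents of `a` give local direct summands of the coalgebra `T`. -/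
lemma exists_isLocal_of_primitive [IsIdempotentComplete (ProjCat k E)] {p : a ⟶ a} (hp : p ≫ p = p)
    (hprim : ∀ x : a ⟶ a, x ≫ x = x → x ≫ p = x → p ≫ x = x → x = 0 ∨ x = p) :
    ∃ (U : Coalg c (ProjCat k E)) (i : U.pt ⟶ T) (r : T ⟶ U.pt), U.IsLocal ∧ i ≫ r = 𝟙 _ ∧
      r ≫ i = precomp c p := by
  have hpp : precomp c p ≫ precomp c p = precomp c p :=
    (precomp_comp c p p).trans (congrArg _ hp)
  have hsplit : ∃ (U : Coalg c (ProjCat k E)) (i : U.pt ⟶ T) (r : T ⟶ U.pt),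
      IsCoalgHom U (base c) i ∧ IsCoalgHom (base c) U r ∧ i ≫ r = 𝟙 _ ∧ r ≫ i = precomp c p :=
    (base c).exists_split (isCoalgHom_precomp c p) hpp
  obtain ⟨U, i, r, hi, hr, hir, hri⟩ := hsplit
  refine ⟨U, i, r, fun ε hε hεε => ?_, hir, hri⟩
  -- An idempotent of the summand, regarded as an endomorphism of T, is given by an idempotent x
  -- below p; primitivity leaves only 0 and p.
  obtain ⟨x, hx⟩ := exists_precomp c (hr.comp (hε.comp hi))
  have hx' : r ≫ ε ≫ i = precomp c x := hx
  have h1 : x ≫ x = x := precomp_injective c (by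
    rw [← precomp_comp, ← hx']
    simp only [Category.assoc]
    rw [reassoc_of% hir, reassoc_of% hεε])
  have h2 : x ≫ p = x := precomp_injective c (by
    rw [← precomp_comp, ← hx', ← hri, Category.assoc, reassoc_of% hir])
  have h3 : p ≫ x = x := precomp_injective c (by
    rw [← precomp_comp, ← hx', ← hri]
    simp only [Category.assoc]
    rw [reassoc_of% hir])
  have h4 : ε = i ≫ precomp c x ≫ r := by
    rw [← hx']
    simp only [Category.assoc]
    rw [hir, Category.comp_id, reassoc_of% hir]
  rcases hprim x h1 h2 h3 with rfl | rfl
  · left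
    rw [h4]
    have : precomp c (0 : a ⟶ a) = 0 := map_zero (precompHom c)
    rw [this, zero_comp, comp_zero]
  · right
    rw [h4, ← hri]
    simp only [Category.assoc]
    rw [hir, Category.comp_id, hir]

end Coalg

end Precomp

/-! ### Semisimple and simple rings. -/

section Semisimple

variable {A : Type u} [Ring A]

/-- A ring is semisimple if all its cyclic modules are projective. -/
lemma isSemisimpleRing_of_projective (h : ∀ I : Ideal A, Module.Projective A (A ⧸ I)) :
    IsSemisimpleRing A := by
  refine (isSemisimpleModule_iff A A).2 ⟨fun I => ?_⟩
  have := h I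
  obtain ⟨g, hg⟩ := Module.projective_lifting_property I.mkQ LinearMap.id I.mkQ_surjective
  -- A section of the projection onto A / I yields an idempotent endomorphism of A with kernel I,
  -- whose range is a complement.
  have h1 : IsIdempotentElem (g ∘ₗ I.mkQ : A →ₗ[A] A) := by
    refine LinearMap.ext fun x => ?_
    change g (I.mkQ (g (I.mkQ x))) = g (I.mkQ x)
    exact congrArg g (LinearMap.congr_fun hg (I.mkQ x))
  have h2 := LinearMap.IsIdempotentElem.isCompl h1
  have h3 : LinearMap.ker (g ∘ₗ I.mkQ : A →ₗ[A] A) = I := by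
    rw [LinearMap.ker_comp, LinearMap.ker_eq_bot_of_inverse hg]
    exact I.ker_mkQ
  rw [h3] at h2
  exact ⟨_, h2.symm⟩

/-- Connected semisimple rings are simple. -/
lemma isSimpleRing_of_isConnectedRing [IsSemisimpleRing A] (h : IsConnectedRing A) :
    IsSimpleRing A := by
  obtain ⟨n, D, d, _, hd, ⟨φ⟩⟩ := IsSemisimpleRing.exists_ringEquiv_pi_matrix_divisionRing A
  have := h.1
  have hne : Nonempty (Fin n) := by
    by_contra hcon
    rw [not_nonempty_iff] at hcon
    exact one_ne_zero (φ.injective (Subsingleton.elim (φ (1 : A)) (φ 0)))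
  obtain ⟨i⟩ := hne
  -- The unit of one Wedderburn block is a central idempotent, so connectedness leaves no other
  -- block.
  let s : ∀ i, Matrix (Fin (d i)) (Fin (d i)) (D i) := Pi.single i 1
  have hs : φ.symm s ∈ Set.center A := by
    rw [Semigroup.mem_center_iff]
    intro x
    apply φ.injective
    rw [map_mul, map_mul, φ.apply_symm_apply]
    ext j : 1
    by_cases hj : j = i
    · subst hj; simp [s]
    · simp [s, hj]
  have hs' : IsIdempotentElem (φ.symm s) := by
    apply φ.injective
    rw [map_mul, φ.apply_symm_apply]
    ext j : 1
    by_cases hj : j = i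
    · subst hj; simp [s]
    · simp [s, hj]
  have hj : ∀ j, j = i := by
    by_contra! hcon
    obtain ⟨j, hj⟩ := hcon
    rcases h.2 _ hs hs' with h0 | h1
    · have := congrArg φ h0
      rw [φ.apply_symm_apply, map_zero] at this
      have := congrFun this i
      simp [s] at this
    · have := congrArg φ h1
      rw [φ.apply_symm_apply, map_one] at this
      have := congrFun this j
      simp [s, hj] at this
  let u : Unique (Fin n) := ⟨⟨i⟩, hj⟩
  let ψ := φ.trans (RingEquiv.piUnique fun i => Matrix (Fin (d i)) (Fin (d i)) (D i))
  exact IsSimpleRing.of_ringEquiv ψ.symm inferInstance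

end Semisimple

/-! ### Decomposition into indecomposable objects. -/

section Decomposition

variable (k : Type*) [Field k] [IsAlgClosed k] {D : Type*} [Category* D] [Preadditive D] [Linear k D]
  [hfinD : ∀ X Y : D, FiniteDimensional k (X ⟶ Y)] [IsIdempotentComplete D]

include k in
/-- Every object is a direct sum of indecomposable direct summands. -/
lemma addClosure_isIndec (X : D) :
    addClosure (fun Y => IsIndec Y ∧ Nonempty (Retract Y X)) X := by
  induction hn : Module.finrank k (X ⟶ X) using Nat.strong_induction_on generalizing X with
  | _ n ih =>
  by_cases h0 : IsZero X
  · exact ⟨0, fun _ => X, fun _ => 0, fun _ => 0, fun i => i.elim0, by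
      rw [Finset.univ_eq_empty, Finset.sum_empty]; exact h0.eq_of_src _ _⟩
  by_cases ht : TrivIdem X
  · exact addClosure_of_mem ⟨isIndec_of_trivIdem h0 ht, ⟨Retract.refl X⟩⟩
  unfold TrivIdem at ht
  push Not at ht
  obtain ⟨e, he, he0, he1⟩ := ht
  -- It is applied to e and to 1 - e; both differ from the identity, so both images have smaller
  -- endomorphism algebras.
  have key : ∀ e : X ⟶ X, e ≫ e = e → e ≠ 𝟙 X → ∃ (Y : D) (i : Y ⟶ X) (r : X ⟶ Y), r ≫ i = e ∧
      addClosure (fun Y => IsIndec Y ∧ Nonempty (Retract Y X)) Y := fun e he he1 => by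
    obtain ⟨Y, i, r, hir, hri⟩ := IsIdempotentComplete.idempotents_split X e he
    refine ⟨Y, i, r, hri, addClosure_mono ?_ (ih _ ?_ Y rfl)⟩
    · rintro Z ⟨hZ, ⟨h⟩⟩
      exact ⟨hZ, ⟨h.trans ⟨i, r, hir⟩⟩⟩
    · rw [← hn]
      exact Coalg.finrank_end_lt hir (by rwa [hri])
  obtain ⟨Y, i, r, hri, hY⟩ := key e he he1
  obtain ⟨Z, i', r', hri', hZ⟩ := key (𝟙 X - e) (Idempotents.idem_of_id_sub_idem e he)
    (fun h => he0 (by simpa using h))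
  refine addClosure_trans (ι := Fin 2) ![Y, Z] (Fin.cons r (Fin.cons r' finZeroElim))
    (Fin.cons i (Fin.cons i' finZeroElim)) (fun j => ?_) ?_
  · fin_cases j
    · exact hY
    · exact hZ
  · rw [Fin.sum_univ_two]
    change r ≫ i + r' ≫ i' = _
    rw [hri, hri']
    abel

include k in
lemma exists_isIndec_retract {X : D} (h : ¬ IsZero X) : ∃ Y, IsIndec Y ∧ Nonempty (Retract Y X) := by
  obtain ⟨n, Y, p, q, hY, hpq⟩ := addClosure_isIndec k X
  cases n with
  | zero =>
    refine absurd ?_ h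
    rw [IsZero.iff_id_eq_zero, ← hpq, Finset.univ_eq_empty, Finset.sum_empty]
  | succ n => exact ⟨Y 0, hY 0⟩

end Decomposition

/-! ### Covering relations and their decorations. -/

section Vertices

variable {k : Type*} [Field k] [IsAlgClosed k] {A : Type u} [Ring A] [Algebra k A]
  [FiniteDimensional k A]
  {C : Type*} [Category* C] [Preadditive C] [Linear k C] {E : C ≌ FGModuleCat.{u} A}
  [E.functor.Additive] [E.functor.Linear k]
  {a : C} {T : ProjCat k E} (c : Copower k a T.obj)
  [hfin : ∀ X Y : C, FiniteDimensional k (X ⟶ Y)]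
  {M : Type*} [Category* M] [Preadditive M] [Linear k M] [MonoidalRightAction (ProjCat k E) M]
  [AdditiveAction (ProjCat k E) M] [LinearAction k (ProjCat k E) M]
  [hfinM : ∀ X Y : M, FiniteDimensional k (X ⟶ Y)] [IsIdempotentComplete M]
  (hproj : ∀ G : ProjCat k E, addClosure (fun N => N = a) (G.obj.obj a))
  (hpr : ∀ G : ProjCat k E, addClosure (fun F => F = 𝟙_ (ProjCat k E) ∨ F = T) G)

include c hproj in
/-- The action can be reversed on direct summands of objects of the form `T X`. -/
lemma retract_action_of_retract {X Y Z : M} {F : ProjCat k E} (hY : IsIndec Y)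
    (h : Retract Y (X ⊙ᵣ T)) (hZ : ¬ IsZero Z) (hZY : Retract Z (Y ⊙ᵣ F)) :
    Nonempty (Retract Y (Z ⊙ᵣ T)) := by
  -- Y is a summand of a local coalgebra U, so Z is a summand of F U. Applying T to Z recovers U and
  -- with it Y.
  obtain ⟨U, hU, ⟨r⟩⟩ := Coalg.exists_isLocal hY.trivIdem hY.1 (Coalg.cofree c X) ⟨h⟩
  obtain ⟨s⟩ := U.retract_of_retract hproj hU hZ (hZY.trans (r.map (actBy F)))
  exact ⟨r.trans s⟩

include c hproj in
lemma le_of_le_of_retract {W : M} {Y Z : Ind (ProjCat k E) M} (h : Retract Y.1 (W ⊙ᵣ T))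
    (hle : Y ≤ Z) : Z ≤ Y := by
  obtain ⟨F, ⟨r⟩⟩ := hle
  exact ⟨T, retract_action_of_retract c hproj Y.2 h Z.2.1 r⟩

include c hproj in
-- The case Z = Y, F = 𝟙 of the reversal: a summand of some T W is a summand of its own image under
-- T.
lemma setActsNonzero_of_retract {W : M} {Y : Ind (ProjCat k E) M} (h : Retract Y.1 (W ⊙ᵣ T))
    {R : Set (Ind (ProjCat k E) M)} (hY : Y ∈ R) : SetActsNonzero T R :=
  ⟨Y, hY, Y, hY, retract_action_of_retract c hproj Y.2 h Y.2.1
    (F := 𝟙_ (ProjCat k E)) (Retract.ofIso (ρᵣ Y.1).symm)⟩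

include c hproj in
-- Such a vertex contains a summand of some T Y, and every step leaving that summand can be
-- reversed.
lemma isMax_of_setActsNonzero {ρ : Vertex (ProjCat k E) M}
    (h : SetActsNonzero T (indOf (ProjCat k E) {ρ})) : IsMax ρ := by
  intro τ hτ
  obtain ⟨Y, -, Z, ⟨_, rfl, rfl⟩, ⟨r⟩⟩ := h
  induction τ using Antisymmetrization.ind with
  | _ W =>
    have h1 : Z ≤ W := toAntisymmetrization_le_toAntisymmetrization_iff.1 hτ
    exact toAntisymmetrization_le_toAntisymmetrization_iff.2 (le_of_le_of_retract c hproj r h1)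

include hpr in
-- Every 1-morphism is built from 𝟙 and T, and Y is local. Through 𝟙 nothing moves, so a strict step
-- must use T.
lemma retract_or_retract {X Y : Ind (ProjCat k E) M} (h : X ≤ Y) :
    Nonempty (Retract Y.1 X.1) ∨ Nonempty (Retract Y.1 (X.1 ⊙ᵣ T)) := by
  obtain ⟨F, ⟨r⟩⟩ := h
  have h1 : addClosure (fun W => W = X.1 ⊙ᵣ 𝟙_ (ProjCat k E) ∨ W = X.1 ⊙ᵣ T) Y.1 := by
    refine addClosure_retract r (addClosure_map (orbit (ProjCat k E) X.1) (fun G hG => ?_) (hpr F))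
    rcases hG with rfl | rfl
    · exact addClosure_of_mem (Or.inl rfl)
    · exact addClosure_of_mem (Or.inr rfl)
  obtain ⟨W, rfl | rfl, ⟨s⟩⟩ := exists_retract_of_addClosure k Y.2.trivIdem Y.2.1 h1
  · exact Or.inl ⟨s.trans (Retract.ofIso (ρᵣ X.1))⟩
  · exact Or.inr ⟨s⟩

/-- Isomorphic objects belong to the same vertex. -/
lemma toAntisymmetrization_eq_of_retract {X Y : Ind (ProjCat k E) M} (h : Retract Y.1 X.1) :
    toAntisymmetrization (· ≤ ·) X = toAntisymmetrization (· ≤ ·) Y := by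
  obtain ⟨e⟩ := X.2.trivIdem.retract_symm Y.2.1 h
  have key : ∀ {X Y : Ind (ProjCat k E) M} (_ : X.1 ≅ Y.1), X ≤ Y := fun {X Y} e =>
    ⟨𝟙_ (ProjCat k E), ⟨(Retract.ofIso e.symm).trans (Retract.ofIso (ρᵣ X.1).symm)⟩⟩
  exact le_antisymm (toAntisymmetrization_le_toAntisymmetrization_iff.2 (key e.symm))
    (toAntisymmetrization_le_toAntisymmetrization_iff.2 (key e))

include c hproj hpr in
/-- Covering relations lead from vertices on which `T` acts by zero to vertices on which it does
not. -/
lemma setActsNonzero_of_covBy {ρ τ : Vertex (ProjCat k E) M} (h : ρ ⋖ τ) :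
    ¬ SetActsNonzero T (indOf (ProjCat k E) {ρ}) ∧ SetActsNonzero T (indOf (ProjCat k E) {τ}) := by
  refine ⟨fun hρ => h.lt.not_isMax (isMax_of_setActsNonzero c hproj hρ), ?_⟩
  induction ρ using Antisymmetrization.ind with
  | _ X =>
  induction τ using Antisymmetrization.ind with
  | _ Y =>
    have h1 : X ≤ Y := toAntisymmetrization_le_toAntisymmetrization_iff.1 h.le
    rcases retract_or_retract hpr h1 with ⟨⟨r⟩⟩ | ⟨⟨r⟩⟩
    · exact absurd (toAntisymmetrization_eq_of_retract r) h.lt.ne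
    · exact setActsNonzero_of_retract c hproj r ⟨_, rfl, rfl⟩

variable [hfin𝒞 : ∀ X Y : ProjCat k E, FiniteDimensional k (X ⟶ Y)]
  [IsIdempotentComplete (ProjCat k E)] (hunit : TrivIdem (𝟙_ (ProjCat k E)))
  {ι : Type*} {L : ι → Set (Ind (ProjCat k E) (ProjCat k E))}
  (hL : ∀ i, ∀ F ∈ L i, ∀ F' ∈ L i, F ≤ F') (hLT : ∀ i, ∀ F ∈ L i, Nonempty (Retract F.1 T))
  (hcover : ∀ F : Ind (ProjCat k E) (ProjCat k E), Nonempty (Retract F.1 T) → ∃ i, F ∈ L i)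

include c hproj hpr hunit hL hLT hcover in
/-- Edges are decorated by unions of left cells. -/
lemma exists_decoration_eq {ρ τ : Vertex (ProjCat k E) M} (h : ρ ⋖ τ) :
    ∃ S : Set ι, decoration (ProjCat k E) ρ τ = ⋃ i ∈ S, L i := by
  -- Take all cells that meet the decoration; it must be shown that each of them is contained in it.
  refine ⟨{i | (L i ∩ decoration (ProjCat k E) ρ τ).Nonempty}, Set.Subset.antisymm ?_ ?_⟩
  · intro F hF
    have hFT : Nonempty (Retract F.1 T) := by
      obtain ⟨G, rfl | rfl, ⟨r⟩⟩ := exists_retract_of_addClosure k F.2.trivIdem F.2.1 (hpr F.1)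
      -- A summand F of the identity makes F X a summand of X, so it cannot lead to another vertex.
      · exfalso
        obtain ⟨X, Y, hX, hY, ⟨s⟩⟩ := hF
        rw [← hX, ← hY] at h
        refine h.lt.ne (toAntisymmetrization_eq_of_retract ?_)
        exact s.trans ((r.map (orbit (ProjCat k E) X.1)).trans (Retract.ofIso (ρᵣ X.1)))
      · exact ⟨r⟩
    obtain ⟨i, hi⟩ := hcover F hFT
    exact Set.mem_biUnion (show i ∈ {i | _} from ⟨F, hi, hF⟩) hi
  · refine Set.iUnion₂_subset fun i ⟨F, hFi, X, Y, hX, hY, ⟨r⟩⟩ F' hF' => ?_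
    obtain ⟨H, ⟨s⟩⟩ := hL i F' hF' F hFi
    obtain ⟨t⟩ := hLT i F' hF'
    have r1 : Retract Y.1 ((X.1 ⊙ᵣ F'.1) ⊙ᵣ H) :=
      r.trans ((s.map (orbit (ProjCat k E) X.1)).trans (Retract.ofIso (αᵣ X.1 F'.1 H)))
    -- F is a summand of F' followed by H, so Y is a summand of H W for some indecomposable summand
    -- W of F' X. It remains to place W in the vertex of Y.
    have h1 : addClosure (fun V => ∃ W, (IsIndec W ∧ Nonempty (Retract W (X.1 ⊙ᵣ F'.1))) ∧
        V = W ⊙ᵣ H) Y.1 :=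
      addClosure_retract r1 (addClosure_map (actBy H)
        (fun W hW => addClosure_of_mem ⟨W, hW, rfl⟩) (addClosure_isIndec k (X.1 ⊙ᵣ F'.1)))
    obtain ⟨_, ⟨W, ⟨hW, ⟨r2⟩⟩, rfl⟩, ⟨r3⟩⟩ :=
      exists_retract_of_addClosure k Y.2.trivIdem Y.2.1 h1
    let W' : Ind (ProjCat k E) M := ⟨W, hW⟩
    have hWY : W' ≤ Y := ⟨H, ⟨r3⟩⟩
    -- F' is a summand of T, so W is a summand of T X, and the step from W to Y can be reversed.
    have hYW : Y ≤ W' := le_of_le_of_retract c hproj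
      (r2.trans (t.map (orbit (ProjCat k E) X.1))) hWY
    refine ⟨X, W', hX, ?_, ⟨r2⟩⟩
    rw [← hY]
    exact le_antisymm (toAntisymmetrization_le_toAntisymmetrization_iff.2 hWY)
      (toAntisymmetrization_le_toAntisymmetrization_iff.2 hYW)

end Vertices

/-! ### Left cells and the action of T on them. -/

section Cells

variable {k : Type*} [Field k] [IsAlgClosed k] {A : Type u} [Ring A] [Algebra k A]
  [FiniteDimensional k A]
  {C : Type*} [Category* C] [Preadditive C] [Linear k C] {E : C ≌ FGModuleCat.{u} A}
  [E.functor.Additive] [E.functor.Linear k]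
  {a : C} {T : ProjCat k E} (c : Copower k a T.obj)
  [hfin : ∀ X Y : C, FiniteDimensional k (X ⟶ Y)]
  [hfin𝒞 : ∀ X Y : ProjCat k E, FiniteDimensional k (X ⟶ Y)]
  [IsIdempotentComplete (ProjCat k E)]
  (hproj : ∀ G : ProjCat k E, addClosure (fun N => N = a) (G.obj.obj a))
  (hTl : ∀ G : ProjCat k E, addClosure (fun F => F = T) (T ⊗ G))
  (hTr : ∀ G : ProjCat k E, addClosure (fun F => F = T) (G ⊗ T))

include hTl hTr in
/-- `T` acts by zero on the left cell of the unit. -/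
lemma not_setActsNonzero_leftCell_unit (hunit : TrivIdem (𝟙_ (ProjCat k E)))
    (h0 : ¬ IsZero (𝟙_ (ProjCat k E))) (h : IsEmpty (Retract (𝟙_ (ProjCat k E)) T)) :
    ¬ SetActsNonzero T (leftCell (𝟙_ (ProjCat k E))) := by
  rintro ⟨Y, hY, Z, ⟨⟨H, ⟨s⟩⟩, -⟩, ⟨r⟩⟩
  -- Z would be a summand of a sum of copies of T. Since Z acts back onto 𝟙 and T absorbs that
  -- action, 𝟙 would be a summand of T.
  have h1 : addClosure (fun F => F = T) Z.1 := addClosure_retract r (hTr Y.1)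
  have h2 : addClosure (fun F => F = T) (𝟙_ (ProjCat k E)) :=
    addClosure_retract s (addClosure_map (actBy (D := ProjCat k E) H)
      (fun F hF => by rw [hF]; exact hTl H) h1)
  obtain ⟨_, rfl, ⟨t⟩⟩ := exists_retract_of_addClosure k hunit h0 h2
  exact h.false t

include hTl in
lemma retract_of_mem_leftCell {F : ProjCat k E} (hF : Retract F T)
    {G : Ind (ProjCat k E) (ProjCat k E)} (hG : G ∈ leftCell F) : Nonempty (Retract G.1 T) := by
  obtain ⟨-, H, ⟨r⟩⟩ := hG
  obtain ⟨_, rfl, h⟩ := exists_retract_of_addClosure k G.2.trivIdem G.2.1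
    (addClosure_retract (r.trans (hF.map (actBy (D := ProjCat k E) H))) (hTl H))
  exact h

variable {U : Coalg c (ProjCat k E)} (hU : U.IsLocal) {F : ProjCat k E} (hF : Retract F U.pt)
  (hF0 : ¬ IsZero F)

include hproj hU hF hF0 in
/-- Indecomposable direct summands of a local coalgebra form one left cell. -/
lemma mem_leftCell_of_retract {G : Ind (ProjCat k E) (ProjCat k E)} (hG : Retract G.1 U.pt) :
    G ∈ leftCell F := by
  have key : ∀ {H : ProjCat k E}, ¬ IsZero H → Retract H U.pt → Nonempty (Retract U.pt (H ⊙ᵣ T)) :=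
    fun {H} hH0 hH => U.retract_of_retract hproj hU hH0
      (G := 𝟙_ (ProjCat k E)) (hH.trans (Retract.ofIso (ρᵣ U.pt).symm))
  obtain ⟨r⟩ := key G.2.1 hG
  obtain ⟨s⟩ := key hF0 hF
  exact ⟨⟨T, ⟨hF.trans r⟩⟩, ⟨T, ⟨hG.trans s⟩⟩⟩

include hproj hU hF hF0 in
-- Any indecomposable summand of F lies in the cell, so F itself need not be shown indecomposable.
lemma leftCell_nonempty : (leftCell F).Nonempty := by
  obtain ⟨Y, hY, ⟨r⟩⟩ := exists_isIndec_retract k hF0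
  exact ⟨⟨Y, hY⟩, mem_leftCell_of_retract c hproj hU hF hF0 (r.trans hF)⟩

end Cells

/-! ### The idempotents cutting out Ae ⊗ fA, and endomorphisms of the regular module. -/

section Regular

variable (k : Type*) [Field k] {A : Type u} [Ring A] [Algebra k A] [FiniteDimensional k A]

lemma fromRegular_comp {V : FGModuleCat.{u} A} (b : A) (v : V.obj) :
    (fromRegular b : regular A ⟶ regular A) ≫ fromRegular v = fromRegular (b • v) :=
  regular_hom_ext (mul_smul (1 : A) b v)

open scoped ModuleCat.Algebra in
-- The endomorphism x ⊗ v ↦ xe ⊗ fv of A ⊗ V, in the language of copowers: f acts on the index v and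
-- e on the copy of A.
lemma lam_bimoduleProj_incl (e f : A) {V : FGModuleCat.{u} A} (v : regular A ⟶ V) :
    (copowerRegular k A).lam v ≫ (bimoduleProj k e f ≫ bimoduleIncl k e f).app V =
      (fromRegular e : regular A ⟶ regular A) ≫
        (copowerRegular k A).lam ((fromRegular f : regular A ⟶ regular A) ≫ v) := by
  rw [← fromRegular_eq v, fromRegular_comp]
  generalize v.hom.hom (1 : A) = w
  have h1 : ∀ w : V.obj, (copowerRegular k A).lam (fromRegular w) = fromRegular (oneTmul k V w) :=
    fun w => congrArg (fun x => fromRegular (oneTmul k V x)) (one_smul A w)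
  rw [h1, h1, fromRegular_comp]
  refine regular_hom_ext ?_
  change (bimoduleIncl k e f).app V ((bimoduleProj k e f).app V ((1 : A) • oneTmul k V w)) =
    (1 : A) • (e • oneTmul k V (f • w))
  rw [one_smul, one_smul]
  refine Eq.trans ?_ (TensorProduct.smul_tmul' e (spanOne A 1) (cornerOne k V (f • w))).symm
  refine congrArg₂ (fun (x : ↥(Ideal.span {(1 : A)})) (v : ↥(corner k (1 : A) V.obj)) => x ⊗ₜ[k] v)
    ?_ rfl
  apply Subtype.ext
  change (1 : A) * e = e * 1
  rw [one_mul, mul_one]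

end Regular

section EndRegular

variable (k : Type*) [Field k] {A : Type u} [Ring A] [Algebra k A] [FiniteDimensional k A]
  {C : Type*} [Category* C] [Preadditive C] [Linear k C] (E : C ≌ FGModuleCat.{u} A)
  [E.functor.Additive] [E.functor.Linear k]

/-- Right multiplication by an element of `A`. -/
def mulRight (b : A) : regularObj E ⟶ regularObj E :=
  E.inverse.map (fromRegular b : regular A ⟶ regular A)

omit [FiniteDimensional k A] in
lemma mulRight_comp (b b' : A) : mulRight E b ≫ mulRight E b' = mulRight E (b * b') := by
  rw [mulRight, mulRight, ← E.inverse.map_comp, fromRegular_comp]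
  rfl

lemma mulRight_one : mulRight E (1 : A) = 𝟙 _ := by
  have : (fromRegular (1 : A) : regular A ⟶ regular A) = 𝟙 _ := regular_hom_ext (one_smul A (1 : A))
  rw [mulRight, this, E.inverse.map_id]

lemma mulRight_add (b b' : A) : mulRight E (b + b') = mulRight E b + mulRight E b' := by
  have : (fromRegular (b + b') : regular A ⟶ regular A) = fromRegular b + fromRegular b' :=
    fromRegular_add _ _
  rw [mulRight, this, E.inverse.map_add]
  rfl

/-- `mulRight` as an additive map. -/
def mulRightHom : A →+ (regularObj E ⟶ regularObj E) := AddMonoidHom.mk' _ (mulRight_add E)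

lemma mulRight_zero : mulRight E (0 : A) = 0 := map_zero (mulRightHom E)

lemma mulRight_injective {b b' : A} (h : mulRight E b = mulRight E b') : b = b' := by
  have h1 := congrArg (fun x : regular A ⟶ regular A => x.hom.hom (1 : A))
    (E.inverse.map_injective h)
  have h2 : (1 : A) • b = (1 : A) • b' := h1
  rwa [one_smul, one_smul] at h2

lemma exists_mulRight (x : regularObj E ⟶ regularObj E) : ∃ b : A, mulRight E b = x := by
  obtain ⟨g, rfl⟩ := E.inverse.map_surjective x
  exact ⟨g.hom.hom (1 : A), congrArg E.inverse.map (fromRegular_eq g)⟩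

/-- All endomorphisms of the regular module are right multiplications, so x is given by some b in A,
and e = b + (e - b) is an orthogonal decomposition. -/
lemma primitive_mulRight {e : A} (he : IsPrimitiveIdempotent e) (x : regularObj E ⟶ regularObj E)
    (h1 : x ≫ x = x) (h2 : x ≫ mulRight E e = x) (h3 : mulRight E e ≫ x = x) :
    x = 0 ∨ x = mulRight E e := by
  obtain ⟨b, rfl⟩ := exists_mulRight E x
  rw [mulRight_comp] at h1 h2 h3
  replace h1 := mulRight_injective E h1
  replace h2 := mulRight_injective E h2
  replace h3 := mulRight_injective E h3
  have h4 : IsIdempotentElem (e - b) := by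
    rw [IsIdempotentElem, mul_sub, sub_mul, sub_mul, he.1.eq, h1, h2, h3, sub_self, sub_zero]
  rcases he.2.2 b (e - b) h1 h4 (by rw [mul_sub, h2, h1, sub_self])
    (by rw [sub_mul, h3, h1, sub_self]) (add_sub_cancel b e).symm with h | h
  · exact Or.inl (by rw [h, mulRight_zero])
  · exact Or.inr (by rw [sub_eq_zero.1 h])

lemma lam_projMorRetract {e f : A} (he : IsIdempotentElem e) (hf : IsIdempotentElem f) {N : C}
    (v : regularObj E ⟶ N) :
    (copowerA k E).lam v ≫ ((projMorRetract (k := k) E e f he hf).r ≫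
      (projMorRetract (k := k) E e f he hf).i).hom.app N =
      mulRight E e ≫ (copowerA k E).lam (mulRight E f ≫ v) := by
  have h := congrArg E.inverse.map
    (lam_bimoduleProj_incl k e f (homEquivInverse k E (regular A) N v))
  rw [← comp_homEquivInverse, E.inverse.map_comp, E.inverse.map_comp] at h
  refine Eq.trans ?_ h
  refine congrArg (fun x => (copowerA k E).lam v ≫ x) ?_
  exact (E.inverse.map_comp _ _).symm

end EndRegular

/-! ### The identity functor: indecomposable, and not a summand of T. -/

section Unit

variable {k : Type*} [Field k] {A : Type u} [Ring A] [Algebra k A] [FiniteDimensional k A]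
  {C : Type*} [Category* C] [Preadditive C] [Linear k C] (E : C ≌ FGModuleCat.{u} A)
  [E.functor.Additive] [E.functor.Linear k]

lemma unit_hom_ext {α β : 𝟙_ (ProjCat k E) ⟶ 𝟙_ (ProjCat k E)}
    (h : α.hom.app (regularObj E) = β.hom.app (regularObj E)) : α = β :=
  ProjCat.hom_ext_app fun N => regularObj_ext k E fun v => by
    have key : ∀ α : 𝟙_ (ProjCat k E) ⟶ 𝟙_ (ProjCat k E),
      v ≫ (show N ⟶ N from α.hom.app N) = α.hom.app (regularObj E) ≫ v := fun α =>
        α.hom.naturality v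
    exact (key α).trans ((congrArg (fun x : regularObj E ⟶ regularObj E => x ≫ v) h).trans
      (key β).symm)

/-- The identity functor is indecomposable if `A` is connected. -/
lemma trivIdem_unit (hconn : IsConnectedRing A) : TrivIdem (𝟙_ (ProjCat k E)) := by
  intro α hα
  obtain ⟨z, hz⟩ := exists_mulRight E (show regularObj E ⟶ regularObj E from α.hom.app (regularObj E))
  -- Naturality of α with respect to right multiplications is the statement that z is central.
  have hc : z ∈ Set.center A := by
    rw [Semigroup.mem_center_iff]
    intro b
    apply mulRight_injective E
    rw [← mulRight_comp, ← mulRight_comp, hz]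
    exact α.hom.naturality (mulRight E b)
  have hzz : IsIdempotentElem z := by
    apply mulRight_injective E
    rw [← mulRight_comp, hz]
    exact congrArg (fun β => β.hom.app (regularObj E)) hα
  rcases hconn.2 z hc hzz with rfl | rfl
  · left
    apply unit_hom_ext
    rw [mulRight_zero] at hz
    exact hz.symm
  · right
    apply unit_hom_ext
    rw [mulRight_one] at hz
    exact hz.symm

lemma not_isZero_unit [Nontrivial A] : ¬ IsZero (𝟙_ (ProjCat k E)) := by
  intro h
  rw [IsZero.iff_id_eq_zero] at h
  have h1 : 𝟙 (regularObj E) = 0 := congrArg (fun β => β.hom.app (regularObj E)) h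
  rw [← mulRight_one, ← mulRight_zero] at h1
  exact one_ne_zero (mulRight_injective E h1)

/-- If the identity functor is a direct summand of `A ⊗ -`, then `A` is semisimple. -/
lemma isSemisimpleRing_of_retract (h : Retract (𝟙_ (ProjCat k E)) (tensorA k E)) :
    IsSemisimpleRing A := by
  have hfin := finiteDimensional_hom k E
  refine isSemisimpleRing_of_projective fun I => ?_
  let N := E.inverse.obj (FGModuleCat.of A (A ⧸ I))
  -- If 𝟙 is a summand of T, then N is a summand of T N, which is a sum of copies of the regular
  -- module; so A / I is projective.
  have h1 : addClosure (fun X => X = regularObj E) N := by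
    refine addClosure_retract (Y := (tensorA k E).obj.obj N)
      ⟨h.i.hom.app N, h.r.hom.app N, congrArg (fun β => β.hom.app N) h.retract⟩ ?_
    exact addClosure_of_fintype (fun _ => regularObj E) (fun i => (copowerA k E).coord _)
      (fun i => (copowerA k E).lam _) (fun _ => rfl) ((copowerA k E).sum_coord_lam N)
  have h2 : addClosure (fun V : FGModuleCat.{u} A => Module.Projective A V.obj)
      (FGModuleCat.of A (A ⧸ I)) := by
    refine addClosure_retract (Retract.ofIso (E.counitIso.app _).symm)
      (addClosure_map E.functor (fun X hX => addClosure_of_mem ?_) h1)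
    rw [hX]
    let e := (E.counitIso.app (regular A))
    have : Module.Projective A (regular A).obj := inferInstanceAs (Module.Projective A A)
    exact Module.Projective.of_split (M := (regular A).obj) e.hom.hom.hom e.inv.hom.hom
      (congrArg (fun x => x.hom.hom) e.hom_inv_id)
  obtain ⟨n, V, p, q, hV, hpq⟩ := h2
  have : Module.Projective A (∀ i, (V i).obj) :=
    Module.Projective.of_equiv (DFinsupp.linearEquivFunOnFintype (R := A) (M := fun i => (V i).obj))
  refine Module.Projective.of_split (M := ∀ i, (V i).obj) (LinearMap.pi fun i => (p i).hom.hom)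
    (∑ i, (q i).hom.hom ∘ₗ LinearMap.proj i) (LinearMap.ext fun x => ?_)
  let φ : (FGModuleCat.of A (A ⧸ I) ⟶ FGModuleCat.of A (A ⧸ I)) →+ A ⧸ I :=
    AddMonoidHom.mk' (fun g => g.hom.hom x) fun g h => rfl
  have h3 := congrArg φ hpq
  rw [map_sum] at h3
  rw [LinearMap.comp_apply, LinearMap.sum_apply]
  exact h3

end Unit

/-! ### The functors Ae ⊗ eA and the left cells of summands of T. -/

section Summands

variable {k : Type*} [Field k] [IsAlgClosed k] {A : Type u} [Ring A] [Algebra k A]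
  [FiniteDimensional k A]
  {C : Type*} [Category* C] [Preadditive C] [Linear k C] (E : C ≌ FGModuleCat.{u} A)
  [E.functor.Additive] [E.functor.Linear k] [hfin : ∀ X Y : C, FiniteDimensional k (X ⟶ Y)]

lemma projMor_not_isZero {e : A} (he : IsIdempotentElem e) (he0 : e ≠ 0) :
    ¬ IsZero (projMor k E e e he he) := by
  intro h
  let c := copowerA k E
  let r := projMorRetract (k := k) E e e he he
  have h1 : mulRight E e ≫ c.lam (mulRight E e ≫ 𝟙 _) = 0 := by
    rw [← lam_projMorRetract k E he he, h.eq_of_tgt r.r 0, zero_comp]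
    exact comp_zero
  have hp : mulRight E e ≠ 0 := fun h0 => he0 (mulRight_injective E (h0.trans (mulRight_zero E).symm))
  rw [Category.comp_id] at h1
  -- The counit multiplies the two factors, so the vanishing of the idempotent gives e · e = 0.
  have h2 := congrArg (fun x => x ≫ (ProjCat.counit c).hom.app _) h1
  simp only [Category.assoc, zero_comp] at h2
  rw [ProjCat.lam_counit, mulRight_comp, he.eq] at h2
  exact hp h2

/-- The functor `A e ⊗ e A ⊗_A -` is a direct summand of a local direct summand of the coalgebra
`A ⊗ -`. -/
lemma exists_isLocal_projMor {e : A} (he : IsPrimitiveIdempotent e) :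
    ∃ (U : Coalg (copowerA k E) (ProjCat k E)) (i : U.pt ⟶ tensorA k E) (r : tensorA k E ⟶ U.pt),
      U.IsLocal ∧ r ≫ i = ProjCat.precomp (copowerA k E) (mulRight E e) ∧
      Nonempty (Retract (projMor k E e e he.1 he.1) U.pt) := by
  have hp : mulRight E e ≫ mulRight E e = mulRight E e := by rw [mulRight_comp, he.1.eq]
  obtain ⟨U, i, r, hU, hir, hri⟩ :=
    Coalg.exists_isLocal_of_primitive (copowerA k E) hp (primitive_mulRight E he)
  let s := projMorRetract (k := k) E e e he.1 he.1
  -- The coalgebra U is A ⊗ eA. The idempotent of Ae ⊗ eA cuts down both factors, so it is absorbed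
  -- by the one that cuts down only the second.
  have h1 : (s.r ≫ s.i) ≫ ProjCat.precomp (copowerA k E) (mulRight E e) = s.r ≫ s.i :=
    ProjCat.hom_ext_lam (copowerA k E) fun {N} v => by
      rw [ProjCat.comp_app, ← Category.assoc, lam_projMorRetract, Category.assoc,
        ProjCat.lam_precomp, reassoc_of% hp]
  have h2 : s.i ≫ r ≫ i = s.i := by
    have := congrArg (fun x => s.i ≫ x) h1
    simpa [← hri] using this
  exact ⟨U, i, r, hU, hri, ⟨⟨s.i ≫ r, i ≫ s.r, by
    rw [Category.assoc, ← Category.assoc r, ← Category.assoc s.i, h2, s.retract]⟩⟩⟩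

/-- Every indecomposable direct summand of `A ⊗ -` lies in the left cell of one of the functors
`A e i ⊗ e i A ⊗_A -`. -/
lemma exists_mem_leftCell_projMor {n : ℕ} {e : Fin n → A} (he : IsPrimitiveDecomposition e)
    (F : Ind (ProjCat k E) (ProjCat k E)) (hF : Nonempty (Retract F.1 (tensorA k E))) :
    ∃ i, F ∈ leftCell (projMor k E (e i) (e i) (he.primitive i).1 (he.primitive i).1) := by
  choose U i r hU hri hs using fun i => exists_isLocal_projMor (k := k) E (he.primitive i)
  -- The decomposition of 1 splits T = A ⊗ A into the local coalgebras A ⊗ e_j A, and F is a summand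
  -- of one of them.
  have h1 : addClosure (fun G => ∃ j, G = (U j).pt) (tensorA k E) := by
    refine addClosure_of_fintype (fun j => (U j).pt) r i (fun j => ⟨j, rfl⟩) ?_
    rw [Finset.sum_congr rfl fun j _ => hri j]
    have h2 : ∑ j, mulRight E (e j) = 𝟙 _ := by
      rw [← mulRight_one, ← he.complete.complete]
      exact (map_sum (mulRightHom E) e _).symm
    rw [← ProjCat.precomp_id, ← h2]
    exact (map_sum (ProjCat.precompHom (copowerA k E)) (fun j => mulRight E (e j)) _).symm
  obtain ⟨t⟩ := hF
  obtain ⟨_, ⟨j, rfl⟩, ⟨t'⟩⟩ :=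
    exists_retract_of_addClosure k F.2.trivIdem F.2.1 (addClosure_retract t h1)
  obtain ⟨s⟩ := hs j
  exact ⟨j, mem_leftCell_of_retract (copowerA k E) (addClosure_regularObj E) (hU j) s
    (projMor_not_isZero E _ (he.primitive j).2.1) t'⟩

lemma leftCell_projMor_nonempty {e : A} (he : IsPrimitiveIdempotent e) :
    (leftCell (projMor k E e e he.1 he.1)).Nonempty := by
  obtain ⟨U, -, -, hU, -, ⟨s⟩⟩ := exists_isLocal_projMor (k := k) E he
  exact leftCell_nonempty (copowerA k E) (addClosure_regularObj E) hU s
    (projMor_not_isZero E _ he.2.1)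

end Summands

end TwoRep

/-! ### The theorem. -/

open TwoRep

theorem proposition92
    {k : Type*} [Field k] [IsAlgClosed k]
    {A : Type u} [Ring A] [Algebra k A] [FiniteDimensional k A]
    {n : ℕ} (e : Fin n → A) (he : TwoRep.IsPrimitiveDecomposition e)
    (hbasic : TwoRep.IsBasic e) (hconn : TwoRep.IsConnectedRing A)
    (hsimple : ¬ IsSimpleRing A) (hinj : Module.Injective A A)
    {C : Type*} [Category* C] [Preadditive C] [Linear k C] (E : C ≌ FGModuleCat.{u} A)
    [E.functor.Additive] [E.functor.Linear k]
    {M : Type*} [Category* M] [Preadditive M] [Linear k M]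
    [MonoidalRightAction (TwoRep.ProjCat k E) M]
    [TwoRep.AdditiveAction (TwoRep.ProjCat k E) M] [TwoRep.LinearAction k (TwoRep.ProjCat k E) M]
    (hM : TwoRep.IsFinitary k M) :
    let 𝒞 := TwoRep.ProjCat k E
    let L₀ : Set (TwoRep.Ind 𝒞 𝒞) := TwoRep.leftCell (𝟙_ 𝒞)
    let L : Fin n → Set (TwoRep.Ind 𝒞 𝒞) := fun i =>
      TwoRep.leftCell (TwoRep.projMor k E (e i) (e i) (he.primitive i).1 (he.primitive i).1)
    (∃ V₀ V₁ : Set (TwoRep.Vertex 𝒞 M),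
      V₀ ∪ V₁ = Set.univ ∧ (TwoRep.diagram 𝒞 M).IsBipartiteWith V₀ V₁ ∧
      ∀ (Q : Set (TwoRep.Vertex 𝒞 M)) (ρ : TwoRep.Vertex 𝒞 M), IsUpperSet Q → Minimal (· ∈ Q) ρ →
        (ρ ∈ V₀ ↔ TwoRep.Equivalent k 𝒞 (TwoRep.SimpleSubquotient 𝒞 Q ρ) (TwoRep.CellRep L₀)) ∧
        ∀ i, (ρ ∈ V₁ ↔
          TwoRep.Equivalent k 𝒞 (TwoRep.SimpleSubquotient 𝒞 Q ρ) (TwoRep.CellRep (L i)))) ∧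
    ∀ ρ τ : TwoRep.Vertex 𝒞 M, ρ ⋖ τ → ∃ S : Set (Fin n), TwoRep.decoration 𝒞 ρ τ = ⋃ i ∈ S, L i := by
  intro 𝒞 L₀ L
  have hfin := finiteDimensional_hom k E
  have hfinM := hM.finiteDimensional_hom
  have := hM.isIdempotentComplete
  have := hconn.1
  let T : 𝒞 := tensorA k E
  let c := copowerA k E
  have hproj := addClosure_regularObj (k := k) E
  have hpr := addClosure_unit_tensorA (k := k) E
  have hTl := addClosure_tensorA_left (k := k) E
  have hTr := addClosure_tensorA_right (k := k) E
  have hunit : TrivIdem (𝟙_ 𝒞) := trivIdem_unit E hconn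
  have hunit0 : ¬ IsZero (𝟙_ 𝒞) := not_isZero_unit E
  have hretract : IsEmpty (Retract (𝟙_ 𝒞) T) := ⟨fun h => hsimple (by
    have := isSemisimpleRing_of_retract E h
    exact isSimpleRing_of_isConnectedRing hconn)⟩
  have hL₀ : IsTopSet L₀ L₀ := isTopSet_leftCell
    ⟨⟨𝟙_ 𝒞, isIndec_of_trivIdem hunit0 hunit⟩, ActsOnto.refl 𝒞 _, ActsOnto.refl 𝒞 _⟩
  have hL : ∀ i, IsTopSet (L i) (L i) := fun i =>
    isTopSet_leftCell (leftCell_projMor_nonempty E (he.primitive i))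
  have hLT : ∀ i, ∀ F ∈ L i, Nonempty (Retract F.1 T) := fun i F hF =>
    retract_of_mem_leftCell hTl (projMorRetract E (e i) (e i) _ _) hF
  have h0 : ¬ SetActsNonzero T L₀ := not_setActsNonzero_leftCell_unit hTl hTr hunit hunit0 hretract
  -- An element of L i is a summand of T, that is of T applied to 𝟙, so the reversal applies in the
  -- principal 2-representation.
  have h1 : ∀ i, SetActsNonzero T (L i) := fun i => by
    obtain ⟨F, hF⟩ := (hL i).nonempty
    obtain ⟨r⟩ := hLT i F hF
    exact setActsNonzero_of_retract c hproj (r.trans (Retract.ofIso (λ_ T).symm)) hF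
  -- The parts are defined by the vanishing of T on the vertex. This does not refer to Q, so the
  -- type of the subquotient depends on ρ alone.
  refine ⟨⟨{ρ | ¬ SetActsNonzero T (indOf 𝒞 {ρ})}, {ρ | SetActsNonzero T (indOf 𝒞 {ρ})}, ?_,
    ⟨?_, ?_⟩, ?_⟩, ?_⟩
  · ext ρ
    simp only [Set.mem_union, Set.mem_ofPred_eq, Set.mem_univ, iff_true]
    exact (em _).symm
  · exact Set.disjoint_left.2 fun ρ h h' => h h'
  · rintro ρ τ (h | h)
    · exact Or.inl (setActsNonzero_of_covBy c hproj hpr h)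
    · exact Or.inr (setActsNonzero_of_covBy c hproj hpr h).symm
  · intro Q ρ _ hρ
    have hR := isTopSet_simpleSubquotient hρ
    refine ⟨?_, fun i => ?_⟩
    · refine Iff.trans ?_ (subquotient_equivalent_iff c hproj hpr hTr hunit hR hL₀).symm
      exact (iff_false_right h0).symm
    · refine Iff.trans ?_ (subquotient_equivalent_iff c hproj hpr hTr hunit hR (hL i)).symm
      exact (iff_true_right (h1 i)).symm
  · intro ρ τ h
    exact exists_decoration_eq c hproj hpr hunit (fun i F hF F' hF' => (hL i).trans F hF F' hF') hLT
      (fun F hF => exists_mem_leftCell_projMor E he F hF) h
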